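/- Let $M$ be a smooth $n$-dimensional manifold and let $(\mathbf U,\langle\cdot,\cdot\rangle,f)$ be a sub-Riemannian structure on $M$: $\mathbf U\to M$ is a smooth vector bundle of finite rank with a smoothly varying scalar product on its fibres, and $f:\mathbf U\to TM$ is a smooth morphism of vector bundles over the identity of $M$. Let $\mathcal D=\{f\circ\sigma \mid \sigma \text{ smooth section of } \mathbf U\}$, $\mathcal D^0=0$, $\mathcal D^1=\mathcal D$, $\mathcal D^{i+1}=\mathcal D^i+[\mathcal D,\mathcal D^i]$ and $\mathcal D^i_q=\{X(q)\mid X\in\mathcal D^i\}$. Assume that $\mathcal D$ is Lie bracket generating, that is, for every $q\in M$ the values at $q$ of the Lie algebra of vector fields generated by $\mathcal D$ fill $T_qM$; let $r(q)$ be the first integer $r$ with $\mathcal D^{r}_q=T_qM$. Let $N\subset M$ be a connected (injectively immersed) smooth submanifold of dimension $k$ which is equisingular: for every $i$, the dimensions of $\mathcal D^i_p$ and of $\mathcal D^i_p\cap T_pN$ do not depend on $p\in N$. Assume that $N$ is oriented. For $p\in N$ and $i\ge 1$ let $$\pi_i:\otimes^i\mathbf U_p\to \mathcal D^i_p/\mathcal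 D^{i-1}_p,\qquad \pi_i(v_1\otimes\dots\otimes v_i)=[f(V_1),[f(V_2),\dots,f(V_i)]](p)\ \mathrm{mod}\ \mathcal D^{i-1}_p,$$ where $V_1,\dots,V_i$ are smooth sections of $\mathbf U$ with $V_j(p)=v_j$. Equip $\mathcal D^i_p/\mathcal D^{i-1}_p$ with the inner product whose norm is $|w|=\min\{|e| : \pi_i(e)=w\}$ (where $\langle v_1\otimes\dots\otimes v_i,w_1\otimes\dots\otimes w_i\rangle=\prod_j\langle v_j,w_j\rangle$ on $\otimes^i\mathbf U_p$), equip $\mathfrak{gr}_p(\mathcal D)=\bigoplus_{i=1}^{r(p)}\mathcal D^i_p/\mathcal D^{i-1}_p$ with the orthogonal sum, and equip its subspace $\mathfrak{gr}^N_p(\mathcal D)=\bigoplus_{i=1}^{r(p)}(\mathcal D^i_p\cap T_pN)/(\mathcal D^{i-1}_p\cap T_pN)$ with the restricted inner product. Let $\mathscr V^N_p\in\Lambda^k\mathfrak{gr}^N_p(\mathcal D)^*$ be the wedge product of the elements of the dual basis of an orthonormal basis of $\mathfrak{gr}^N_p(\mathcal D)$, and let $\theta^N_p:\Lambda^kT_p^*N\to\Lambda^k\mathfrak{gr}^N_p(\mathcal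 D)^*$ be the canonical isomorphism associated with the flag $(\mathcal D^i_p\cap T_pN)_i$ of $T_pN$, i.e. the pull-back along any linear map $s:\mathfrak{gr}^N_p(\mathcal D)\to T_pN$ that sends every class in $(\mathcal D^i_p\cap T_pN)/(\mathcal D^{i-1}_p\cap T_pN)$ to a representative of it. Then the maps $\pi_i$ are well defined and surjective, $\mathscr V^N_p$ is well defined up to a sign, and, when the sign of $\mathscr V^N_p$ is chosen so that $(\theta^N_p)^{-1}(\mathscr V^N_p)$ is positively oriented, $\varpi^N_p=(\theta^N_p)^{-1}(\mathscr V^N_p)$ is a smooth, nowhere vanishing, positively oriented $k$-form on $N$. Consequently Popp's measure of $N$, i.e. the measure $\mathscr P^N$ associated with $\varpi^N$, is a smooth volume on $N$: $\mathscr P^N(A)=\int_A\varpi^N$ for every Borel set $A\subset N$. -/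

import Mathlib

open Set Filter Topology MeasureTheory Module
open scoped Manifold ContDiff Bundle TensorProduct

attribute [-instance] TopCat.of.chartedSpace TopCat.of.hasGroupoid

set_option linter.unusedSectionVars false

noncomputable section

namespace SubRiem

section LinearAlgebra

variable {E : Type*} [AddCommGroup E] [Module ℝ E]

/-- The piece `F^{i+1} / F^i` of the graded space of a flag. -/
abbrev GradedPiece (F : ℕ → Submodule ℝ E) (i : ℕ) : Type _ :=
  F (i + 1) ⧸ (F i).submoduleOf (F (i + 1))

/-- The class in `F^{i+1} / F^i` of an element of `F^{i+1}`. -/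
abbrev gradedMk (F : ℕ → Submodule ℝ E) (i : ℕ) : F (i + 1) →ₗ[ℝ] GradedPiece F i :=
  ((F i).submoduleOf (F (i + 1))).mkQ

/-- The graded space `F^1/F^0 ⊕ ⋯ ⊕ F^r/F^{r-1}`. -/
abbrev Graded (F : ℕ → Submodule ℝ E) (r : ℕ) : Type _ :=
  ∀ i : Fin r, GradedPiece F i

/-- `{0} = F^0 ⊆ F^1 ⊆ ⋯ ⊆ F^r = E`. -/
structure IsFullFlag (F : ℕ → Submodule ℝ E) (r : ℕ) : Prop where
  zero : F 0 = ⊥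
  mono : Monotone F
  top : F r = ⊤

/-- `s : gr(F) → E` lifts every class of `F^{i+1}/F^i` to a representative of that class. -/
def IsSplitting (F : ℕ → Submodule ℝ E) (r : ℕ) (s : Graded F r →ₗ[ℝ] E) : Prop :=
  ∀ (i : Fin r) (v : F (i + 1)), s (Pi.single i (gradedMk F i v)) - (v : E) ∈ F i

theorem exists_splitting {F : ℕ → Submodule ℝ E} {r : ℕ} (h : IsFullFlag F r) :
    ∃ s : Graded F r ≃ₗ[ℝ] E, IsSplitting F r s.toLinearMap := by
  have hsec : ∀ i : ℕ, ∃ t : GradedPiece F i →ₗ[ℝ] F (i + 1), gradedMk F i ∘ₗ t = LinearMap.id :=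
    fun i => LinearMap.exists_rightInverse_of_surjective _
      (LinearMap.range_eq_top.2 (Submodule.mkQ_surjective _))
  choose t ht using hsec
  have ht' : ∀ i c, gradedMk F i (t i c) = c := fun i c => LinearMap.congr_fun (ht i) c
  have hmk : ∀ i (v : F (i + 1)), gradedMk F i v = 0 ↔ (v : E) ∈ F i := fun i v => by
    rw [gradedMk, Submodule.mkQ_apply, Submodule.Quotient.mk_eq_zero]
    exact Iff.rfl
  let s : Graded F r →ₗ[ℝ] E :=
    LinearMap.lsum ℝ (fun i : Fin r => GradedPiece F i) ℝ
      (fun i => (F (i + 1)).subtype ∘ₗ t i)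
  have hs : ∀ c : Graded F r, s c = ∑ i : Fin r, (t i (c i) : E) := fun c => by simp [s, LinearMap.lsum_apply]
  have hsingle : ∀ (i : Fin r) c, s (Pi.single i c) = t i c := fun i c => by
    rw [hs, Finset.sum_eq_single i]
    · simp
    · intro j _ hj
      simp [Pi.single_eq_of_ne hj]
    · simp
  have hsplit : IsSplitting F r s := fun i v => by
    rw [hsingle, ← Submodule.coe_sub, ← hmk, map_sub, ht', sub_self]
  have hinj : Function.Injective s := by
    rw [injective_iff_map_eq_zero]
    intro c hc
    by_contra hne
    classical
    have hex : (Finset.univ.filter fun i => c i ≠ 0).Nonempty := by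
      obtain ⟨i, hi⟩ := Function.ne_iff.1 hne
      exact ⟨i, by simpa using hi⟩
    set i := (Finset.univ.filter fun i => c i ≠ 0).max' hex with hi
    have him : c i ≠ 0 := (Finset.mem_filter.1 (Finset.max'_mem _ hex)).2
    have hgt : ∀ j, i < j → c j = 0 := fun j hj => by
      by_contra hcj
      exact absurd (Finset.le_max' _ j (by simpa using hcj)) (not_le.2 hj)
    apply him
    rw [← ht' i (c i), hmk]
    rw [hs, ← Finset.add_sum_erase _ _ (Finset.mem_univ i)] at hc
    rw [eq_neg_of_add_eq_zero_left hc]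
    refine (F i).neg_mem (Submodule.sum_mem _ fun j hj => ?_)
    rcases lt_trichotomy j i with hlt | heq | hlt
    · exact h.mono (Nat.succ_le_of_lt hlt) (t j (c j)).2
    · exact absurd heq (Finset.ne_of_mem_erase hj)
    · simp [hgt j hlt]
  have hsurj : ∀ m ≤ r, ∀ v ∈ F m, ∃ c, s c = v := by
    intro m
    induction m with
    | zero =>
      intro _ v hv
      rw [h.zero, Submodule.mem_bot] at hv
      exact ⟨0, by simp [hv]⟩
    | succ m ih =>
      intro hm v hv
      have hmem := hsplit ⟨m, hm⟩ ⟨v, hv⟩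
      obtain ⟨c, hc⟩ := ih (Nat.le_of_succ_le hm) _ hmem
      refine ⟨Pi.single ⟨m, hm⟩ (gradedMk F m ⟨v, hv⟩) - c, ?_⟩
      rw [map_sub, hc]
      simp
  refine ⟨LinearEquiv.ofBijective s ⟨hinj, fun v => ?_⟩, hsplit⟩
  exact hsurj r le_rfl v (by rw [h.top]; trivial)

/-- The canonical isomorphism `Λ^k E^* ≅ Λ^k gr(F)^*` for `k = dim E`: pull-back along a splitting
`gr(F) → E`. In top degree it does not depend on the splitting, see `flagIso_apply`. -/
def flagIso {F : ℕ → Submodule ℝ E} {r : ℕ} (h : IsFullFlag F r) (k : ℕ) :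
    (E [⋀^Fin k]→ₗ[ℝ] ℝ) ≃ₗ[ℝ] (Graded F r [⋀^Fin k]→ₗ[ℝ] ℝ) :=
  AlternatingMap.domLCongr ℝ ℝ (Fin k) ℝ (exists_splitting h).choose.symm

theorem flagIso_apply [FiniteDimensional ℝ E] {F : ℕ → Submodule ℝ E} {r : ℕ}
    (h : IsFullFlag F r) {k : ℕ} (hk : finrank ℝ E = k) {s : Graded F r →ₗ[ℝ] E}
    (hs : IsSplitting F r s) (η : E [⋀^Fin k]→ₗ[ℝ] ℝ) :
    flagIso h k η = η.compLinearMap s := by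
  set e := (exists_splitting h).choose with he
  have hes : IsSplitting F r e.toLinearMap := (exists_splitting h).choose_spec
  set N : E →ₗ[ℝ] E := s ∘ₗ e.symm.toLinearMap - LinearMap.id with hN
  have hpiece : ∀ (i : Fin r) c, s (Pi.single i c) - e (Pi.single i c) ∈ F i := fun i c => by
    obtain ⟨v, rfl⟩ := Submodule.mkQ_surjective _ c
    have h1 := (F i).sub_mem (hs i v) (hes i v)
    simpa using h1
  have hNmem : ∀ i, ∀ v ∈ F (i + 1), N v ∈ F i := by
    intro i
    induction i with
    | zero =>
      intro v hv
      by_cases hr : 0 < r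
      · have h0 := hes ⟨0, hr⟩ ⟨v, hv⟩
        have h1 := hpiece ⟨0, hr⟩ (gradedMk F 0 ⟨v, hv⟩)
        simp only [h.zero, Submodule.mem_bot] at h0 h1 ⊢
        have h2 : v = e (Pi.single ⟨0, hr⟩ (gradedMk F 0 ⟨v, hv⟩)) := (sub_eq_zero.1 h0).symm
        rw [h2]
        simpa [hN] using h1
      · have : F 0 = ⊤ := by
          rw [← h.top]
          congr 1
          omega
        rw [this]
        trivial
    | succ i ih =>
      intro v hv
      by_cases hr : i + 1 < r
      · have h0 := ih _ (hes ⟨i + 1, hr⟩ ⟨v, hv⟩)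
        have h1 := hpiece ⟨i + 1, hr⟩ (gradedMk F (i + 1) ⟨v, hv⟩)
        rw [map_sub] at h0
        have h3 := (F (i + 1)).sub_mem h1 (h.mono (Nat.le_succ i) h0)
        simpa [hN] using h3
      · have : F (i + 1) = ⊤ := eq_top_iff.2 (h.top ▸ h.mono (not_lt.1 hr))
        rw [this]
        trivial
  have hpow : ∀ i, ∀ v ∈ F i, (N ^ i) v = 0 := by
    intro i
    induction i with
    | zero =>
      intro v hv
      rw [h.zero, Submodule.mem_bot] at hv
      simp [hv]
    | succ i ih =>
      intro v hv
      rw [pow_succ, Module.End.mul_apply]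
      exact ih _ (hNmem i v hv)
  have hnil : IsNilpotent (-N) :=
    IsNilpotent.neg ⟨r, LinearMap.ext fun v => hpow r v (by rw [h.top]; trivial)⟩
  have hdet : LinearMap.det (s ∘ₗ e.symm.toLinearMap) = 1 := by
    have h1 := LinearMap.eval_charpoly (-N) 1
    rw [hnil.charpoly_eq_X_pow_finrank] at h1
    have h2 : s ∘ₗ e.symm.toLinearMap = algebraMap ℝ (E →ₗ[ℝ] E) 1 - -N := by
      rw [hN, map_one]
      ext v
      simp
    rw [h2, ← h1]
    simp
  let b : Basis (Fin k) ℝ E := (finBasis ℝ E).reindex (finCongr hk)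
  have hcomp : η.compLinearMap (s ∘ₗ e.symm.toLinearMap) = η := by
    ext v
    rw [AlternatingMap.eq_smul_basis_det b η]
    simp only [AlternatingMap.compLinearMap_apply, AlternatingMap.smul_apply]
    have := b.det_comp (s ∘ₗ e.symm.toLinearMap) v
    rw [hdet, one_mul] at this
    rw [← this]
    rfl
  ext v
  have h4 := congrArg (fun ζ => ζ (fun j => e (v j))) hcomp
  simp only [AlternatingMap.compLinearMap_apply, LinearMap.comp_apply, LinearEquiv.coe_coe,
    LinearEquiv.symm_apply_apply] at h4
  exact h4.symm

/-- The linear map `gr(φ⁻¹ F) → gr(F)` induced by `φ : E → E'`; it is injective, so that it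
identifies `gr(φ⁻¹ F)` with a subspace of `gr(F)`. -/
def gradedComap {E' : Type*} [AddCommGroup E'] [Module ℝ E'] (φ : E →ₗ[ℝ] E')
    (F : ℕ → Submodule ℝ E') (r : ℕ) :
    Graded (fun i => (F i).comap φ) r →ₗ[ℝ] Graded F r :=
  LinearMap.pi fun i =>
    (Submodule.mapQ (((F i).comap φ).submoduleOf ((F (i + 1)).comap φ))
      ((F i).submoduleOf (F (i + 1)))
      (φ.restrict (p := (F (i + 1)).comap φ) (q := F (i + 1)) fun _ hv => hv)
      (fun _ hv => hv)) ∘ₗ LinearMap.proj i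

/-- The inner product of `⊗^i V`:
`⟨v_1 ⊗ ⋯ ⊗ v_i, w_1 ⊗ ⋯ ⊗ w_i⟩ = ⟨v_1, w_1⟩ ⋯ ⟨v_i, w_i⟩`. -/
def tensorInner {V : Type*} [AddCommGroup V] [Module ℝ V] (g : V →ₗ[ℝ] V →ₗ[ℝ] ℝ) (i : ℕ) :
    (⨂[ℝ] _ : Fin i, V) →ₗ[ℝ] (⨂[ℝ] _ : Fin i, V) →ₗ[ℝ] ℝ :=
  PiTensorProduct.dualDistrib ∘ₗ PiTensorProduct.map fun _ => g

/-- `|w|² = min {|e|² : q e = w}`. -/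
def inducedNormSq {T V : Type*} [AddCommGroup T] [Module ℝ T] [AddCommGroup V] [Module ℝ V]
    (B : T →ₗ[ℝ] T →ₗ[ℝ] ℝ) (q : T →ₗ[ℝ] V) (w : V) : ℝ :=
  sInf {a | ∃ e, q e = w ∧ a = B e e}

/-- The inner product on `V` induced by a surjection `q : T → V` and the inner product `B` of `T`:
the one whose norm is `inducedNormSq`, by polarization. -/
def inducedInner {T V : Type*} [AddCommGroup T] [Module ℝ T] [AddCommGroup V] [Module ℝ V]
    (B : T →ₗ[ℝ] T →ₗ[ℝ] ℝ) (q : T →ₗ[ℝ] V) (w w' : V) : ℝ :=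
  (inducedNormSq B q (w + w') - inducedNormSq B q (w - w')) / 4

end LinearAlgebra

section Manifold

variable {n : ℕ} {M : Type*} [TopologicalSpace M] [ChartedSpace (EuclideanSpace ℝ (Fin n)) M]

variable (n M) in
/-- Vector fields on the `n`-manifold `M` (without regularity). -/
abbrev VField : Type _ := ∀ x : M, TangentSpace (𝓡 n) x

/-- Evaluation of vector fields at `x`. -/
abbrev evalAt (x : M) : VField n M →ₗ[ℝ] TangentSpace (𝓡 n) x := LinearMap.proj x

/-- The span of the brackets `[X, Y]` with `X ∈ A`, `Y ∈ B`. -/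
def bracketSpan (A B : Submodule ℝ (VField n M)) : Submodule ℝ (VField n M) :=
  Submodule.span ℝ {Z | ∃ X ∈ A, ∃ Y ∈ B, Z = VectorField.mlieBracket (𝓡 n) X Y}

/-- The Lie algebra of vector fields generated by `D`: the smallest space of vector fields that
contains `D` and is closed under brackets. -/
def lieHull (D : Submodule ℝ (VField n M)) : Submodule ℝ (VField n M) :=
  sInf {L | D ≤ L ∧ ∀ X ∈ L, ∀ Y ∈ L, VectorField.mlieBracket (𝓡 n) X Y ∈ L}

/-- `D^0 = 0`, `D^1 = D`, `D^{i+1} = D^i + [D, D^i]`. -/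
def derivedFlag (D : Submodule ℝ (VField n M)) : ℕ → Submodule ℝ (VField n M)
  | 0 => ⊥
  | 1 => D
  | i + 2 => derivedFlag D (i + 1) ⊔ bracketSpan D (derivedFlag D (i + 1))

variable {F : Type*} [NormedAddCommGroup F] [NormedSpace ℝ F]
  {U : M → Type*} [TopologicalSpace (Bundle.TotalSpace F U)]
  [∀ x, TopologicalSpace (U x)] [∀ x, AddCommGroup (U x)] [∀ x, Module ℝ (U x)]
  [FiberBundle F U] [VectorBundle ℝ F U]

variable (F) in
/-- The fields `f ∘ σ`, with `σ` a smooth section of the bundle `U`. -/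
def horizontalModule (f : ∀ x, U x →ₗ[ℝ] TangentSpace (𝓡 n) x) : Submodule ℝ (VField n M) :=
  LinearMap.range
    ({ toFun := fun σ x => f x (σ x)
       map_add' := fun σ τ => by ext1 x; simp
       map_smul' := fun c σ => by ext1 x; simp } :
      ContMDiffSection (𝓡 n) F ∞ U →ₗ[ℝ] VField n M)

theorem horizontalModule_contMDiff [IsManifold (𝓡 n) ∞ M]
    {f : ∀ x, U x →ₗ[ℝ] TangentSpace (𝓡 n) x}
    (hf : ContMDiff ((𝓡 n).prod 𝓘(ℝ, F)) (𝓡 n).tangent ∞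
      (fun u : Bundle.TotalSpace F U => (⟨u.1, f u.1 u.2⟩ : TangentBundle (𝓡 n) M)))
    {X : VField n M} (hX : X ∈ horizontalModule F f) :
    ContMDiff (𝓡 n) (𝓡 n).tangent ∞ (fun x => (⟨x, X x⟩ : TangentBundle (𝓡 n) M)) := by
  obtain ⟨σ, rfl⟩ := hX
  exact hf.comp σ.contMDiff

end Manifold

section Flag

variable {n : ℕ} {M : Type*} [TopologicalSpace M] [ChartedSpace (EuclideanSpace ℝ (Fin n)) M]

theorem derivedFlag_le_succ (D : Submodule ℝ (VField n M)) (i : ℕ) :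
    derivedFlag D i ≤ derivedFlag D (i + 1) := by
  cases i with
  | zero => exact bot_le
  | succ i => exact le_sup_left

theorem derivedFlag_mono (D : Submodule ℝ (VField n M)) : Monotone (derivedFlag D) :=
  monotone_nat_of_le_succ (derivedFlag_le_succ D)

theorem bracket_mem_derivedFlag {D : Submodule ℝ (VField n M)} {X Y : VField n M} {i : ℕ}
    (hX : X ∈ D) (hY : Y ∈ derivedFlag D (i + 1)) :
    VectorField.mlieBracket (𝓡 n) X Y ∈ derivedFlag D (i + 2) :=
  Submodule.mem_sup_right (Submodule.subset_span ⟨X, hX, Y, hY, rfl⟩)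

variable [IsManifold (𝓡 n) ∞ M]

theorem mlieBracket_smooth {X Y : VField n M}
    (hX : ContMDiff (𝓡 n) (𝓡 n).tangent ∞ (fun x => (⟨x, X x⟩ : TangentBundle (𝓡 n) M)))
    (hY : ContMDiff (𝓡 n) (𝓡 n).tangent ∞ (fun x => (⟨x, Y x⟩ : TangentBundle (𝓡 n) M))) :
    ContMDiff (𝓡 n) (𝓡 n).tangent ∞ (fun x =>
      (⟨x, VectorField.mlieBracket (𝓡 n) X Y x⟩ : TangentBundle (𝓡 n) M)) := fun x => by
  have : IsManifold (𝓡 n) (minSmoothness ℝ 2) M := by simp; infer_instance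
  have : IsManifold (𝓡 n) ((((⊤ : ℕ∞) : WithTop ℕ∞)) + 1) M := by
    simpa using (inferInstance : IsManifold (𝓡 n) ∞ M)
  exact ContMDiffAt.mlieBracket_vectorField (m := ⊤) (n := ⊤) (hX x) (hY x) (by simp)

theorem derivedFlag_smooth {D : Submodule ℝ (VField n M)}
    (hD : ∀ X ∈ D, ContMDiff (𝓡 n) (𝓡 n).tangent ∞
      (fun x => (⟨x, X x⟩ : TangentBundle (𝓡 n) M))) (i : ℕ) :
    ∀ X ∈ derivedFlag D i, ContMDiff (𝓡 n) (𝓡 n).tangent ∞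
      (fun x => (⟨x, X x⟩ : TangentBundle (𝓡 n) M)) := by
  let S : Submodule ℝ (VField n M) :=
    { carrier := {X | ContMDiff (𝓡 n) (𝓡 n).tangent ∞
        (fun x => (⟨x, X x⟩ : TangentBundle (𝓡 n) M))}
      add_mem' := fun hX hY => ContMDiff.add_section hX hY
      zero_mem' := (0 : ContMDiffSection (𝓡 n) (EuclideanSpace ℝ (Fin n)) ∞
        (fun x : M => TangentSpace (𝓡 n) x)).contMDiff
      smul_mem' := fun c _ hX => ContMDiff.const_smul_section (a := c) hX }
  suffices derivedFlag D i ≤ S from this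
  induction i using Nat.twoStepInduction with
  | zero => exact bot_le
  | one => exact hD
  | more i _ ih =>
    refine sup_le ih (Submodule.span_le.2 ?_)
    rintro _ ⟨X, hX, Y, hY, rfl⟩
    exact mlieBracket_smooth (hD X hX) (ih hY)

theorem derivedFlag_bracket {D : Submodule ℝ (VField n M)}
    (hD : ∀ X ∈ D, ContMDiff (𝓡 n) (𝓡 n).tangent ∞
      (fun x => (⟨x, X x⟩ : TangentBundle (𝓡 n) M))) (i : ℕ) :
    ∀ j, ∀ X ∈ derivedFlag D i, ∀ Y ∈ derivedFlag D j,
      VectorField.mlieBracket (𝓡 n) X Y ∈ derivedFlag D (i + j) := by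
  have hs := derivedFlag_smooth hD
  have two : (2 : WithTop ℕ∞) ≤ ∞ := (inferInstance : ENat.LEInfty 2).out
  have hmd : ∀ {X : VField n M} {i : ℕ}, X ∈ derivedFlag D i → ∀ x,
      MDifferentiableAt (𝓡 n) (𝓡 n).tangent (fun x => (⟨x, X x⟩ : TangentBundle (𝓡 n) M)) x :=
    fun hX x => (hs _ _ hX x).mdifferentiableAt (by simp)
  have : IsManifold (𝓡 n) (minSmoothness ℝ 2) M := by simp; infer_instance
  have : IsManifold (𝓡 n) (minSmoothness ℝ 3) M := by simp; infer_instance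
  induction i using Nat.twoStepInduction with
  | zero =>
    intro j X hX Y _
    rw [show X = 0 from hX, VectorField.mlieBracket_zero_left]
    exact Submodule.zero_mem _
  | one =>
    intro j X hX Y hY
    rcases j with _ | j
    · rw [show Y = 0 from hY, VectorField.mlieBracket_zero_right]
      exact Submodule.zero_mem _
    · rw [show 1 + (j + 1) = j + 2 by omega]
      exact bracket_mem_derivedFlag hX hY
  | more i _ ih =>
    intro j X hX Y hY
    rcases j with _ | j
    · rw [show Y = 0 from hY, VectorField.mlieBracket_zero_right]
      exact Submodule.zero_mem _
    obtain ⟨A, hA, B, hB, rfl⟩ := Submodule.mem_sup.1 hX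
    have hB' : B ∈ derivedFlag D (i + 2) := Submodule.mem_sup_right hB
    have hAB : VectorField.mlieBracket (𝓡 n) (A + B) Y
        = VectorField.mlieBracket (𝓡 n) A Y + VectorField.mlieBracket (𝓡 n) B Y := by
      ext1 x
      exact VectorField.mlieBracket_add_left (hmd hA x) (hmd hB' x)
    rw [hAB]
    refine Submodule.add_mem _ (derivedFlag_mono D (by omega) (ih _ A hA Y hY)) ?_
    clear hAB hX hA
    have key : ∀ Z ∈ bracketSpan D (derivedFlag D (i + 1)), Z ∈ derivedFlag D (i + 2) ∧
        VectorField.mlieBracket (𝓡 n) Z Y ∈ derivedFlag D (i + 2 + (j + 1)) := by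
      intro Z hZ
      refine ⟨Submodule.mem_sup_right hZ, ?_⟩
      induction hZ using Submodule.span_induction with
      | mem Z hZ =>
        obtain ⟨V, hV, W, hW, rfl⟩ := hZ
        have hV1 : V ∈ derivedFlag D 1 := hV
        have hJ := VectorField.leibniz_identity_mlieBracket (I := 𝓡 n) (U := V) (V := W) (W := Y)
          (by simpa using (hs _ _ hV1).of_le two) (by simpa using (hs _ _ hW).of_le two)
          (by simpa using (hs _ _ hY).of_le two)
        rw [← sub_eq_iff_eq_add] at hJ
        rw [← hJ]
        refine Submodule.sub_mem _ ?_ ?_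
        · have h1 := ih _ W hW Y hY
          rw [show i + 2 + (j + 1) = (i + 1 + j) + 2 by omega]
          exact bracket_mem_derivedFlag hV (by rwa [show i + 1 + j + 1 = i + 1 + (j + 1) by omega])
        · have h1 := bracket_mem_derivedFlag hV hY
          have h2 := ih _ W hW _ h1
          rwa [show i + 2 + (j + 1) = i + 1 + (j + 2) by omega]
      | zero =>
        rw [VectorField.mlieBracket_zero_left]
        exact Submodule.zero_mem _
      | add Z Z' hZ hZ' h1 h2 =>
        have h3 : VectorField.mlieBracket (𝓡 n) (Z + Z') Y
            = VectorField.mlieBracket (𝓡 n) Z Y + VectorField.mlieBracket (𝓡 n) Z' Y := by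
          ext1 x
          exact VectorField.mlieBracket_add_left
            (hmd (i := i + 2) (Submodule.mem_sup_right hZ) x)
            (hmd (i := i + 2) (Submodule.mem_sup_right hZ') x)
        rw [h3]
        exact Submodule.add_mem _ h1 h2
      | smul c Z hZ h1 =>
        have h3 : VectorField.mlieBracket (𝓡 n) (c • Z) Y
            = c • VectorField.mlieBracket (𝓡 n) Z Y := by
          ext1 x
          exact VectorField.mlieBracket_const_smul_left
            (hmd (i := i + 2) (Submodule.mem_sup_right hZ) x)
        rw [h3]
        exact Submodule.smul_mem _ _ h1
    exact (key B hB).2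

theorem lieHull_le_iSup {D : Submodule ℝ (VField n M)}
    (hD : ∀ X ∈ D, ContMDiff (𝓡 n) (𝓡 n).tangent ∞
      (fun x => (⟨x, X x⟩ : TangentBundle (𝓡 n) M))) :
    lieHull D ≤ ⨆ i, derivedFlag D i := by
  refine sInf_le ⟨le_iSup (derivedFlag D) 1, fun X hX Y hY => ?_⟩
  have hdir := (derivedFlag_mono D).directed_le
  obtain ⟨i, hi⟩ := (Submodule.mem_iSup_of_directed _ hdir).1 hX
  obtain ⟨j, hj⟩ := (Submodule.mem_iSup_of_directed _ hdir).1 hY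
  exact (le_iSup (derivedFlag D) (i + j)) (derivedFlag_bracket hD i j X hi Y hj)

end Flag

section Structure

variable (n : ℕ) (M : Type*) [TopologicalSpace M] [ChartedSpace (EuclideanSpace ℝ (Fin n)) M]
  [IsManifold (𝓡 n) ∞ M]
  (F : Type*) [NormedAddCommGroup F] [NormedSpace ℝ F]
  (U : M → Type*) [TopologicalSpace (Bundle.TotalSpace F U)]
  [∀ x, TopologicalSpace (U x)] [∀ x, AddCommGroup (U x)] [∀ x, Module ℝ (U x)]
  [∀ x, IsTopologicalAddGroup (U x)] [∀ x, ContinuousConstSMul ℝ (U x)]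
  [FiberBundle F U] [VectorBundle ℝ F U]

/-- A (Lie bracket generating) sub-Riemannian structure on the `n`-manifold `M`: a smoothly varying
scalar product on the fibres of the vector bundle `U`, and a smooth morphism of vector bundles
`f : U → TM` over the identity of `M`. -/
structure SubRiemannianStructure where
  metric : Bundle.ContMDiffRiemannianMetric (𝓡 n) ∞ F U
  f : ∀ x, U x →ₗ[ℝ] TangentSpace (𝓡 n) x
  smooth_f : ContMDiff ((𝓡 n).prod 𝓘(ℝ, F)) (𝓡 n).tangent ∞
    (fun u : Bundle.TotalSpace F U => (⟨u.1, f u.1 u.2⟩ : TangentBundle (𝓡 n) M))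
  bracket_generating : ∀ x : M, (lieHull (horizontalModule F f)).map (evalAt x) = ⊤

variable {n M F U}

namespace SubRiemannianStructure

variable (S : SubRiemannianStructure n M F U)

/-- The module `D` of horizontal vector fields. -/
def distribution : Submodule ℝ (VField n M) := horizontalModule F S.f

/-- `D^i_x`, the set of values at `x` of the fields in `D^i`. -/
def flagAt (x : M) (i : ℕ) : Submodule ℝ (TangentSpace (𝓡 n) x) :=
  (derivedFlag S.distribution i).map (evalAt x)

theorem flagAt_mono (x : M) : Monotone (S.flagAt x) :=
  fun _ _ h => Submodule.map_mono (derivedFlag_mono _ h)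

theorem exists_step (x : M) : ∃ r, S.flagAt x r = ⊤ := by
  have h1 : (⨆ i, S.flagAt x i) = ⊤ := by
    rw [eq_top_iff, ← S.bracket_generating x]
    refine (Submodule.map_mono
      (lieHull_le_iSup fun X hX => horizontalModule_contMDiff S.smooth_f hX)).trans ?_
    rw [Submodule.map_iSup]
    exact le_rfl
  have hfin : FiniteDimensional ℝ (TangentSpace (𝓡 n) x) :=
    inferInstanceAs (FiniteDimensional ℝ (EuclideanSpace ℝ (Fin n)))
  obtain ⟨r, hr⟩ := monotone_stabilizes_iff_noetherian.2
    (inferInstance : IsNoetherian ℝ (TangentSpace (𝓡 n) x)) ⟨S.flagAt x, S.flagAt_mono x⟩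
  refine ⟨r, eq_top_iff.2 ?_⟩
  rw [← h1]
  refine iSup_le fun i => ?_
  rcases le_total r i with hi | hi
  · exact (hr i hi).ge
  · exact S.flagAt_mono x hi

open Classical in
/-- `r(x)`, the first integer such that `D^r_x = T_x M`. -/
def step (x : M) : ℕ := Nat.find (S.exists_step x)

theorem isFullFlag_flagAt (x : M) : IsFullFlag (S.flagAt x) (S.step x) where
  zero := by simp [flagAt, derivedFlag]
  mono := S.flagAt_mono x
  top := by
    classical
    exact Nat.find_spec (S.exists_step x)

/-- The field `[f(V_0), [f(V_1), …, [f(V_{i-1}), f(V_i)]]]`. -/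
def iteratedBracket : ∀ i : ℕ, (Fin (i + 1) → ContMDiffSection (𝓡 n) F ∞ U) → VField n M
  | 0, V => fun x => S.f x (V 0 x)
  | i + 1, V => VectorField.mlieBracket (𝓡 n) (fun x => S.f x (V 0 x))
      (iteratedBracket i (Fin.tail V))

theorem iteratedBracket_mem (i : ℕ) (V : Fin (i + 1) → ContMDiffSection (𝓡 n) F ∞ U) (x : M) :
    S.iteratedBracket i V x ∈ S.flagAt x (i + 1) := by
  suffices S.iteratedBracket i V ∈ derivedFlag S.distribution (i + 1) from ⟨_, this, rfl⟩
  induction i with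
  | zero => exact ⟨V 0, rfl⟩
  | succ i ih => exact bracket_mem_derivedFlag ⟨V 0, rfl⟩ (ih _)

/-- The property defining the map `π_{i+1} : ⊗^{i+1} U_x → D^{i+1}_x / D^i_x`:
`π (v_0 ⊗ ⋯ ⊗ v_i) = [f(V_0), [f(V_1), …, f(V_i)]](x) mod D^i_x`
whenever `V_0, …, V_i` are smooth sections of `U` with `V_j(x) = v_j`. -/
def IsBracketMap (x : M) (i : ℕ)
    (L : (⨂[ℝ] _ : Fin (i + 1), U x) →ₗ[ℝ] GradedPiece (S.flagAt x) i) : Prop :=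
  ∀ V : Fin (i + 1) → ContMDiffSection (𝓡 n) F ∞ U,
    L (PiTensorProduct.tprod ℝ fun j => V j x) =
      gradedMk (S.flagAt x) i ⟨S.iteratedBracket i V x, S.iteratedBracket_mem i V x⟩

open Classical in
/-- The map `π_{i+1} : ⊗^{i+1} U_x → D^{i+1}_x / D^i_x`. -/
def bracketMap (x : M) (i : ℕ) :
    (⨂[ℝ] _ : Fin (i + 1), U x) →ₗ[ℝ] GradedPiece (S.flagAt x) i :=
  if h : ∃ L, S.IsBracketMap x i L then h.choose else 0

/-- The inner product on `gr_x(D)`, the orthogonal sum of the inner products that the maps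
`π_1, …, π_r` induce on the pieces `D^{i+1}_x / D^i_x`. -/
def gradedInner (x : M) (u v : Graded (S.flagAt x) (S.step x)) : ℝ :=
  ∑ i : Fin (S.step x),
    inducedInner (tensorInner (ContinuousLinearMap.toLinearMap₁₂ (S.metric.inner x)) (i + 1))
      (S.bracketMap x i) (u i) (v i)

end SubRiemannianStructure

end Structure

section Forms

variable {k : ℕ} {N : Type*} [TopologicalSpace N] [ChartedSpace (EuclideanSpace ℝ (Fin k)) N]

variable (k N) in
/-- Differential forms of degree `k` on the `k`-manifold `N` (without regularity). -/
abbrev TopForm : Type _ := ∀ p : N, TangentSpace (𝓡 k) p [⋀^Fin k]→ₗ[ℝ] ℝ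

variable (k N) in
/-- A choice of an orientation of every tangent space. -/
abbrev PointwiseOrientation : Type _ := ∀ p : N, Orientation ℝ (TangentSpace (𝓡 k) p) (Fin k)

/-- The form `η` is nonzero and belongs to the orientation `o`. -/
def IsPositive {V : Type*} [AddCommGroup V] [Module ℝ V] (o : Orientation ℝ V (Fin k))
    (η : V [⋀^Fin k]→ₗ[ℝ] ℝ) : Prop :=
  ∃ h : η ≠ 0, rayOfNeZero ℝ η h = o

/-- `o` is an orientation of the manifold `N`: it is locally constant in charts. -/
def IsOrientation (o : PointwiseOrientation k N) : Prop :=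
  ∀ p : N, ∃ c : EuclideanSpace ℝ (Fin k) [⋀^Fin k]→ₗ[ℝ] ℝ, ∀ᶠ q in 𝓝 p,
    IsPositive (o q) (c.compLinearMap
      (mfderiv (𝓡 k) (𝓡 k) (chartAt (EuclideanSpace ℝ (Fin k)) p) q).toLinearMap)

/-- The coefficient `α(∂_1, …, ∂_k)` of `α` in the chart `e`, as a function on the target of `e`. -/
def formCoeff (α : TopForm k N) (e : OpenPartialHomeomorph N (EuclideanSpace ℝ (Fin k)))
    (y : EuclideanSpace ℝ (Fin k)) : ℝ :=
  α (e.symm y) fun j => mfderiv (𝓡 k) (𝓡 k) e.symm y (EuclideanSpace.single j (1 : ℝ))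

/-- A smooth, non-degenerate and positively oriented form of top degree. -/
structure IsVolumeForm (o : PointwiseOrientation k N) (α : TopForm k N) : Prop where
  smooth : ∀ e ∈ IsManifold.maximalAtlas (𝓡 k) ∞ N, ContDiffOn ℝ ∞ (formCoeff α e) e.target
  positive : ∀ p, IsPositive (o p) (α p)

variable [MeasurableSpace N]

/-- `μ(A) = ∫_A α`, for `N` oriented by `α`: in every smooth chart, `μ` has density
`|α(∂_1, …, ∂_k)|` with respect to Lebesgue measure. -/
def IsFormMeasure (α : TopForm k N) (μ : Measure N) : Prop :=
  ∀ e ∈ IsManifold.maximalAtlas (𝓡 k) ∞ N, ∀ A ⊆ e.source, MeasurableSet A →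
    μ A = ∫⁻ y in e '' A, ENNReal.ofReal |formCoeff α e y|

/-- `μ` is a smooth volume on the manifold `N` oriented by `o`. -/
def IsSmoothVolume (o : PointwiseOrientation k N) (μ : Measure N) : Prop :=
  ∃ α : TopForm k N, IsVolumeForm o α ∧ IsFormMeasure α μ

/-- The measure associated with `α`, glued from the measures `|α(∂_1, …, ∂_k)| dy` of the smooth
charts: the least measure that is, on every chart domain, at least the one of the chart. -/
def formMeasure (α : TopForm k N) : Measure N :=
  ⨆ e ∈ IsManifold.maximalAtlas (𝓡 k) ∞ N,
    ((volume.restrict e.target).withDensity fun y => ENNReal.ofReal |formCoeff α e y|).map e.symm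

end Forms

section Popp

variable {n : ℕ} {M : Type*} [TopologicalSpace M] [ChartedSpace (EuclideanSpace ℝ (Fin n)) M]
  [IsManifold (𝓡 n) ∞ M]
  {F : Type*} [NormedAddCommGroup F] [NormedSpace ℝ F]
  {U : M → Type*} [TopologicalSpace (Bundle.TotalSpace F U)]
  [∀ x, TopologicalSpace (U x)] [∀ x, AddCommGroup (U x)] [∀ x, Module ℝ (U x)]
  [∀ x, IsTopologicalAddGroup (U x)] [∀ x, ContinuousConstSMul ℝ (U x)]
  [FiberBundle F U] [VectorBundle ℝ F U]
  {k : ℕ} {N : Type*} [TopologicalSpace N] [ChartedSpace (EuclideanSpace ℝ (Fin k)) N]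

/-- The differential `T_p N → T_{ι p} M`. -/
abbrev tangentIncl (ι : N → M) (p : N) :
    TangentSpace (𝓡 k) p →ₗ[ℝ] TangentSpace (𝓡 n) (ι p) :=
  (mfderiv (𝓡 k) (𝓡 n) ι p).toLinearMap

/-- The flag `D^i_p ∩ T_p N` of the submanifold `ι : N → M`, as a flag of subspaces of `T_p N`. -/
def restrictedFlag (S : SubRiemannianStructure n M F U) (ι : N → M) (p : N) (i : ℕ) :
    Submodule ℝ (TangentSpace (𝓡 k) p) :=
  (S.flagAt (ι p) i).comap (tangentIncl ι p)

/-- `ι : N → M` is an equisingular submanifold: an injective immersion of the connected manifold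
`N` such that the dimensions of `D^i_p` and of `D^i_p ∩ T_p N` do not depend on `p ∈ N`. -/
structure IsEquisingular (S : SubRiemannianStructure n M F U) (ι : N → M) : Prop where
  connected : ConnectedSpace N
  smooth : ContMDiff (𝓡 k) (𝓡 n) ∞ ι
  injective : Function.Injective ι
  immersion : ∀ p, Function.Injective (mfderiv (𝓡 k) (𝓡 n) ι p)
  finrank_flag : ∀ i p q, finrank ℝ (S.flagAt (ι p) i) = finrank ℝ (S.flagAt (ι q) i)
  finrank_restrictedFlag : ∀ i (p q : N),
    finrank ℝ (restrictedFlag (k := k) S ι p i) = finrank ℝ (restrictedFlag (k := k) S ι q i)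

variable {S : SubRiemannianStructure n M F U} {ι : N → M}

theorem IsEquisingular.isFullFlag (hN : IsEquisingular (k := k) S ι) (p : N) :
    IsFullFlag (restrictedFlag (k := k) S ι p) (S.step (ι p)) where
  zero := by
    rw [restrictedFlag, (S.isFullFlag_flagAt (ι p)).zero, Submodule.comap_bot,
      LinearMap.ker_eq_bot]
    exact hN.immersion p
  mono := fun _ _ h => Submodule.comap_mono (S.flagAt_mono _ h)
  top := by rw [restrictedFlag, (S.isFullFlag_flagAt (ι p)).top, Submodule.comap_top]

variable (S ι) in
/-- The graded space `gr^N_p(D)`. -/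
abbrev restrictedGraded (p : N) : Type _ :=
  Graded (restrictedFlag (k := k) S ι p) (S.step (ι p))

variable (S ι) in
/-- The inner product on `gr^N_p(D)`: the restriction of the one of `gr_p(D)`. -/
def restrictedInner (p : N) (u v : restrictedGraded (k := k) S ι p) : ℝ :=
  S.gradedInner (ι p) (gradedComap (tangentIncl ι p) (S.flagAt (ι p)) _ u)
    (gradedComap (tangentIncl ι p) (S.flagAt (ι p)) _ v)

variable (S ι) in
/-- `b` is an orthonormal basis of `gr^N_p(D)`. -/
def IsOrthonormalBasis (p : N) (b : Basis (Fin k) ℝ (restrictedGraded (k := k) S ι p)) : Prop :=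
  ∀ i j, restrictedInner (k := k) S ι p (b i) (b j) = if i = j then 1 else 0

variable (S ι) in
/-- `v` is the element `𝒱^N_p` (or its opposite): the wedge product of the elements of the dual
basis of an orthonormal basis of `gr^N_p(D)`. -/
def IsVolumeElement (p : N) (v : restrictedGraded (k := k) S ι p [⋀^Fin k]→ₗ[ℝ] ℝ) : Prop :=
  ∃ b, IsOrthonormalBasis S ι p b ∧ (v = b.det ∨ v = -b.det)

/-- The isomorphism `θ^N_p : Λ^k T_p^*N → Λ^k gr^N_p(D)^*`. -/
def thetaN (hN : IsEquisingular (k := k) S ι) (p : N) :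
    (TangentSpace (𝓡 k) p [⋀^Fin k]→ₗ[ℝ] ℝ) ≃ₗ[ℝ]
      (restrictedGraded (k := k) S ι p [⋀^Fin k]→ₗ[ℝ] ℝ) :=
  flagIso (hN.isFullFlag p) k

open Classical in
/-- The form `p ↦ (θ^N_p)⁻¹(𝒱^N_p)`, with the sign of `𝒱^N_p` fixed by the orientation of `N`. -/
def poppForm (hN : IsEquisingular (k := k) S ι) (o : PointwiseOrientation k N) : TopForm k N :=
  fun p =>
    if h : ∃ v, IsVolumeElement S ι p v ∧ IsPositive (o p) ((thetaN hN p).symm v) then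
      (thetaN hN p).symm h.choose
    else 0

/-- The measure `𝒫^N`. -/
def poppMeasure [MeasurableSpace N] (hN : IsEquisingular (k := k) S ι)
    (o : PointwiseOrientation k N) : Measure N :=
  formMeasure (poppForm hN o)

end Popp

end SubRiem

end

/-! The bracket maps. The module `D` is closed under multiplication by smooth functions, and by the
Leibniz rule so is every `D^i`. If one of the sections `V_j` vanishes at `x`, it is a sum of
sections with coefficients in the ideal `I_x` of functions vanishing at `x`. Each time such a
coefficient is pulled out of a bracket, its derivative multiplies a shorter bracket, so the iterated
bracket lies in `I_x D^{i+1} + D^i` (`iteratedBracket_mem_vanishingModule`) and its value at `x`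
lies in `D^i_x`. The class of the bracket therefore depends only on the values `V_j(x)`.
Surjectivity holds because right-nested brackets span `D^{i+1}` modulo `D^i`
(`derivedFlag_succ_le`). Two orthonormal bases differ by an orthogonal matrix, whence the volume
element up to sign.

Smoothness of the form. Instead of smooth adapted frames, the proof computes the square of the form
by dilations. Near a point of `N` take a frame of `U`. Let `A` be the matrix, in coordinates of `M`,
of all iterated brackets of frame sections of length at most `r`, and `Γ` the inverse Gram matrix of
the corresponding tensors. Multiply every column by `ε` to the power of its length and put `H(ε) =
A_ε Γ A_ε^T`. In adapted orthonormal coordinates, given by a matrix `P`, the dilated `H(ε)` tends to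
the identity as `ε → 0`. With `Q` and `Q_N` the homogeneous dimensions of the two flags and `W` the
coordinates of `k` vectors `w` tangent to `N`, this gives `ε^{-2Q} det H(ε) → δ = (det P)^{-2}` and
`ε^{2Q_N - 2Qk} det(W^T adj(H(ε)) W) → ϖ(w)^2 δ^k`. Both determinants are polynomials in `ε`, so the
limits are coefficients of these polynomials, that is, polynomial expressions in the entries of `A`,
`Γ` and `W` (`coeff_gramDet_eq`). Equisingularity makes `r`, `Q` and `Q_N` constant along `N`, so
the same coefficients serve at all nearby points, and `ϖ(w)^2` is a quotient of smooth functions.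
The orientation then selects a smooth square root (`contDiffAt_formCoeff_of_sq`).

The measure. The chart densities agree on overlaps by the change of variables formula, so the
supremum of the chart measures restricts to the right measure on every chart domain
(`isFormMeasure_formMeasure`). -/

noncomputable section

namespace SubRiem

/-! ### Scalar products, induced norms and Gram matrices -/

section BilinearForms

variable {V : Type*} [AddCommGroup V] [Module ℝ V]

/-- A scalar product on a real vector space. -/
structure IsScalarProduct (B : V →ₗ[ℝ] V →ₗ[ℝ] ℝ) : Prop where
  symm : ∀ v w, B v w = B w v
  pos : ∀ v, v ≠ 0 → 0 < B v v

theorem IsScalarProduct.nonneg {B : V →ₗ[ℝ] V →ₗ[ℝ] ℝ} (hB : IsScalarProduct B) (v : V) :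
    0 ≤ B v v := by
  by_cases h : v = 0
  · simp [h]
  · exact (hB.pos v h).le

/-- The inner product space structure given by a scalar product. -/
abbrev IsScalarProduct.core {B : V →ₗ[ℝ] V →ₗ[ℝ] ℝ} (hB : IsScalarProduct B) :
    InnerProductSpace.Core ℝ V where
  inner v w := B v w
  conj_inner_symm v w := by simpa using hB.symm w v
  re_inner_nonneg v := by simpa using hB.nonneg v
  add_left u v w := by simp
  smul_left v w r := by simp
  definite v h := by
    by_contra hv
    exact (hB.pos v hv).ne' h

theorem IsScalarProduct.exists_orthonormal_basis [FiniteDimensional ℝ V]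
    {B : V →ₗ[ℝ] V →ₗ[ℝ] ℝ} (hB : IsScalarProduct B) :
    ∃ b : Basis (Fin (finrank ℝ V)) ℝ V, ∀ i j, B (b i) (b j) = if i = j then 1 else 0 := by
  let _ : NormedAddCommGroup V := hB.core.toNormedAddCommGroup
  let _ : InnerProductSpace ℝ V := InnerProductSpace.ofCore hB.core.toCore
  refine ⟨(stdOrthonormalBasis ℝ V).toBasis, fun i j => ?_⟩
  have := orthonormal_iff_ite.1 (stdOrthonormalBasis ℝ V).orthonormal i j
  rw [OrthonormalBasis.coe_toBasis]
  exact this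

theorem apply_eq_sum_of_orthonormal {κ : Type*} [Fintype κ] [DecidableEq κ]
    {B : V →ₗ[ℝ] V →ₗ[ℝ] ℝ} {b : Basis κ ℝ V}
    (hb : ∀ i j, B (b i) (b j) = if i = j then 1 else 0) (v w : V) :
    B v w = ∑ i, b.repr v i * b.repr w i := by
  conv_lhs => rw [← b.sum_repr v, ← b.sum_repr w]
  simp only [map_sum, map_smul, LinearMap.sum_apply, LinearMap.smul_apply, hb, smul_eq_mul]
  refine Finset.sum_congr rfl fun i _ => ?_
  simp [mul_comm]

theorem isScalarProduct_of_orthonormal {κ : Type*} [Fintype κ] [DecidableEq κ]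
    {B : V →ₗ[ℝ] V →ₗ[ℝ] ℝ} {b : Basis κ ℝ V}
    (hb : ∀ i j, B (b i) (b j) = if i = j then 1 else 0) : IsScalarProduct B where
  symm v w := by
    simp_rw [apply_eq_sum_of_orthonormal hb, mul_comm]
  pos v hv := by
    rw [apply_eq_sum_of_orthonormal hb]
    refine lt_of_le_of_ne (Finset.sum_nonneg fun i _ => mul_self_nonneg _) fun h => hv ?_
    rw [eq_comm, Finset.sum_eq_zero_iff_of_nonneg fun i _ => mul_self_nonneg _] at h
    exact b.ext_elem fun i => by simpa using h i (Finset.mem_univ i)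

theorem tensorInner_tprod (g : V →ₗ[ℝ] V →ₗ[ℝ] ℝ) (i : ℕ) (v w : Fin i → V) :
    tensorInner g i (PiTensorProduct.tprod ℝ v) (PiTensorProduct.tprod ℝ w)
      = ∏ j, g (v j) (w j) := by
  simp [tensorInner, PiTensorProduct.map_tprod, PiTensorProduct.dualDistrib_apply]

/-- The pure tensors in an orthonormal basis of `V` are orthonormal, and a form with an orthonormal
basis is positive definite. -/
theorem isScalarProduct_tensorInner [FiniteDimensional ℝ V] {g : V →ₗ[ℝ] V →ₗ[ℝ] ℝ}
    (hg : IsScalarProduct g) (i : ℕ) : IsScalarProduct (tensorInner g i) := by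
  classical
  obtain ⟨b, hb⟩ := hg.exists_orthonormal_basis
  refine isScalarProduct_of_orthonormal (b := Basis.piTensorProduct fun _ : Fin i => b)
    fun p q => ?_
  rw [Basis.piTensorProduct_apply, Basis.piTensorProduct_apply, tensorInner_tprod]
  simp_rw [hb]
  rw [Finset.prod_ite_zero]
  simp [funext_iff]

/-- Projecting any linear right inverse of `q` onto the orthogonal complement of the kernel changes
it only by kernel elements. The result picks the lift of minimal norm. -/
theorem exists_adjoint_section {T : Type*} [AddCommGroup T] [Module ℝ T] [FiniteDimensional ℝ T]
    {B : T →ₗ[ℝ] T →ₗ[ℝ] ℝ} (hB : IsScalarProduct B) {q : T →ₗ[ℝ] V}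
    (hq : Function.Surjective q) :
    ∃ s : V →ₗ[ℝ] T, (∀ w, q (s w) = w) ∧ ∀ w t, q t = 0 → B (s w) t = 0 := by
  let _ : NormedAddCommGroup T := hB.core.toNormedAddCommGroup
  let _ : InnerProductSpace ℝ T := InnerProductSpace.ofCore hB.core.toCore
  obtain ⟨t₀, ht₀⟩ := LinearMap.exists_rightInverse_of_surjective q (LinearMap.range_eq_top.2 hq)
  have ht₀' : ∀ w, q (t₀ w) = w := fun w => LinearMap.congr_fun ht₀ w
  refine ⟨(LinearMap.ker q)ᗮ.starProjection.toLinearMap ∘ₗ t₀, fun w => ?_, fun w t ht => ?_⟩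
  · have h : t₀ w - (LinearMap.ker q)ᗮ.starProjection (t₀ w) ∈ LinearMap.ker q := by
      have := Submodule.sub_starProjection_mem_orthogonal (K := (LinearMap.ker q)ᗮ) (t₀ w)
      rwa [Submodule.orthogonal_orthogonal] at this
    rw [LinearMap.mem_ker, map_sub, ht₀', sub_eq_zero] at h
    exact h.symm
  · have := Submodule.starProjection_apply_mem (LinearMap.ker q)ᗮ (t₀ w)
    rw [Submodule.mem_orthogonal'] at this
    exact this t ht

/-- The form induced by a scalar product along a surjection is a scalar product. -/
theorem exists_inducedInner {T : Type*} [AddCommGroup T] [Module ℝ T] [FiniteDimensional ℝ T]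
    {B : T →ₗ[ℝ] T →ₗ[ℝ] ℝ} (hB : IsScalarProduct B) {q : T →ₗ[ℝ] V}
    (hq : Function.Surjective q) :
    ∃ C : V →ₗ[ℝ] V →ₗ[ℝ] ℝ, IsScalarProduct C ∧ (∀ w w', inducedInner B q w w' = C w w') ∧
      ∃ s : V →ₗ[ℝ] T, (∀ w, q (s w) = w) ∧ ∀ w t, B (s w) t = C w (q t) := by
  obtain ⟨s, hs, ho⟩ := exists_adjoint_section hB hq
  have hadj : ∀ w t, B (s w) t = B (s w) (s (q t)) := fun w t => by
    rw [← sub_eq_zero, ← map_sub]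
    exact ho w _ (by rw [map_sub, hs, sub_self])
  -- Pythagoras: `e - s (q e)` is orthogonal to `s (q e)`, so the infimum is attained at `s w`. The
  -- norm is thus quadratic in `w`, and polarization returns the bilinear form.
  have hnorm : ∀ w, inducedNormSq B q w = B (s w) (s w) := fun w => by
    refine IsLeast.csInf_eq ⟨⟨s w, hs w, rfl⟩, ?_⟩
    rintro _ ⟨e, rfl, rfl⟩
    have h1 := hB.nonneg (e - s (q e))
    have h2 := hadj (q e) e
    have h3 := hB.symm e (s (q e))
    simp only [map_sub, LinearMap.sub_apply] at h1
    linarith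
  refine ⟨B.compl₁₂ s s, ⟨fun v w => hB.symm _ _, fun v hv => hB.pos _ fun h => hv ?_⟩,
    fun w w' => ?_, s, hs, hadj⟩
  · rw [← hs v, h, map_zero]
  · have h3 := hB.symm (s w) (s w')
    rw [inducedInner, hnorm, hnorm]
    simp only [map_sub, map_add, LinearMap.sub_apply, LinearMap.add_apply,
      LinearMap.compl₁₂_apply]
    linarith

/-- The Gram matrix of a basis. -/
def gramMatrix {T κ : Type*} [AddCommGroup T] [Module ℝ T] (B : T →ₗ[ℝ] T →ₗ[ℝ] ℝ) (e : κ → T) :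
    Matrix κ κ ℝ :=
  Matrix.of fun i j => B (e i) (e j)

/-- A kernel vector `c` of the Gram matrix would give a nonzero vector `∑ c i • e i` of zero norm.
-/
theorem gramMatrix_det_ne_zero {κ : Type*} [Fintype κ] [DecidableEq κ]
    {B : V →ₗ[ℝ] V →ₗ[ℝ] ℝ} (hB : IsScalarProduct B) (e : Basis κ ℝ V) :
    (gramMatrix B e).det ≠ 0 := by
  intro h
  obtain ⟨c, hc, h0⟩ := Matrix.exists_mulVec_eq_zero_iff.2 h
  have h1 : B (∑ i, c i • e i) (∑ i, c i • e i) = 0 := by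
    have h2 : ∀ i, B (e i) (∑ j, c j • e j) = 0 := fun i => by
      have := congrFun h0 i
      simp only [Matrix.mulVec, dotProduct, gramMatrix, Matrix.of_apply, Pi.zero_apply] at this
      simpa [mul_comm] using this
    rw [map_sum B, LinearMap.sum_apply]
    exact Finset.sum_eq_zero fun i _ => by rw [map_smul, LinearMap.smul_apply, h2, smul_zero]
  by_cases hv : ∑ i, c i • e i = 0
  · exact hc (funext fun i => Fintype.linearIndependent_iff.1 e.linearIndependent c hv i)
  · exact (hB.pos _ hv).ne' h1

/-- The inverse Gram matrix is the dual metric of `T`; its push-forward under `q` is the dual of the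
induced metric `C`, hence the identity in a `C`-orthonormal basis. Concretely, if `σ` is the matrix
of the lift `s` and `G` the Gram matrix, adjointness says `G σ = A^T` and the section property says
`A σ = 1`. -/
theorem coordinates_cometric {T κ μ : Type*} [AddCommGroup T] [Module ℝ T]
    [Fintype κ] [DecidableEq κ] [Fintype μ] [DecidableEq μ]
    {B : T →ₗ[ℝ] T →ₗ[ℝ] ℝ} (hB : IsScalarProduct B) {q : T →ₗ[ℝ] V}
    {C : V →ₗ[ℝ] V →ₗ[ℝ] ℝ} {s : V →ₗ[ℝ] T} (hs : ∀ w, q (s w) = w)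
    (hadj : ∀ w t, B (s w) t = C w (q t)) (e : Basis κ ℝ T) (c : Basis μ ℝ V)
    (hc : ∀ i j, C (c i) (c j) = if i = j then 1 else 0) :
    (Matrix.of fun a I => c.repr (q (e I)) a) * (gramMatrix B e)⁻¹ *
      (Matrix.of fun a I => c.repr (q (e I)) a).transpose = 1 := by
  set A : Matrix μ κ ℝ := Matrix.of fun a I => c.repr (q (e I)) a with hA
  set σ : Matrix κ μ ℝ := Matrix.of fun I a => e.repr (s (c a)) I with hσ
  have h1 : gramMatrix B e * σ = A.transpose := by
    ext J a
    have h2 : A a J = B (s (c a)) (e J) := by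
      rw [hadj, apply_eq_sum_of_orthonormal hc]
      simp [hA, Finsupp.single_apply]
    rw [Matrix.transpose_apply, h2, hB.symm, ← e.sum_repr (s (c a))]
    simp only [Matrix.mul_apply, gramMatrix, hσ, Matrix.of_apply, map_sum, map_smul, smul_eq_mul]
    exact Finset.sum_congr rfl fun j _ => mul_comm _ _
  have h2 : A * σ = 1 := by
    ext a b
    have h3 := congrArg (fun v => c.repr v a) (hs (c b))
    rw [← e.sum_repr (s (c b))] at h3
    simp only [map_sum, map_smul, Finsupp.coe_finsetSum, Finset.sum_apply, Finsupp.smul_apply,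
      smul_eq_mul, Basis.repr_self, Finsupp.single_apply] at h3
    rw [Matrix.mul_apply, Matrix.one_apply]
    simp only [hA, hσ, Matrix.of_apply]
    simp_rw [mul_comm (c.repr _ a)]
    simpa [eq_comm] using h3
  have hu : IsUnit (gramMatrix B e).det := (gramMatrix_det_ne_zero hB e).isUnit
  rw [← h1, Matrix.mul_assoc, Matrix.nonsing_inv_mul_cancel_left _ _ hu, h2]

end BilinearForms

/-! ### Vector fields as modules over the smooth functions -/

section FunctionModule

variable {n : ℕ} {M : Type*} [TopologicalSpace M] [ChartedSpace (EuclideanSpace ℝ (Fin n)) M]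
  [IsManifold (𝓡 n) ∞ M]

theorem contMDiff_mvfderiv_apply {f : M → ℝ} (hf : ContMDiff (𝓡 n) 𝓘(ℝ) ∞ f) {X : VField n M}
    (hX : ContMDiff (𝓡 n) (𝓡 n).tangent ∞ (fun x => (⟨x, X x⟩ : TangentBundle (𝓡 n) M))) :
    ContMDiff (𝓡 n) 𝓘(ℝ) ∞ fun x => mvfderiv (𝓡 n) f x (X x) := by
  have h1 := (hf.contMDiff_tangentMap (m := ∞) (by simp)).comp hX
  exact (contMDiff_snd_tangentBundle_modelSpace ℝ 𝓘(ℝ)).comp h1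

/-- The spaces of vector fields that are modules over the smooth functions. -/
def IsFunctionModule (D : Submodule ℝ (VField n M)) : Prop :=
  ∀ f : M → ℝ, ContMDiff (𝓡 n) 𝓘(ℝ) ∞ f → ∀ X ∈ D, f • X ∈ D

/-- From `f [V, W] = [f V, W] + (W f) V`: the first bracket again starts with a field of `D`, and
the correction stays in `D`. -/
theorem IsFunctionModule.derivedFlag {D : Submodule ℝ (VField n M)}
    (hD : ∀ X ∈ D, ContMDiff (𝓡 n) (𝓡 n).tangent ∞
      (fun x => (⟨x, X x⟩ : TangentBundle (𝓡 n) M))) (hm : IsFunctionModule D) (i : ℕ) :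
    IsFunctionModule (derivedFlag D i) := by
  induction i using Nat.twoStepInduction with
  | zero =>
    intro f _ X hX
    rw [show X = 0 from hX, smul_zero]
    exact Submodule.zero_mem _
  | one => exact hm
  | more i _ ih =>
    intro f hf X hX
    obtain ⟨A, hA, B, hB, rfl⟩ := Submodule.mem_sup.1 hX
    rw [smul_add]
    refine Submodule.add_mem _ (Submodule.mem_sup_left (ih f hf A hA)) ?_
    clear hX
    induction hB using Submodule.span_induction with
    | mem Z hZ =>
      obtain ⟨V, hV, W, hW, rfl⟩ := hZ
      have hVs := hD V hV
      have h : f • VectorField.mlieBracket (𝓡 n) V W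
          = VectorField.mlieBracket (𝓡 n) (f • V) W
            + (fun x => mvfderiv (𝓡 n) f x (W x)) • V := by
        ext1 x
        have := VectorField.mlieBracket_smul_left (W := W)
          ((hf x).mdifferentiableAt (by simp)) ((hVs x).mdifferentiableAt (by simp))
        rw [Pi.add_apply, this, Pi.smul_apply', Pi.smul_apply']
        simp
      rw [h]
      have hWs := derivedFlag_smooth hD (i + 1) W hW
      refine Submodule.add_mem _ (bracket_mem_derivedFlag (hm f hf V hV) hW) ?_
      exact derivedFlag_mono D (show 1 ≤ i + 2 by omega)
        (hm _ (contMDiff_mvfderiv_apply hf hWs) V hV)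
    | zero =>
      rw [smul_zero]
      exact Submodule.zero_mem _
    | add Z Z' _ _ h1 h2 =>
      rw [smul_add]
      exact Submodule.add_mem _ h1 h2
    | smul c Z _ h1 =>
      rw [smul_comm]
      exact Submodule.smul_mem _ _ h1

/-- The space `I_x D^{i+1} + D^i`, where `I_x` is the ideal of the smooth functions that vanish
at `x`. -/
def vanishingModule (D : Submodule ℝ (VField n M)) (x : M) (i : ℕ) : Submodule ℝ (VField n M) :=
  Submodule.span ℝ {Z | ∃ f : M → ℝ, ContMDiff (𝓡 n) 𝓘(ℝ) ∞ f ∧ f x = 0 ∧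
    ∃ Y ∈ derivedFlag D (i + 1), Z = f • Y} ⊔ derivedFlag D i

theorem apply_mem_of_mem_vanishingModule {D : Submodule ℝ (VField n M)} {x : M} {i : ℕ}
    {Z : VField n M} (hZ : Z ∈ vanishingModule D x i) :
    Z x ∈ (derivedFlag D i).map (evalAt x) := by
  suffices h : vanishingModule D x i ≤ ((derivedFlag D i).map (evalAt x)).comap (evalAt x) from
    h hZ
  refine sup_le (Submodule.span_le.2 ?_) (Submodule.le_comap_map _ _)
  rintro _ ⟨f, -, hf, Y, -, rfl⟩
  exact ⟨0, Submodule.zero_mem _, by simp [hf]⟩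

/-- The bracket is additive only on differentiable fields, so it becomes a linear map on `D^i`,
whose members are smooth, and not on all fields. -/
theorem mlieBracket_linear_right {D : Submodule ℝ (VField n M)}
    (hD : ∀ X ∈ D, ContMDiff (𝓡 n) (𝓡 n).tangent ∞
      (fun x => (⟨x, X x⟩ : TangentBundle (𝓡 n) M))) {X : VField n M}
    (i : ℕ) : ∃ L : derivedFlag D i →ₗ[ℝ] VField n M,
      ∀ Y, L Y = VectorField.mlieBracket (𝓡 n) X Y := by
  have hmd : ∀ (Y : derivedFlag D i) (x : M), MDifferentiableAt (𝓡 n) (𝓡 n).tangent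
      (fun x => (⟨x, (Y : VField n M) x⟩ : TangentBundle (𝓡 n) M)) x :=
    fun Y x => (derivedFlag_smooth hD i Y Y.2 x).mdifferentiableAt (by simp)
  refine ⟨{ toFun := fun Y => VectorField.mlieBracket (𝓡 n) X Y, map_add' := fun Y Z => ?_,
            map_smul' := fun c Y => ?_ }, fun _ => rfl⟩
  · ext1 x
    exact VectorField.mlieBracket_add_right (hmd Y x) (hmd Z x)
  · ext1 x
    exact VectorField.mlieBracket_const_smul_right (hmd Y x)

/-- To show that a bracket with a fixed field maps `L ≤ D^i` to `L'` it suffices to consider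
generators. -/
theorem mlieBracket_mem_of_span {D : Submodule ℝ (VField n M)}
    (hD : ∀ X ∈ D, ContMDiff (𝓡 n) (𝓡 n).tangent ∞
      (fun x => (⟨x, X x⟩ : TangentBundle (𝓡 n) M))) {X : VField n M} {i : ℕ}
    {L L' : Submodule ℝ (VField n M)} {s : Set (VField n M)}
    (hs : L ≤ Submodule.span ℝ s) (hs' : s ⊆ derivedFlag D i)
    (h : ∀ Y ∈ s, VectorField.mlieBracket (𝓡 n) X Y ∈ L') :
    ∀ Y ∈ L, VectorField.mlieBracket (𝓡 n) X Y ∈ L' := by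
  obtain ⟨B, hB⟩ := mlieBracket_linear_right hD (X := X) i
  have hsp : Submodule.span ℝ s ≤ (L'.comap B).map (derivedFlag D i).subtype := by
    refine Submodule.span_le.2 fun Y hY => ⟨⟨Y, hs' hY⟩, ?_, rfl⟩
    change B _ ∈ L'
    rw [hB]
    exact h Y hY
  intro Y hY
  obtain ⟨Z, hZ, rfl⟩ := hsp (hs hY)
  rw [SetLike.mem_coe, Submodule.mem_comap, hB] at hZ
  exact hZ

/-- In `[X, f Y] = f [X, Y] + (X f) Y` the first term keeps the vanishing coefficient and the second
has lost one bracket, so it falls into the lower step of the flag. -/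
theorem mlieBracket_mem_vanishingModule_right {D : Submodule ℝ (VField n M)}
    (hD : ∀ X ∈ D, ContMDiff (𝓡 n) (𝓡 n).tangent ∞
      (fun x => (⟨x, X x⟩ : TangentBundle (𝓡 n) M))) (hm : IsFunctionModule D) {x : M} {i : ℕ}
    {X Z : VField n M} (hX : X ∈ D) (hZ : Z ∈ vanishingModule D x i) :
    VectorField.mlieBracket (𝓡 n) X Z ∈ vanishingModule D x (i + 1) := by
  refine mlieBracket_mem_of_span hD (i := i + 1) (L := vanishingModule D x i)
    (s := {Z | ∃ f : M → ℝ, ContMDiff (𝓡 n) 𝓘(ℝ) ∞ f ∧ f x = 0 ∧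
      ∃ Y ∈ derivedFlag D (i + 1), Z = f • Y} ∪ derivedFlag D i) ?_ ?_ ?_ Z hZ
  · rw [Submodule.span_union, Submodule.span_eq]
    exact le_rfl
  · rintro _ (⟨f, hf, -, Y, hY, rfl⟩ | hY)
    · exact hm.derivedFlag hD _ f hf Y hY
    · exact derivedFlag_le_succ D i hY
  · rintro _ (⟨f, hf, hfx, Y, hY, rfl⟩ | hY)
    · have hYs := derivedFlag_smooth hD _ Y hY
      have h : VectorField.mlieBracket (𝓡 n) X (f • Y)
          = f • VectorField.mlieBracket (𝓡 n) X Y + (fun x => mvfderiv (𝓡 n) f x (X x)) • Y := by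
        ext1 y
        rw [VectorField.mlieBracket_smul_right ((hf y).mdifferentiableAt (by simp))
          ((hYs y).mdifferentiableAt (by simp)), Pi.add_apply, add_comm]
        rfl
      rw [h]
      refine Submodule.add_mem _ (Submodule.mem_sup_left (Submodule.subset_span
        ⟨f, hf, hfx, _, bracket_mem_derivedFlag hX hY, rfl⟩)) (Submodule.mem_sup_right ?_)
      exact hm.derivedFlag hD _ _ (contMDiff_mvfderiv_apply hf (hD X hX)) Y hY
    · refine Submodule.mem_sup_right ?_
      rcases i with _ | i
      · rename_i hY
        rw [show _ = (0 : VField n M) from hY, VectorField.mlieBracket_zero_right]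
        exact Submodule.zero_mem _
      · exact bracket_mem_derivedFlag hX hY

/-- The left entry of an iterated bracket is a field of `D`, so level `0` suffices. Here `[Z, f Y] =
(Z f) Y - f [Y, Z]`, with `(Z f) Y` in `D`. -/
theorem mlieBracket_mem_vanishingModule_left {D : Submodule ℝ (VField n M)}
    (hD : ∀ X ∈ D, ContMDiff (𝓡 n) (𝓡 n).tangent ∞
      (fun x => (⟨x, X x⟩ : TangentBundle (𝓡 n) M))) (hm : IsFunctionModule D) {x : M} {i : ℕ}
    {X Z : VField n M} (hX : X ∈ vanishingModule D x 0) (hZ : Z ∈ derivedFlag D (i + 1)) :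
    VectorField.mlieBracket (𝓡 n) X Z ∈ vanishingModule D x (i + 1) := by
  rw [VectorField.mlieBracket_swap]
  refine Submodule.neg_mem _ ?_
  refine mlieBracket_mem_of_span hD (i := 1) (L := vanishingModule D x 0)
    (s := {Z | ∃ f : M → ℝ, ContMDiff (𝓡 n) 𝓘(ℝ) ∞ f ∧ f x = 0 ∧
      ∃ Y ∈ derivedFlag D (0 + 1), Z = f • Y}) ?_ ?_ ?_ X hX
  · exact sup_le le_rfl bot_le
  · rintro _ ⟨f, hf, -, Y, hY, rfl⟩
    exact hm.derivedFlag hD _ f hf Y hY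
  · rintro _ ⟨f, hf, hfx, Y, hY, rfl⟩
    have hYs := derivedFlag_smooth hD _ Y hY
    have h : VectorField.mlieBracket (𝓡 n) Z (f • Y)
        = (fun x => mvfderiv (𝓡 n) f x (Z x)) • Y - f • VectorField.mlieBracket (𝓡 n) Y Z := by
      ext1 y
      rw [VectorField.mlieBracket_smul_right ((hf y).mdifferentiableAt (by simp))
        ((hYs y).mdifferentiableAt (by simp)), VectorField.mlieBracket_swap (V := Y)]
      simp
    rw [h]
    refine Submodule.sub_mem _ (Submodule.mem_sup_right ?_) (Submodule.mem_sup_left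
      (Submodule.subset_span ⟨f, hf, hfx, _, bracket_mem_derivedFlag hY hZ, rfl⟩))
    refine derivedFlag_mono D (show 1 ≤ i + 1 by omega) (hm _ ?_ Y hY)
    exact contMDiff_mvfderiv_apply hf (derivedFlag_smooth hD _ Z hZ)

end FunctionModule

/-! ### Global frames and extensions of vectors to sections -/

section Sections

variable {n : ℕ} {M : Type*} [TopologicalSpace M] [T2Space M]
  [ChartedSpace (EuclideanSpace ℝ (Fin n)) M] [IsManifold (𝓡 n) ∞ M]
  {F : Type*} [NormedAddCommGroup F] [NormedSpace ℝ F] [FiniteDimensional ℝ F]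
  {U : M → Type*} [TopologicalSpace (Bundle.TotalSpace F U)]
  [∀ x, TopologicalSpace (U x)] [∀ x, AddCommGroup (U x)] [∀ x, Module ℝ (U x)]
  [FiberBundle F U] [VectorBundle ℝ F U]

/-- The product of a smooth function and a smooth section. -/
def functionSMul (f : M → ℝ) (hf : ContMDiff (𝓡 n) 𝓘(ℝ) ∞ f) (σ : ContMDiffSection (𝓡 n) F ∞ U) :
    ContMDiffSection (𝓡 n) F ∞ U :=
  ⟨f • ⇑σ, hf.smul_section σ.contMDiff⟩

variable [ContMDiffVectorBundle ∞ F U (𝓡 n)]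

/-- Near every point there is a frame made of global smooth sections, and every smooth section is
a combination of the frame up to a multiple that vanishes at the point. -/
theorem exists_frame (x : M) :
    ∃ e : Fin (finrank ℝ F) → ContMDiffSection (𝓡 n) F ∞ U,
      (∀ᶠ y in 𝓝 x, ∃ b : Basis (Fin (finrank ℝ F)) ℝ (U y), ∀ j, b j = e j y) ∧
      ∀ σ : ContMDiffSection (𝓡 n) F ∞ U,
        ∃ (a : Fin (finrank ℝ F) → M → ℝ) (ψ : M → ℝ),
          (∀ j, ContMDiff (𝓡 n) 𝓘(ℝ) ∞ (a j)) ∧ ContMDiff (𝓡 n) 𝓘(ℝ) ∞ ψ ∧ ψ x = 0 ∧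
          ∀ y, σ y = ∑ j, a j y • e j y + ψ y • σ y := by
  have : ContMDiffVectorBundle 1 F U (𝓡 n) := ContMDiffVectorBundle.of_le (n := ∞) (by simp)
  set t := trivializationAt F U x
  have hx : x ∈ t.baseSet := FiberBundle.mem_baseSet_trivializationAt F U x
  have hnhds : t.baseSet ∈ 𝓝 x := t.open_baseSet.mem_nhds hx
  let b := finBasis ℝ F
  obtain ⟨φ, hφ, -⟩ := (SmoothBumpFunction.nhds_basis_support (I := 𝓡 n) hnhds).mem_iff.1 hnhds
  have hframe := t.isLocalFrameOn_localFrame_baseSet (𝓡 n) ∞ b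
  -- The local frame multiplied by a bump function supported in the trivializing set and equal to
  -- `1` near `x`.
  let e : Fin (finrank ℝ F) → ContMDiffSection (𝓡 n) F ∞ U := fun j =>
    ⟨⇑φ • t.localFrame b j, ContMDiffOn.smul_section_of_tsupport φ.contMDiff.contMDiffOn
      t.open_baseSet hφ (hframe.contMDiffOn j)⟩
  refine ⟨e, ?_, fun σ => ?_⟩
  · filter_upwards [hnhds, φ.eventuallyEq_one] with y hy hy1
    refine ⟨hframe.toBasisAt hy, fun j => ?_⟩
    rw [hframe.toBasisAt_coe]
    change _ = φ y • t.localFrame b j y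
    rw [hy1, Pi.one_apply, one_smul]
  -- Both the frame and the coefficients carry a factor `φ`, so the sum is `φ² σ` and the remainder
  -- has the coefficient `1 - φ²`, which vanishes at `x`.
  · refine ⟨fun j y => φ y * t.localFrameCoeff (𝓡 n) b j y (σ y), fun y => 1 - φ y * φ y,
      fun j => ?_, contMDiff_const.sub (φ.contMDiff.mul φ.contMDiff), by simp,
      fun y => ?_⟩
    · refine contMDiff_of_tsupport fun y hy => ?_
      have hy' : y ∈ t.baseSet := hφ (tsupport_mul_subset_left hy)
      exact φ.contMDiff.contMDiffAt.mul
        (contMDiffAt_localFrameCoeff b hy' (σ.contMDiff y) j)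
    · by_cases hy : y ∈ t.baseSet
      · have h := t.eq_sum_localFrameCoeff_smul (I := 𝓡 n) (b := b) (s := σ) hy
        have h2 : ∑ j, (φ y * t.localFrameCoeff (𝓡 n) b j y (σ y)) • e j y
            = (φ y * φ y) • σ y := by
          conv_rhs => rw [h, Finset.smul_sum]
          refine Finset.sum_congr rfl fun j _ => ?_
          change _ • φ y • t.localFrame b j y = _
          rw [smul_smul, smul_smul]
          congr 1
          ring
        rw [h2, ← add_smul]
        simp
      · have h0 : φ y = 0 := image_eq_zero_of_notMem_tsupport fun h => hy (hφ h)
        simp [h0]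

/-- Linearity of the extension is what turns the multilinear bracket class on sections into a
multilinear map on the fibre. -/
theorem exists_extension (x : M) :
    ∃ E : U x →ₗ[ℝ] ContMDiffSection (𝓡 n) F ∞ U, ∀ v, E v x = v := by
  obtain ⟨e, he, -⟩ := exists_frame (n := n) (F := F) (U := U) x
  obtain ⟨b, hb⟩ := he.self_of_nhds
  refine ⟨b.constr ℝ e, fun v => ?_⟩
  let ev : ContMDiffSection (𝓡 n) F ∞ U →ₗ[ℝ] U x :=
    { toFun := fun σ => σ x, map_add' := fun _ _ => rfl, map_smul' := fun _ _ => rfl }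
  have h : ev ∘ₗ b.constr ℝ e = LinearMap.id := b.ext fun j => by
    rw [LinearMap.comp_apply, b.constr_basis]
    exact (hb j).symm
  exact LinearMap.congr_fun h v

/-- A section that vanishes at `x` is a combination of sections with coefficients that vanish
at `x`. -/
theorem exists_eq_sum_of_apply_eq_zero (x : M) {σ : ContMDiffSection (𝓡 n) F ∞ U}
    (hσ : σ x = 0) :
    ∃ (m : ℕ) (a : Fin m → M → ℝ) (τ : Fin m → ContMDiffSection (𝓡 n) F ∞ U),
      (∀ j, ContMDiff (𝓡 n) 𝓘(ℝ) ∞ (a j)) ∧ (∀ j, a j x = 0) ∧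
      ∀ y, σ y = ∑ j, a j y • τ j y := by
  obtain ⟨e, he, h⟩ := exists_frame (n := n) (F := F) (U := U) x
  obtain ⟨b, hb⟩ := he.self_of_nhds
  obtain ⟨a, ψ, ha, hψ, hψx, heq⟩ := h σ
  -- The section `σ` itself serves as one of the sections, with coefficient `ψ`. The other
  -- coefficients vanish at `x` because the frame is independent there and `σ x = 0`.
  refine ⟨_, Fin.cons ψ a, Fin.cons σ e, fun j => ?_, fun j => ?_, fun y => ?_⟩
  · refine Fin.cases ?_ (fun j => ?_) j
    · simpa using hψ
    · simpa using ha j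
  · have h0 := heq x
    rw [hσ, smul_zero, add_zero] at h0
    refine Fin.cases ?_ (fun j => ?_) j
    · simpa using hψx
    · simp_rw [← hb] at h0
      simpa using Fintype.linearIndependent_iff.1 b.linearIndependent (fun j => a j x) h0.symm j
  · rw [Fin.sum_univ_succ]
    simp only [Fin.cons_zero, Fin.cons_succ]
    rw [add_comm]
    exact heq y

end Sections

/-! ### The bracket maps are well defined and surjective -/

namespace SubRiemannianStructure

variable {n : ℕ} {M : Type*} [TopologicalSpace M]
  [ChartedSpace (EuclideanSpace ℝ (Fin n)) M] [IsManifold (𝓡 n) ∞ M]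
  {F : Type*} [NormedAddCommGroup F] [NormedSpace ℝ F]
  {U : M → Type*} [TopologicalSpace (Bundle.TotalSpace F U)]
  [∀ x, TopologicalSpace (U x)] [∀ x, AddCommGroup (U x)] [∀ x, Module ℝ (U x)]
  [∀ x, IsTopologicalAddGroup (U x)] [∀ x, ContinuousConstSMul ℝ (U x)]
  [FiberBundle F U] [VectorBundle ℝ F U]
  (S : SubRiemannianStructure n M F U)

theorem distribution_smooth (X : VField n M) (hX : X ∈ S.distribution) :
    ContMDiff (𝓡 n) (𝓡 n).tangent ∞ (fun x => (⟨x, X x⟩ : TangentBundle (𝓡 n) M)) :=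
  horizontalModule_contMDiff S.smooth_f hX

theorem isFunctionModule_distribution : IsFunctionModule S.distribution := by
  rintro f hf _ ⟨σ, rfl⟩
  exact ⟨functionSMul f hf σ, funext fun x => (S.f x).map_smul (f x) (σ x)⟩

theorem iteratedBracket_mem_derivedFlag (i : ℕ) (V : Fin (i + 1) → ContMDiffSection (𝓡 n) F ∞ U) :
    S.iteratedBracket i V ∈ derivedFlag S.distribution (i + 1) := by
  induction i with
  | zero => exact ⟨V 0, rfl⟩
  | succ i ih => exact bracket_mem_derivedFlag ⟨V 0, rfl⟩ (ih _)

/-- The field `f ∘ σ`, as a linear function of `σ`. -/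
def anchor : ContMDiffSection (𝓡 n) F ∞ U →ₗ[ℝ] VField n M where
  toFun σ x := S.f x (σ x)
  map_add' σ τ := by ext1 x; simp
  map_smul' c σ := by ext1 x; simp

theorem anchor_mem (σ : ContMDiffSection (𝓡 n) F ∞ U) : S.anchor σ ∈ S.distribution := ⟨σ, rfl⟩

theorem anchor_mdifferentiableAt (σ : ContMDiffSection (𝓡 n) F ∞ U) (x : M) :
    MDifferentiableAt (𝓡 n) (𝓡 n).tangent
      (fun x => (⟨x, S.anchor σ x⟩ : TangentBundle (𝓡 n) M)) x :=
  (S.distribution_smooth _ (S.anchor_mem σ) x).mdifferentiableAt (by simp)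

theorem iteratedBracket_mdifferentiableAt (i : ℕ)
    (V : Fin (i + 1) → ContMDiffSection (𝓡 n) F ∞ U) (x : M) :
    MDifferentiableAt (𝓡 n) (𝓡 n).tangent
      (fun x => (⟨x, S.iteratedBracket i V x⟩ : TangentBundle (𝓡 n) M)) x :=
  (derivedFlag_smooth S.distribution_smooth _ _ (S.iteratedBracket_mem_derivedFlag i V)
    x).mdifferentiableAt (by simp)

theorem iteratedBracket_succ (i : ℕ) (V : Fin (i + 2) → ContMDiffSection (𝓡 n) F ∞ U) :
    S.iteratedBracket (i + 1) V =
      VectorField.mlieBracket (𝓡 n) (S.anchor (V 0)) (S.iteratedBracket i (Fin.tail V)) := rfl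

theorem iteratedBracket_update_add (i : ℕ) (V : Fin (i + 1) → ContMDiffSection (𝓡 n) F ∞ U)
    (j : Fin (i + 1)) (σ τ : ContMDiffSection (𝓡 n) F ∞ U) :
    S.iteratedBracket i (Function.update V j (σ + τ)) =
      S.iteratedBracket i (Function.update V j σ) + S.iteratedBracket i (Function.update V j τ) := by
  induction i with
  | zero =>
    obtain rfl : j = 0 := Fin.fin_one_eq_zero j
    change S.anchor (Function.update V 0 (σ + τ) 0) =
      S.anchor (Function.update V 0 σ 0) + S.anchor (Function.update V 0 τ 0)
    simp
  | succ i ih =>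
    simp only [iteratedBracket_succ]
    refine Fin.cases ?_ (fun j => ?_) j
    · simp only [Fin.tail_update_zero, Function.update_self, map_add]
      ext1 x
      exact VectorField.mlieBracket_add_left (S.anchor_mdifferentiableAt σ x)
        (S.anchor_mdifferentiableAt τ x)
    · simp only [Fin.tail_update_succ, ih, Function.update_of_ne (Fin.succ_ne_zero j).symm]
      ext1 x
      exact VectorField.mlieBracket_add_right (S.iteratedBracket_mdifferentiableAt i _ x)
        (S.iteratedBracket_mdifferentiableAt i _ x)

theorem iteratedBracket_update_smul (i : ℕ) (V : Fin (i + 1) → ContMDiffSection (𝓡 n) F ∞ U)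
    (j : Fin (i + 1)) (c : ℝ) (σ : ContMDiffSection (𝓡 n) F ∞ U) :
    S.iteratedBracket i (Function.update V j (c • σ)) =
      c • S.iteratedBracket i (Function.update V j σ) := by
  induction i with
  | zero =>
    obtain rfl : j = 0 := Fin.fin_one_eq_zero j
    change S.anchor (Function.update V 0 (c • σ) 0) = c • S.anchor (Function.update V 0 σ 0)
    simp
  | succ i ih =>
    simp only [iteratedBracket_succ]
    refine Fin.cases ?_ (fun j => ?_) j
    · simp only [Fin.tail_update_zero, Function.update_self, map_smul]
      ext1 x
      exact VectorField.mlieBracket_const_smul_left (S.anchor_mdifferentiableAt σ x)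
    · simp only [Fin.tail_update_succ, ih, Function.update_of_ne (Fin.succ_ne_zero j).symm]
      ext1 x
      exact VectorField.mlieBracket_const_smul_right (S.iteratedBracket_mdifferentiableAt i _ x)

/-- The class of an iterated bracket in `D^{i+1}_x / D^i_x`, as a multilinear function of the
sections. -/
def bracketClass (x : M) (i : ℕ) :
    MultilinearMap ℝ (fun _ : Fin (i + 1) => ContMDiffSection (𝓡 n) F ∞ U)
      (GradedPiece (S.flagAt x) i) where
  toFun V := gradedMk (S.flagAt x) i ⟨S.iteratedBracket i V x, S.iteratedBracket_mem i V x⟩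
  map_update_add' V j σ τ := by
    rw [← map_add]
    congr 1
    ext1
    -- `MultilinearMap` quantifies over every decidability instance; this one is identified with the
    -- canonical one used in the additivity lemma.
    rename_i inst
    rw [Subsingleton.elim inst (instDecidableEqFin (i + 1))]
    exact congrFun (S.iteratedBracket_update_add i V j σ τ) x
  map_update_smul' V j c σ := by
    rw [← map_smul]
    congr 1
    ext1
    rename_i inst
    rw [Subsingleton.elim inst (instDecidableEqFin (i + 1))]
    exact congrFun (S.iteratedBracket_update_smul i V j c σ) x

theorem gradedMk_eq_zero_iff {E : Type*} [AddCommGroup E] [Module ℝ E] {Fl : ℕ → Submodule ℝ E}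
    {i : ℕ} {v : Fl (i + 1)} : gradedMk Fl i v = 0 ↔ (v : E) ∈ Fl i := by
  rw [gradedMk, Submodule.mkQ_apply, Submodule.Quotient.mk_eq_zero]
  exact Iff.rfl

/-- A multilinear map that vanishes as soon as one argument is in the kernel of `ev` depends only
on the images of its arguments under `ev`. -/
theorem _root_.MultilinearMap.congr_of_kernel {ι V W X : Type*} [Fintype ι] [AddCommGroup V]
    [Module ℝ V] [AddCommGroup W] [Module ℝ W] [AddCommGroup X] [Module ℝ X]
    (m : MultilinearMap ℝ (fun _ : ι => V) W) (ev : V →ₗ[ℝ] X)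
    (h : ∀ (v : ι → V) (j : ι), ev (v j) = 0 → m v = 0) {v w : ι → V}
    (hvw : ∀ j, ev (v j) = ev (w j)) : m v = m w := by
  classical
  suffices key : ∀ s : Finset ι, m (s.piecewise v w) = m w by
    simpa using key Finset.univ
  intro s
  induction s using Finset.induction_on with
  | empty => simp
  | insert j s hj ih =>
    -- Arguments are exchanged one at a time: consecutive hybrids differ only in the slot `j`, by a
    -- vector in the kernel of `ev`.
    rw [Finset.piecewise_insert, ← ih, ← sub_eq_zero]
    conv_lhs => rw [← Function.update_eq_self j (s.piecewise v w), Function.update_idem]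
    rw [← m.map_update_sub]
    refine h _ j ?_
    simp [hj, hvw]

/-- Bracketing `D` with `D^i` stays in `D^{i+1}`, and bracketing it with a right-nested bracket
yields a longer right-nested bracket. This gives the surjectivity of the bracket maps. -/
theorem derivedFlag_succ_le (i : ℕ) : derivedFlag S.distribution (i + 1) ≤
    derivedFlag S.distribution i ⊔ Submodule.span ℝ (range (S.iteratedBracket i)) := by
  induction i with
  | zero =>
    rintro _ ⟨σ, rfl⟩
    exact Submodule.mem_sup_right (Submodule.subset_span ⟨fun _ => σ, rfl⟩)
  | succ i ih =>
    refine sup_le le_sup_left (Submodule.span_le.2 ?_)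
    rintro _ ⟨_, ⟨σ, rfl⟩, Y, hY, rfl⟩
    refine mlieBracket_mem_of_span S.distribution_smooth (i := i + 1)
      (L := derivedFlag S.distribution (i + 1))
      (s := derivedFlag S.distribution i ∪ range (S.iteratedBracket i)) ?_ ?_ ?_ Y hY
    · rw [Submodule.span_union, Submodule.span_eq]
      exact ih
    · rintro _ (hY | ⟨V, rfl⟩)
      · exact derivedFlag_le_succ _ i hY
      · exact S.iteratedBracket_mem_derivedFlag i V
    · rintro Y (hY | ⟨V, rfl⟩)
      · refine Submodule.mem_sup_left ?_
        rcases i with _ | i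
        · rw [show Y = 0 from hY, VectorField.mlieBracket_zero_right]
          exact Submodule.zero_mem _
        · exact bracket_mem_derivedFlag (S.anchor_mem σ) hY
      · exact Submodule.mem_sup_right (Submodule.subset_span ⟨Fin.cons σ V, rfl⟩)

variable [T2Space M] [FiniteDimensional ℝ F] [ContMDiffVectorBundle ∞ F U (𝓡 n)]

/-- Induction on the length: the vanishing section sits either in the outermost slot or in the inner
bracket, and the two Leibniz lemmas treat these cases. -/
theorem iteratedBracket_mem_vanishingModule (x : M) (i : ℕ)
    (V : Fin (i + 1) → ContMDiffSection (𝓡 n) F ∞ U) (j : Fin (i + 1)) (h : V j x = 0) :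
    S.iteratedBracket i V ∈ vanishingModule S.distribution x i := by
  have h0 : ∀ σ : ContMDiffSection (𝓡 n) F ∞ U, σ x = 0 →
      S.anchor σ ∈ vanishingModule S.distribution x 0 := fun σ hσ => by
    obtain ⟨m, a, τ, ha, hax, hσ⟩ := exists_eq_sum_of_apply_eq_zero x hσ
    have heq : S.anchor σ = ∑ j, a j • S.anchor (τ j) := by
      ext1 y
      change S.f y (σ y) = _
      rw [hσ, map_sum, Finset.sum_apply]
      exact Finset.sum_congr rfl fun j _ => map_smul _ _ _
    rw [heq]
    exact Submodule.mem_sup_left (Submodule.sum_mem _ fun j _ =>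
      Submodule.subset_span ⟨a j, ha j, hax j, _, S.anchor_mem _, rfl⟩)
  induction i with
  | zero =>
    obtain rfl : j = 0 := Fin.fin_one_eq_zero j
    exact h0 _ h
  | succ i ih =>
    rw [iteratedBracket_succ]
    revert h
    refine Fin.cases (fun h => ?_) (fun j h => ?_) j
    · exact mlieBracket_mem_vanishingModule_left S.distribution_smooth
        S.isFunctionModule_distribution (h0 _ h) (S.iteratedBracket_mem_derivedFlag i _)
    · exact mlieBracket_mem_vanishingModule_right S.distribution_smooth
        S.isFunctionModule_distribution (S.anchor_mem _) (ih _ j h)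

/-- The map is defined through a linear extension of vectors to sections. Other extensions give the
same class, since replacing a section by one with the same value changes the bracket by an element
of `I_x D^{i+1} + D^i`. -/
theorem exists_isBracketMap (x : M) (i : ℕ) : ∃ L, S.IsBracketMap x i L := by
  obtain ⟨E, hE⟩ := exists_extension (n := n) (F := F) (U := U) x
  refine ⟨PiTensorProduct.lift ((S.bracketClass x i).compLinearMap fun _ => E), fun V => ?_⟩
  rw [PiTensorProduct.lift.tprod, MultilinearMap.compLinearMap_apply]
  let ev : ContMDiffSection (𝓡 n) F ∞ U →ₗ[ℝ] U x :=
    { toFun := fun σ => σ x, map_add' := fun _ _ => rfl, map_smul' := fun _ _ => rfl }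
  refine (S.bracketClass x i).congr_of_kernel ev (fun V j hj => ?_) (fun j => hE _)
  exact gradedMk_eq_zero_iff.2
    (apply_mem_of_mem_vanishingModule (S.iteratedBracket_mem_vanishingModule x i V j hj))

theorem isBracketMap_bracketMap (x : M) (i : ℕ) : S.IsBracketMap x i (S.bracketMap x i) := by
  rw [bracketMap, dif_pos (S.exists_isBracketMap x i)]
  exact (S.exists_isBracketMap x i).choose_spec

/-- Pure tensors span, and each one consists of values of sections. -/
theorem existsUnique_isBracketMap (x : M) (i : ℕ) : ∃! L, S.IsBracketMap x i L := by
  obtain ⟨E, hE⟩ := exists_extension (n := n) (F := F) (U := U) x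
  refine ⟨_, S.isBracketMap_bracketMap x i, fun L hL => ?_⟩
  refine PiTensorProduct.ext (MultilinearMap.ext fun v => ?_)
  have h1 := hL fun j => E (v j)
  rw [← S.isBracketMap_bracketMap x i fun j => E (v j)] at h1
  simp only [hE] at h1
  exact h1

theorem bracketMap_surjective (x : M) (i : ℕ) : Function.Surjective (S.bracketMap x i) := by
  rw [← LinearMap.range_eq_top, eq_top_iff]
  rintro w -
  obtain ⟨⟨v, Z, hZ, rfl⟩, rfl⟩ := Submodule.mkQ_surjective _ w
  obtain ⟨A, hA, B, hB, rfl⟩ := Submodule.mem_sup.1 (S.derivedFlag_succ_le i hZ)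
  have hB' : ∀ B ∈ Submodule.span ℝ (range (S.iteratedBracket i)),
      ∃ h : B x ∈ S.flagAt x (i + 1), gradedMk (S.flagAt x) i ⟨B x, h⟩ ∈
        LinearMap.range (S.bracketMap x i) := by
    intro B hB
    induction hB using Submodule.span_induction with
    | mem B hB =>
      obtain ⟨V, rfl⟩ := hB
      exact ⟨S.iteratedBracket_mem i V x, _, S.isBracketMap_bracketMap x i V⟩
    | zero => exact ⟨Submodule.zero_mem _, 0, by rw [map_zero]; exact (map_zero _).symm⟩
    | add B B' _ _ h h' =>
      obtain ⟨h1, h2⟩ := h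
      obtain ⟨h1', h2'⟩ := h'
      exact ⟨Submodule.add_mem _ h1 h1', Submodule.add_mem _ h2 h2'⟩
    | smul c B _ h =>
      obtain ⟨h1, h2⟩ := h
      exact ⟨Submodule.smul_mem _ c h1, Submodule.smul_mem _ c h2⟩
  obtain ⟨h1, h2⟩ := hB' B hB
  convert! h2 using 1
  rw [← sub_eq_zero]
  erw [← map_sub]
  rw [gradedMk_eq_zero_iff]
  refine ⟨A, hA, ?_⟩
  simp

end SubRiemannianStructure

/-! ### Orthogonal sums and homogeneous orthonormal bases -/

section OrthogonalSums

variable {V : Type*} [AddCommGroup V] [Module ℝ V]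

theorem repr_eq_of_orthonormal {κ : Type*} [Fintype κ] [DecidableEq κ]
    {B : V →ₗ[ℝ] V →ₗ[ℝ] ℝ} {b : Basis κ ℝ V}
    (hb : ∀ i j, B (b i) (b j) = if i = j then 1 else 0) (v : V) (i : κ) :
    b.repr v i = B (b i) v := by
  rw [apply_eq_sum_of_orthonormal hb]
  simp [Finsupp.single_apply]

/-- The transition matrix is orthogonal, so its determinant squares to `1`. -/
theorem det_eq_or_eq_neg_of_orthonormal {κ : Type*} [Fintype κ] [DecidableEq κ]
    {B : V →ₗ[ℝ] V →ₗ[ℝ] ℝ} {b c : Basis κ ℝ V}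
    (hb : ∀ i j, B (b i) (b j) = if i = j then 1 else 0)
    (hc : ∀ i j, B (c i) (c j) = if i = j then 1 else 0) :
    c.det = b.det ∨ c.det = -b.det := by
  have h1 : (c.toMatrix b).transpose * c.toMatrix b = 1 := by
    ext i j
    rw [Matrix.mul_apply, Matrix.one_apply, ← hb i j, apply_eq_sum_of_orthonormal hc]
    rfl
  have h2 : c.det b * c.det b = 1 := by
    have := congrArg Matrix.det h1
    rwa [Matrix.det_mul, Matrix.det_transpose, Matrix.det_one] at this
  have h3 : c.det = c.det b • b.det := AlternatingMap.eq_smul_basis_det b c.det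
  rcases mul_self_eq_one_iff.1 h2 with h | h
  · left
    rw [h3, h, one_smul]
  · right
    ext v
    rw [h3, h]
    simp

variable {r : ℕ} {W : Fin r → Type*} [∀ i, AddCommGroup (W i)] [∀ i, Module ℝ (W i)]

/-- The orthogonal sum of bilinear forms. -/
def sumForm (C : ∀ i, W i →ₗ[ℝ] W i →ₗ[ℝ] ℝ) : (∀ i, W i) →ₗ[ℝ] (∀ i, W i) →ₗ[ℝ] ℝ :=
  ∑ i, (C i).compl₁₂ (LinearMap.proj i) (LinearMap.proj i)

theorem sumForm_apply (C : ∀ i, W i →ₗ[ℝ] W i →ₗ[ℝ] ℝ) (u v : ∀ i, W i) :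
    sumForm C u v = ∑ i, C i (u i) (v i) := by
  simp [sumForm]

theorem sumForm_single (C : ∀ i, W i →ₗ[ℝ] W i →ₗ[ℝ] ℝ) (i : Fin r) (w : W i) (v : ∀ i, W i) :
    sumForm C (Pi.single i w) v = C i w (v i) := by
  rw [sumForm_apply, Finset.sum_eq_single i]
  · simp
  · intro j _ hj
    simp [Pi.single_eq_of_ne hj]
  · simp

theorem isScalarProduct_sumForm {C : ∀ i, W i →ₗ[ℝ] W i →ₗ[ℝ] ℝ}
    (hC : ∀ i, IsScalarProduct (C i)) : IsScalarProduct (sumForm C) where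
  symm u v := by simp_rw [sumForm_apply, (hC _).symm (u _)]
  pos v hv := by
    obtain ⟨i, hi⟩ := Function.ne_iff.1 hv
    rw [sumForm_apply]
    exact Finset.sum_pos' (fun j _ => (hC j).nonneg _) ⟨i, Finset.mem_univ i, (hC i).pos _ hi⟩

/-- A basis of a direct sum that consists of homogeneous elements of the degrees `d`. -/
def IsHomogeneous {κ : Type*} (c : κ → ∀ i, W i) (d : κ → Fin r) : Prop :=
  ∀ a, ∃ w, c a = Pi.single (d a) w

/-- The union of orthonormal bases of the pieces. The index `i : Fin r` stands for the degree `i +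
1`, so the total weight is the homogeneous dimension. -/
theorem exists_homogeneous_orthonormal_basis [∀ i, FiniteDimensional ℝ (W i)]
    {C : ∀ i, W i →ₗ[ℝ] W i →ₗ[ℝ] ℝ} (hC : ∀ i, IsScalarProduct (C i)) {n : ℕ}
    (hn : finrank ℝ (∀ i, W i) = n) :
    ∃ (c : Basis (Fin n) ℝ (∀ i, W i)) (d : Fin n → Fin r), IsHomogeneous c d ∧
      (∀ a b, sumForm C (c a) (c b) = if a = b then 1 else 0) ∧
      ∑ a, ((d a : ℕ) + 1) = ∑ i : Fin r, ((i : ℕ) + 1) * finrank ℝ (W i) := by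
  choose c hc using fun i => (hC i).exists_orthonormal_basis
  have hcard : Fintype.card (Σ i, Fin (finrank ℝ (W i))) = n := by
    rw [← hn, finrank_eq_card_basis (Pi.basis c)]
  let f := Fintype.equivFinOfCardEq hcard
  have hbasis : ∀ x : Σ i, Fin (finrank ℝ (W i)), Pi.basis c x = Pi.single x.1 (c x.1 x.2) :=
    fun x => Pi.basis_apply c x
  have horth : ∀ x y : Σ i, Fin (finrank ℝ (W i)),
      sumForm C (Pi.basis c x) (Pi.basis c y) = if x = y then 1 else 0 := by
    rintro ⟨i, a⟩ ⟨j, b⟩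
    rw [hbasis, sumForm_single, hbasis]
    by_cases h : i = j
    · subst h
      simp [hc]
    · rw [Pi.single_eq_of_ne h, map_zero, if_neg]
      exact fun h' => h (congrArg Sigma.fst h')
  refine ⟨(Pi.basis c).reindex f, fun a => (f.symm a).1, fun a => ⟨c (f.symm a).1 (f.symm a).2, ?_⟩,
    fun a b => ?_, ?_⟩
  · rw [Basis.reindex_apply, hbasis]
  · rw [Basis.reindex_apply, Basis.reindex_apply, horth]
    simp
  · rw [f.symm.sum_comp fun x : Σ i, Fin (finrank ℝ (W i)) => ((x.1 : ℕ) + 1),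
      Fintype.sum_sigma]
    simp [mul_comm]

theorem repr_eq_zero_of_homogeneous {κ : Type*} [Fintype κ] [DecidableEq κ]
    {C : ∀ i, W i →ₗ[ℝ] W i →ₗ[ℝ] ℝ} {c : Basis κ ℝ (∀ i, W i)} {d : κ → Fin r}
    (hd : IsHomogeneous c d) (hc : ∀ a b, sumForm C (c a) (c b) = if a = b then 1 else 0)
    {u : ∀ i, W i} {a : κ} (h : u (d a) = 0) : c.repr u a = 0 := by
  obtain ⟨w, hw⟩ := hd a
  rw [repr_eq_of_orthonormal hc, hw, sumForm_single, h, map_zero]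

end OrthogonalSums

/-! ### Splittings of a flag and dilations -/

section Splittings

variable {E : Type*} [AddCommGroup E] [Module ℝ E] {Fl : ℕ → Submodule ℝ E} {r : ℕ}

/-- A splitting is triangular for the flag: `x` in `F^{i+1}` differs from the lift of its class by
an element of `F^i`, which by induction has no components in degrees above `i`. -/
theorem IsSplitting.symm_apply {s : Graded Fl r ≃ₗ[ℝ] E} (h : IsFullFlag Fl r)
    (hs : IsSplitting Fl r s.toLinearMap) (i : Fin r) (x : Fl (i + 1)) :
    s.symm x i = gradedMk Fl i x ∧ ∀ j : Fin r, i < j → s.symm x j = 0 := by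
  have key : ∀ m ≤ r, ∀ x ∈ Fl m, ∀ j : Fin r, m ≤ j → s.symm x j = 0 := by
    intro m
    induction m with
    | zero =>
      intro _ x hx j _
      rw [h.zero, Submodule.mem_bot] at hx
      simp [hx]
    | succ m ih =>
      intro hm x hx j hj
      have h1 := ih (Nat.le_of_succ_le hm) _ (hs ⟨m, hm⟩ ⟨x, hx⟩) j (Nat.le_of_succ_le hj)
      have hne : j ≠ ⟨m, hm⟩ := fun h => by
        rw [h] at hj
        exact absurd hj (by simp)
      simpa [Pi.single_eq_of_ne hne] using h1
  have h1 := key i i.2.le _ (hs i x)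
  refine ⟨?_, fun j hj => key (i + 1) i.2 x x.2 j hj⟩
  have h2 := h1 i le_rfl
  simp only [LinearEquiv.coe_coe, map_sub, LinearEquiv.symm_apply_apply, Pi.sub_apply,
    Pi.single_eq_same] at h2
  exact (sub_eq_zero.1 h2).symm

/-- In the coordinates of a splitting, the dilations of an element of `F^{i+1}` converge to the
class of the element. -/
theorem tendsto_dilation {κ : Type*} [Fintype κ] [DecidableEq κ] {s : Graded Fl r ≃ₗ[ℝ] E}
    (h : IsFullFlag Fl r) (hs : IsSplitting Fl r s.toLinearMap)
    {C : ∀ i : Fin r, GradedPiece Fl i →ₗ[ℝ] GradedPiece Fl i →ₗ[ℝ] ℝ}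
    {c : Basis κ ℝ (Graded Fl r)} {d : κ → Fin r}
    (hd : IsHomogeneous c d) (hc : ∀ a b, sumForm C (c a) (c b) = if a = b then 1 else 0)
    (i : Fin r) (x : Fl (i + 1)) (a : κ) :
    Tendsto (fun ε : ℝ => (ε ^ ((d a : ℕ) + 1))⁻¹ * c.repr (s.symm x) a * ε ^ ((i : ℕ) + 1))
      (𝓝[≠] 0) (𝓝 (c.repr (Pi.single i (gradedMk Fl i x)) a)) := by
  obtain ⟨h1, h2⟩ := hs.symm_apply h i x
  -- Below the degree of `x` a positive power of `ε` remains; in that degree the powers cancel and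
  -- the coordinate is the one of the class; above it the coordinate vanishes.
  rcases lt_trichotomy (d a) i with hlt | heq | hlt
  · rw [repr_eq_zero_of_homogeneous hd hc (Pi.single_eq_of_ne hlt.ne _)]
    have h3 : Tendsto (fun ε : ℝ => c.repr (s.symm x) a * ε ^ ((i : ℕ) - d a)) (𝓝[≠] 0) (𝓝 0) := by
      have h4 : Tendsto (fun ε : ℝ => c.repr (s.symm x) a * ε ^ ((i : ℕ) - d a)) (𝓝 0)
          (𝓝 (c.repr (s.symm x) a * 0 ^ ((i : ℕ) - d a))) :=
        (continuous_const.mul (continuous_pow _)).tendsto 0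
      rw [zero_pow (by have : (d a : ℕ) < i := hlt; omega), mul_zero] at h4
      exact h4.mono_left nhdsWithin_le_nhds
    refine h3.congr' ?_
    filter_upwards [self_mem_nhdsWithin] with ε hε
    have hε' : ε ≠ 0 := hε
    have h5 : ε ^ ((i : ℕ) + 1) = ε ^ ((d a : ℕ) + 1) * ε ^ ((i : ℕ) - d a) := by
      rw [← pow_add]
      congr 1
      have : (d a : ℕ) < i := hlt
      omega
    rw [h5]
    field_simp
  · refine tendsto_const_nhds.congr' ?_
    filter_upwards [self_mem_nhdsWithin] with ε hε
    have hε' : ε ≠ 0 := hε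
    have h3 : c.repr (s.symm x - Pi.single i (gradedMk Fl i x)) a = 0 :=
      repr_eq_zero_of_homogeneous hd hc (by rw [heq, Pi.sub_apply, h1, Pi.single_eq_same, sub_self])
    rw [map_sub, Finsupp.sub_apply, sub_eq_zero] at h3
    rw [heq, h3]
    field_simp
  · rw [repr_eq_zero_of_homogeneous hd hc (Pi.single_eq_of_ne hlt.ne' _),
      repr_eq_zero_of_homogeneous hd hc (h2 _ hlt)]
    simp

theorem finrank_gradedPiece [FiniteDimensional ℝ E] (h : Monotone Fl) (i : ℕ) :
    finrank ℝ (GradedPiece Fl i) = finrank ℝ (Fl (i + 1)) - finrank ℝ (Fl i) := by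
  change finrank ℝ (Fl (i + 1) ⧸ (Fl i).submoduleOf (Fl (i + 1))) = _
  rw [Submodule.finrank_quotient,
    (Submodule.submoduleOfEquivOfLe (h (Nat.le_succ i))).finrank_eq]

/-- The map `(φ⁻¹ F)^{i+1} / (φ⁻¹ F)^i → F^{i+1} / F^i` induced by `φ`. -/
def gradedPieceComap {E' : Type*} [AddCommGroup E'] [Module ℝ E'] (φ : E' →ₗ[ℝ] E)
    (Fl : ℕ → Submodule ℝ E) (i : ℕ) :
    GradedPiece (fun i => (Fl i).comap φ) i →ₗ[ℝ] GradedPiece Fl i :=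
  Submodule.mapQ (((Fl i).comap φ).submoduleOf ((Fl (i + 1)).comap φ))
    ((Fl i).submoduleOf (Fl (i + 1)))
    (φ.restrict (p := (Fl (i + 1)).comap φ) (q := Fl (i + 1)) fun _ hv => hv)
    (fun _ hv => hv)

theorem gradedPieceComap_injective {E' : Type*} [AddCommGroup E'] [Module ℝ E'] (φ : E' →ₗ[ℝ] E)
    (i : ℕ) : Function.Injective (gradedPieceComap φ Fl i) := by
  rw [injective_iff_map_eq_zero]
  intro w hw
  obtain ⟨v, rfl⟩ := Submodule.mkQ_surjective _ w
  exact SubRiemannianStructure.gradedMk_eq_zero_iff (Fl := fun i => (Fl i).comap φ).2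
    (SubRiemannianStructure.gradedMk_eq_zero_iff (Fl := Fl).1 hw)

theorem gradedComap_single {E' : Type*} [AddCommGroup E'] [Module ℝ E'] (φ : E' →ₗ[ℝ] E)
    (i : Fin r) (w : GradedPiece (fun i => (Fl i).comap φ) i) :
    gradedComap φ Fl r (Pi.single i w) = Pi.single i (gradedPieceComap φ Fl i w) := by
  ext1 j
  change gradedPieceComap φ Fl j (Pi.single (M := fun i : Fin r =>
    GradedPiece (fun i => (Fl i).comap φ) i) i w j) = _
  by_cases h : j = i
  · subst h
    simp
  · rw [Pi.single_eq_of_ne h, Pi.single_eq_of_ne h, map_zero]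

end Splittings

/-! ### Cometrics with polynomial entries and their leading coefficients -/

section PolynomialMatrices

open Polynomial

/-- This turns limits in `ε` into coefficients, which depend algebraically on the data. The
remainder `R = p - c X^m` factors as `X^t q` with `q(0) ≠ 0`; if `t ≤ m`, the hypothesis forces
`q(0) = 0`, and if `t > m`, the coefficient of degree `m` is zero. -/
theorem coeff_eq_of_tendsto {p : ℝ[X]} {m : ℕ} {c : ℝ}
    (h : Tendsto (fun ε : ℝ => (ε ^ m)⁻¹ * p.eval ε) (𝓝[≠] 0) (𝓝 c)) : p.coeff m = c := by
  set R : ℝ[X] := p - C c * X ^ m with hR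
  have h1 : Tendsto (fun ε : ℝ => (ε ^ m)⁻¹ * R.eval ε) (𝓝[≠] 0) (𝓝 0) := by
    have h2 : Tendsto (fun ε : ℝ => (ε ^ m)⁻¹ * p.eval ε - c) (𝓝[≠] 0) (𝓝 (c - c)) :=
      h.sub_const c
    rw [sub_self] at h2
    refine h2.congr' ?_
    filter_upwards [self_mem_nhdsWithin] with ε hε
    have hε' : ε ≠ 0 := hε
    simp only [hR, eval_sub, eval_mul, eval_C, eval_pow, eval_X]
    field_simp
  suffices h0 : R.coeff m = 0 by
    have : R.coeff m = p.coeff m - c := by simp [hR]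
    linarith
  by_contra hne
  have hR0 : R ≠ 0 := fun h => hne (by simp [h])
  obtain ⟨q, hq⟩ := exists_eq_pow_rootMultiplicity_mul_and_not_dvd R hR0 0
  obtain ⟨hq, hdvd⟩ := hq
  set t := rootMultiplicity 0 R
  rw [C_0, sub_zero] at hq hdvd
  have htm : t ≤ m := by
    by_contra hlt
    apply hne
    rw [hq, coeff_X_pow_mul', if_neg (by omega)]
  have h2 : Tendsto (fun ε : ℝ => ε ^ (m - t) * ((ε ^ m)⁻¹ * R.eval ε)) (𝓝[≠] 0)
      (𝓝 (0 ^ (m - t) * 0)) :=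
    (((continuous_pow (m - t)).tendsto (0 : ℝ)).mono_left nhdsWithin_le_nhds).mul h1
  have h3 : Tendsto (fun ε : ℝ => q.eval ε) (𝓝[≠] 0) (𝓝 (q.eval 0)) :=
    (q.continuous.tendsto 0).mono_left nhdsWithin_le_nhds
  have h4 : q.eval 0 = 0 ^ (m - t) * 0 := by
    refine tendsto_nhds_unique h3 (h2.congr' ?_)
    filter_upwards [self_mem_nhdsWithin] with ε hε
    have hε' : ε ≠ 0 := hε
    have h5 : ε ^ m = ε ^ (m - t) * ε ^ t := by
      rw [← pow_add]
      congr 1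
      omega
    rw [hq, eval_mul, eval_pow, eval_X, h5]
    field_simp
  rw [mul_zero, ← coeff_zero_eq_eval_zero, ← X_dvd_iff] at h4
  exact hdvd h4

variable {R S : Type*} [CommRing R] [CommRing S] {μ κ ν : Type*} [Fintype μ] [DecidableEq μ]
  [Fintype κ] [DecidableEq κ] [Fintype ν] [DecidableEq ν]

/-- The matrix whose columns are the columns of `A`, multiplied by `X ^ deg`. -/
def scaledMatrix (deg : κ → ℕ) (A : Matrix μ κ R) : Matrix μ κ R[X] :=
  Matrix.of fun a I => C (A a I) * X ^ deg I

/-- The matrix `A_X Γ A_X^T`, where `A_X` is the rescaled matrix `A`. -/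
def cometric (deg : κ → ℕ) (A : Matrix μ κ R) (Γ : Matrix κ κ R) : Matrix μ μ R[X] :=
  scaledMatrix deg A * Γ.map C * (scaledMatrix deg A).transpose

/-- The determinant of `W^T adj(A_X Γ A_X^T) W`. -/
def gramDet (deg : κ → ℕ) (A : Matrix μ κ R) (Γ : Matrix κ κ R) (W : Matrix μ ν R) : R[X] :=
  ((W.map C).transpose * (cometric deg A Γ).adjugate * W.map C).det

/-- Naturality in the coefficient ring is used later with evaluation on a ring of smooth functions,
which makes all polynomial coefficients smooth at once. -/
theorem cometric_map (f : R →+* S) (deg : κ → ℕ) (A : Matrix μ κ R) (Γ : Matrix κ κ R) :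
    (cometric deg A Γ).map (mapRingHom f) = cometric deg (A.map f) (Γ.map f) := by
  have h : (scaledMatrix deg A).map (mapRingHom f) = scaledMatrix deg (A.map f) := by
    ext1 a I
    simp [scaledMatrix]
  have h' : (Γ.map C).map (mapRingHom f) = (Γ.map f).map C := by
    ext1 a I
    simp
  rw [cometric, cometric, Matrix.map_mul, Matrix.map_mul, ← h, ← h', Matrix.transpose_map]

theorem cometric_det_map (f : R →+* S) (deg : κ → ℕ) (A : Matrix μ κ R) (Γ : Matrix κ κ R) :
    (cometric deg (A.map f) (Γ.map f)).det = (cometric deg A Γ).det.map f := by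
  rw [← cometric_map, ← coe_mapRingHom, RingHom.map_det]
  rfl

theorem gramDet_map (f : R →+* S) (deg : κ → ℕ) (A : Matrix μ κ R) (Γ : Matrix κ κ R)
    (W : Matrix μ ν R) :
    gramDet deg (A.map f) (Γ.map f) (W.map f) = (gramDet deg A Γ W).map f := by
  have h' : (W.map f).map C = (W.map C).map (mapRingHom f) := by
    ext1 a I
    simp
  rw [gramDet, gramDet, ← cometric_map, ← coe_mapRingHom, RingHom.map_det, h',
    ← RingHom.mapMatrix_apply, ← RingHom.map_adjugate]
  simp only [RingHom.mapMatrix_apply, Matrix.map_mul, Matrix.transpose_map]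

/-- The matrix whose columns are the columns of `A`, multiplied by `ε ^ deg`. -/
def dilatedMatrix (deg : κ → ℕ) (A : Matrix μ κ R) (ε : R) : Matrix μ κ R :=
  Matrix.of fun a I => A a I * ε ^ deg I

theorem cometric_eval (deg : κ → ℕ) (A : Matrix μ κ R) (Γ : Matrix κ κ R) (ε : R) :
    (cometric deg A Γ).map (evalRingHom ε) =
      dilatedMatrix deg A ε * Γ * (dilatedMatrix deg A ε).transpose := by
  have h : (scaledMatrix deg A).map (evalRingHom ε) = dilatedMatrix deg A ε := by
    ext1 a I
    simp [scaledMatrix, dilatedMatrix]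
  have h' : (Γ.map C).map (evalRingHom ε) = Γ := by
    ext1 a I
    simp
  rw [cometric, Matrix.map_mul, Matrix.map_mul, h', Matrix.transpose_map, h]

theorem cometric_det_eval (deg : κ → ℕ) (A : Matrix μ κ R) (Γ : Matrix κ κ R) (ε : R) :
    (cometric deg A Γ).det.eval ε =
      (dilatedMatrix deg A ε * Γ * (dilatedMatrix deg A ε).transpose).det := by
  rw [← cometric_eval, ← coe_evalRingHom, RingHom.map_det]
  rfl

theorem gramDet_eval (deg : κ → ℕ) (A : Matrix μ κ R) (Γ : Matrix κ κ R) (W : Matrix μ ν R)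
    (ε : R) :
    (gramDet deg A Γ W).eval ε = (W.transpose *
      (dilatedMatrix deg A ε * Γ * (dilatedMatrix deg A ε).transpose).adjugate * W).det := by
  have h' : (W.map C).map (evalRingHom ε) = W := by
    ext1 a I
    simp
  rw [gramDet, ← coe_evalRingHom, RingHom.map_det]
  simp only [RingHom.mapMatrix_apply, Matrix.map_mul, Matrix.transpose_map, h']
  rw [← cometric_eval, ← RingHom.mapMatrix_apply, ← RingHom.mapMatrix_apply, RingHom.map_adjugate]

/-- A Gram determinant scales by the square of the determinant of the change of vectors, just as the
square of a top-degree form does. -/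
theorem gramDet_mul (deg : κ → ℕ) (A : Matrix μ κ R) (Γ : Matrix κ κ R) (W : Matrix μ ν R)
    (Q : Matrix ν ν R) : gramDet deg A Γ (W * Q) = C (Q.det ^ 2) * gramDet deg A Γ W := by
  have h : (Q.map C).det = C Q.det := by
    rw [RingHom.map_det]
    rfl
  have h2 : (W * Q).map (C : R →+* R[X]) = W.map C * Q.map C := Matrix.map_mul
  rw [gramDet, gramDet, h2, Matrix.transpose_mul]
  simp only [← Matrix.mul_assoc]
  rw [Matrix.det_mul, Matrix.mul_assoc, Matrix.mul_assoc, Matrix.det_mul, Matrix.det_transpose, h,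
    C_pow, Matrix.mul_assoc]
  ring

/-- If the rescaled matrix `A_ε` and a matrix `W` converge to `A₀` and `W₀` after dilations with the
weights `d` and `d'`, where `A₀ Γ A₀^T = 1` and `W₀^T W₀ = 1`, then the leading coefficients of
the determinants are determined by the matrix `P`. -/
theorem coeff_of_tendsto_dilation {deg : κ → ℕ} {A : Matrix μ κ ℝ} {Γ : Matrix κ κ ℝ}
    {W : Matrix μ ν ℝ} {P : Matrix μ μ ℝ} (hP : P.det ≠ 0) {d : μ → ℕ} {d' : ν → ℕ}
    {A₀ : Matrix μ κ ℝ} {W₀ : Matrix μ ν ℝ}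
    (hA : ∀ a I, Tendsto (fun ε : ℝ => (ε ^ d a)⁻¹ * (P * A) a I * ε ^ deg I) (𝓝[≠] 0)
      (𝓝 (A₀ a I)))
    (hW : ∀ a j, Tendsto (fun ε : ℝ => (ε ^ d a)⁻¹ * (P * W) a j * ε ^ d' j) (𝓝[≠] 0)
      (𝓝 (W₀ a j)))
    (hA₀ : A₀ * Γ * A₀.transpose = 1) (hW₀ : W₀.transpose * W₀ = 1) :
    (cometric deg A Γ).det.coeff (2 * ∑ a, d a) = (P.det ^ 2)⁻¹ ∧
      (X ^ (2 * ∑ j, d' j) * gramDet deg A Γ W).coeff (2 * (∑ a, d a) * Fintype.card ν) =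
        (P.det ^ 2)⁻¹ ^ Fintype.card ν := by
  -- `D` undoes the weights of the rows and `D'` puts weights on the columns of `W`. Their
  -- determinants account for the powers of `ε` in the two conclusions.
  let D : ℝ → Matrix μ μ ℝ := fun ε => Matrix.diagonal fun a => (ε ^ d a)⁻¹
  let D' : ℝ → Matrix ν ν ℝ := fun ε => Matrix.diagonal fun j => ε ^ d' j
  let H : ℝ → Matrix μ μ ℝ := fun ε =>
    dilatedMatrix deg A ε * Γ * (dilatedMatrix deg A ε).transpose
  have hD : ∀ ε, (D ε).det = (ε ^ ∑ a, d a)⁻¹ := fun ε => by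
    rw [Matrix.det_diagonal, Finset.prod_inv_distrib, Finset.prod_pow_eq_pow_sum]
  have hD' : ∀ ε, (D' ε).det = ε ^ ∑ j, d' j := fun ε => by
    rw [Matrix.det_diagonal, Finset.prod_pow_eq_pow_sum]
  have hA' : Tendsto (fun ε => D ε * P * dilatedMatrix deg A ε) (𝓝[≠] 0) (𝓝 A₀) := by
    refine tendsto_pi_nhds.2 fun a => tendsto_pi_nhds.2 fun I => (hA a I).congr fun ε => ?_
    rw [Matrix.mul_assoc, Matrix.diagonal_mul, mul_assoc]
    congr 1
    simp only [Matrix.mul_apply, dilatedMatrix, Matrix.of_apply, Finset.sum_mul, mul_assoc]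
  have hW' : Tendsto (fun ε => D ε * P * W * D' ε) (𝓝[≠] 0) (𝓝 W₀) := by
    refine tendsto_pi_nhds.2 fun a => tendsto_pi_nhds.2 fun I => (hW a I).congr fun ε => ?_
    rw [Matrix.mul_diagonal, Matrix.mul_assoc, Matrix.diagonal_mul]
  have hcont : Continuous fun N : Matrix μ κ ℝ => N * Γ * N.transpose :=
    (continuous_id.matrix_mul continuous_const).matrix_mul continuous_id.matrix_transpose
  have hK : ∀ ε, (D ε * P * dilatedMatrix deg A ε) * Γ *
      (D ε * P * dilatedMatrix deg A ε).transpose = D ε * P * H ε * (D ε * P).transpose :=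
    fun ε => by simp only [H, Matrix.transpose_mul, Matrix.mul_assoc]
  have hHlim : Tendsto (fun ε => D ε * P * H ε * (D ε * P).transpose) (𝓝[≠] 0) (𝓝 1) := by
    rw [← hA₀]
    exact ((hcont.tendsto A₀).comp hA').congr hK
  have hdet : Tendsto (fun ε => (D ε * P * H ε * (D ε * P).transpose).det) (𝓝[≠] 0) (𝓝 1) := by
    have := ((continuous_id.matrix_det (n := μ) (R := ℝ)).tendsto 1).comp hHlim
    rwa [id, Matrix.det_one] at this
  have hG : Tendsto (fun ε => ((D ε * P * W * D' ε).transpose *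
      (D ε * P * H ε * (D ε * P).transpose).adjugate * (D ε * P * W * D' ε)).det)
      (𝓝[≠] 0) (𝓝 1) := by
    have hc : Continuous fun x : Matrix μ ν ℝ × Matrix μ μ ℝ =>
        (x.1.transpose * x.2.adjugate * x.1).det :=
      ((continuous_fst.matrix_transpose.matrix_mul continuous_snd.matrix_adjugate).matrix_mul
        continuous_fst).matrix_det
    have := (hc.tendsto (W₀, 1)).comp (hW'.prodMk_nhds hHlim)
    simp only [Matrix.adjugate_one, Matrix.mul_one, hW₀, Matrix.det_one] at this
    exact this
  constructor
  · refine coeff_eq_of_tendsto ?_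
    have h1 := hdet.const_mul (P.det ^ 2)⁻¹
    rw [mul_one] at h1
    refine h1.congr' ?_
    filter_upwards [self_mem_nhdsWithin] with ε hε
    have hε' : ε ≠ 0 := hε
    rw [cometric_det_eval, Matrix.det_mul, Matrix.det_transpose, Matrix.det_mul, Matrix.det_mul, hD]
    change _ = _ * (H ε).det
    rw [pow_mul']
    field_simp
  · refine coeff_eq_of_tendsto ?_
    have h1 := hG.const_mul ((P.det ^ 2)⁻¹ ^ Fintype.card ν)
    rw [mul_one] at h1
    refine h1.congr' ?_
    filter_upwards [self_mem_nhdsWithin] with ε hε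
    have hε' : ε ≠ 0 := hε
    -- The adjugate is multiplicative up to order and `M adj(M) = det M`, so `D P` leaves the
    -- expression as a scalar. The adjugate replaces the inverse in order to stay within polynomials
    -- in `ε`.
    have h2 : (D ε * P * W * D' ε).transpose * (D ε * P * H ε * (D ε * P).transpose).adjugate *
        (D ε * P * W * D' ε) =
        ((D ε * P).det ^ 2) • ((D' ε).transpose * (W.transpose * (H ε).adjugate * W) * D' ε) := by
      have h3 : (D ε * P).transpose * (D ε * P).transpose.adjugate
          = (D ε * P).det • (1 : Matrix μ μ ℝ) := by
        rw [Matrix.mul_adjugate, Matrix.det_transpose]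
      have h4 : (D ε * P).adjugate * (D ε * P) = (D ε * P).det • (1 : Matrix μ μ ℝ) :=
        Matrix.adjugate_mul _
      calc _ = (D' ε).transpose * W.transpose *
            ((D ε * P).transpose * (D ε * P).transpose.adjugate) * (H ε).adjugate *
            ((D ε * P).adjugate * (D ε * P)) * W * D' ε := by
            simp only [Matrix.transpose_mul, Matrix.adjugate_mul_distrib, Matrix.mul_assoc]
        _ = _ := by
            rw [h3, h4, pow_two]
            simp only [Matrix.mul_smul, Matrix.smul_mul, Matrix.mul_one, Matrix.mul_assoc,
              smul_smul]
    rw [h2, Matrix.det_smul, Matrix.det_mul, Matrix.det_mul, Matrix.det_mul, Matrix.det_transpose,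
      hD, hD', eval_mul, eval_pow, eval_X, gramDet_eval]
    change _ = _ * (_ * (W.transpose * (H ε).adjugate * W).det)
    rw [mul_comm 2 (∑ j, d' j), pow_mul, mul_comm 2 (∑ a, d a), pow_mul, pow_mul]
    generalize (W.transpose * (H ε).adjugate * W).det = w
    have hu : ε ^ ∑ a, d a ≠ 0 := pow_ne_zero _ hε'
    generalize ε ^ ∑ a, d a = u at hu
    rw [mul_pow, mul_pow, inv_pow, inv_pow, inv_pow]
    have hP2 : (P.det ^ 2) ^ Fintype.card ν ≠ 0 := pow_ne_zero _ (pow_ne_zero _ hP)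
    field_simp

end PolynomialMatrices

/-! ### The square of the volume form as a ratio of coefficients -/

section PointwiseFormula

open Polynomial

variable {E E' : Type*} [AddCommGroup E] [Module ℝ E] [AddCommGroup E'] [Module ℝ E']
  {Fl : ℕ → Submodule ℝ E} {r : ℕ}

/-- The homogeneous dimension of a flag. -/
def flagWeight (Fl : ℕ → Submodule ℝ E) (r : ℕ) : ℕ :=
  ∑ i : Fin r, ((i : ℕ) + 1) * finrank ℝ (GradedPiece Fl i)

/-- The scalar products that a map `φ : E' → E` induces on the pieces of `gr(φ⁻¹ F)`. -/
def comapForm (φ : E' →ₗ[ℝ] E) (C : ∀ i : Fin r, GradedPiece Fl i →ₗ[ℝ] GradedPiece Fl i →ₗ[ℝ] ℝ)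
    (i : Fin r) : GradedPiece (fun i => (Fl i).comap φ) i →ₗ[ℝ]
      GradedPiece (fun i => (Fl i).comap φ) i →ₗ[ℝ] ℝ :=
  (C i).compl₁₂ (gradedPieceComap φ Fl i) (gradedPieceComap φ Fl i)

theorem isScalarProduct_comapForm {φ : E' →ₗ[ℝ] E}
    {C : ∀ i : Fin r, GradedPiece Fl i →ₗ[ℝ] GradedPiece Fl i →ₗ[ℝ] ℝ}
    (hC : ∀ i, IsScalarProduct (C i)) (i : Fin r) : IsScalarProduct (comapForm φ C i) where
  symm _ _ := (hC i).symm _ _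
  pos v hv := (hC i).pos _ fun h => hv
    (gradedPieceComap_injective φ i (by rw [h, map_zero]))

theorem sumForm_comapForm (φ : E' →ₗ[ℝ] E)
    (C : ∀ i : Fin r, GradedPiece Fl i →ₗ[ℝ] GradedPiece Fl i →ₗ[ℝ] ℝ)
    (u v : Graded (fun i => (Fl i).comap φ) r) :
    sumForm (comapForm φ C) u v = sumForm C (gradedComap φ Fl r u) (gradedComap φ Fl r v) := by
  rw [sumForm_apply, sumForm_apply]
  rfl

variable [FiniteDimensional ℝ E] {n k : ℕ}

/-- In splittings and homogeneous orthonormal bases the dilated matrices converge to coordinates of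
classes, to which `coeff_of_tendsto_dilation` applies. The number `δ` is `(det P)^{-2}`. The factor
`X ^ (2 Q_N)` avoids the subtraction `2 Q k - 2 Q_N` of natural numbers. -/
theorem coeff_gramDet_eq (h : IsFullFlag Fl r) {φ : E' →ₗ[ℝ] E}
    (hN : IsFullFlag (fun i => (Fl i).comap φ) r) [FiniteDimensional ℝ E']
    (hk : finrank ℝ E' = k)
    {C : ∀ i : Fin r, GradedPiece Fl i →ₗ[ℝ] GradedPiece Fl i →ₗ[ℝ] ℝ}
    (hC : ∀ i, IsScalarProduct (C i))
    {T : Fin r → Type*} [∀ i, AddCommGroup (T i)] [∀ i, Module ℝ (T i)]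
    {B : ∀ i, T i →ₗ[ℝ] T i →ₗ[ℝ] ℝ} (hB : ∀ i, IsScalarProduct (B i))
    {q : ∀ i : Fin r, T i →ₗ[ℝ] GradedPiece Fl i} {σ : ∀ i : Fin r, GradedPiece Fl i →ₗ[ℝ] T i}
    (hσ : ∀ i w, q i (σ i w) = w) (hadj : ∀ i w t, B i (σ i w) t = C i w (q i t))
    {κ : Fin r → Type*} [∀ i, Fintype (κ i)] [∀ i, DecidableEq (κ i)]
    (e : ∀ i, Basis (κ i) ℝ (T i)) (z : ∀ i : Fin r, κ i → Fl (i + 1))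
    (hz : ∀ i I, q i (e i I) = gradedMk Fl i (z i I)) (β : Basis (Fin n) ℝ E)
    {A : Matrix (Fin n) (Σ i, κ i) ℝ} (hA : A = Matrix.of fun a x => β.repr (z x.1 x.2) a)
    {Γ : Matrix (Σ i, κ i) (Σ i, κ i) ℝ} (hΓ : Γ = (gramMatrix (sumForm B) (Pi.basis e))⁻¹)
    (w : Fin k → E') {W : Matrix (Fin n) (Fin k) ℝ}
    (hW : W = Matrix.of fun a j => β.repr (φ (w j)) a) {η : E' [⋀^Fin k]→ₗ[ℝ] ℝ}
    {b : Basis (Fin k) ℝ (Graded (fun i => (Fl i).comap φ) r)}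
    (hb : ∀ i j, sumForm C (gradedComap φ Fl r (b i)) (gradedComap φ Fl r (b j))
      = if i = j then 1 else 0)
    (hη : flagIso hN k η = b.det ∨ flagIso hN k η = -b.det) :
    ∃ δ ≠ 0, (cometric (fun x : Σ i, κ i => (x.1 : ℕ) + 1) A Γ).det.coeff (2 * flagWeight Fl r) = δ ∧
      (X ^ (2 * flagWeight (fun i => (Fl i).comap φ) r) *
        gramDet (fun x : Σ i, κ i => (x.1 : ℕ) + 1) A Γ W).coeff (2 * flagWeight Fl r * k) =
          η w ^ 2 * δ ^ k := by
  obtain ⟨s, hs⟩ := exists_splitting h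
  obtain ⟨sN, hsN⟩ := exists_splitting hN
  have hgr : finrank ℝ (Graded Fl r) = n := by
    rw [s.finrank_eq, finrank_eq_card_basis β, Fintype.card_fin]
  have hgrN : finrank ℝ (Graded (fun i => (Fl i).comap φ) r) = k := by
    rw [sN.finrank_eq, hk]
  obtain ⟨c, d, hcd, hc, hd⟩ := exists_homogeneous_orthonormal_basis hC hgr
  obtain ⟨b₀, d', hbd, hb₀, hd'⟩ :=
    exists_homogeneous_orthonormal_basis (isScalarProduct_comapForm (φ := φ) hC) hgrN
  -- Squaring removes both sign ambiguities, and the canonical isomorphism may be computed with the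
  -- splitting `sN`.
  have hcomp : η w ^ 2 = (b₀.det (sN.symm ∘ w)) ^ 2 := by
    have h1 : η w = flagIso hN k η (sN.symm ∘ w) := by
      rw [flagIso_apply hN hk hsN]
      simp [AlternatingMap.compLinearMap_apply, Function.comp_def]
    have h2 : b.det = b₀.det ∨ b.det = -b₀.det :=
      det_eq_or_eq_neg_of_orthonormal hb₀ fun i j => by rw [sumForm_comapForm, hb]
    rw [h1]
    rcases hη with h3 | h3 <;> rcases h2 with h4 | h4 <;> simp [h3, h4]
  set P : Matrix (Fin n) (Fin n) ℝ := (c.map s).toMatrix β with hPdef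
  have hP : P.det ≠ 0 := ((c.map s).isUnit_det β).ne_zero
  have hPrepr : ∀ x a, ∑ j, P a j * β.repr x j = c.repr (s.symm x) a := fun x a =>
    congrFun (β.toMatrix_mulVec_repr (c.map s) x) a
  -- Only vectors adapted to the flag have a dilation limit, so `w` is first expressed in the lifted
  -- basis; the change of basis has determinant `± η w`.
  set W₁ : Matrix (Fin n) (Fin k) ℝ := Matrix.of fun a j => β.repr (φ (sN (b₀ j))) a with hW₁
  have hWmul : W = W₁ * (b₀.map sN).toMatrix w := by
    ext a j
    rw [hW, Matrix.mul_apply, Matrix.of_apply]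
    conv_lhs => rw [← (b₀.map sN).sum_repr (w j)]
    simp only [map_sum, map_smul, Finsupp.coe_finsetSum, Finset.sum_apply, Finsupp.coe_smul,
      Pi.smul_apply, smul_eq_mul, hW₁, Matrix.of_apply, Basis.map_apply]
    exact Finset.sum_congr rfl fun i _ => mul_comm _ _
  have hlimA : ∀ a (x : Σ i, κ i), Tendsto (fun ε : ℝ => (ε ^ ((d a : ℕ) + 1))⁻¹ * (P * A) a x *
      ε ^ ((x.1 : ℕ) + 1)) (𝓝[≠] 0)
      (𝓝 ((Matrix.of fun a (x : Σ i, κ i) =>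
        c.repr (LinearMap.piMap q (Pi.basis e x)) a) a x)) := fun a x => by
    have h1 := tendsto_dilation h hs hcd hc x.1 (z x.1 x.2) a
    have h2 : LinearMap.piMap q (Pi.basis e x) = Pi.single x.1 (gradedMk Fl x.1 (z x.1 x.2)) := by
      rw [Pi.basis_apply, ← hz]
      ext1 j
      change q j (Pi.single x.1 (e x.1 x.2) j) = _
      by_cases hj : j = x.1
      · subst hj
        simp
      · rw [Pi.single_eq_of_ne hj, Pi.single_eq_of_ne hj, map_zero]
    rw [Matrix.of_apply, h2]
    convert! h1 using 5
    rw [hA, Matrix.mul_apply]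
    exact hPrepr _ _
  have hlimW : ∀ a j, Tendsto (fun ε : ℝ => (ε ^ ((d a : ℕ) + 1))⁻¹ * (P * W₁) a j *
      ε ^ ((d' j : ℕ) + 1)) (𝓝[≠] 0)
      (𝓝 ((Matrix.of fun a j => c.repr (gradedComap φ Fl r (b₀ j)) a) a j)) := fun a j => by
    obtain ⟨v, hv⟩ := hbd j
    obtain ⟨v, rfl⟩ := Submodule.mkQ_surjective _ v
    have h0 := hsN (d' j) v
    have h3 : sN (b₀ j) ∈ ((Fl ((d' j : ℕ) + 1)).comap φ) := by
      rw [hv, ← sub_add_cancel (sN _) (v : E')]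
      exact Submodule.add_mem _ (hN.mono (Nat.le_succ _) h0) v.2
    have h1 := tendsto_dilation h hs hcd hc (d' j) ⟨φ (sN (b₀ j)), h3⟩ a
    have h2 : gradedComap φ Fl r (b₀ j) =
        Pi.single (d' j) (gradedMk Fl (d' j) ⟨φ (sN (b₀ j)), h3⟩) := by
      conv_lhs => rw [hv]
      rw [gradedComap_single]
      congr 1
      rw [← sub_eq_zero, ← neg_eq_zero, neg_sub]
      change gradedMk Fl (d' j) _ - gradedMk Fl (d' j) _ = 0
      rw [← map_sub, SubRiemannianStructure.gradedMk_eq_zero_iff]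
      have h4 : φ (sN (b₀ j) - v) ∈ Fl (d' j) := by
        rw [hv]
        exact h0
      rw [map_sub] at h4
      exact h4
    rw [Matrix.of_apply, h2]
    convert! h1 using 5
    rw [hW₁, Matrix.mul_apply]
    exact hPrepr _ _
  -- The orthogonal sum of the maps `q i` is treated as one surjection onto the graded space.
  have hA₀ := coordinates_cometric (isScalarProduct_sumForm hB) (q := LinearMap.piMap q)
    (C := sumForm C) (s := LinearMap.piMap σ) (fun w => funext fun i => hσ i (w i))
    (fun w t => by simp [sumForm_apply, hadj]) (Pi.basis e) c hc
  rw [← hΓ] at hA₀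
  have hW₀ : (Matrix.of fun a j => c.repr (gradedComap φ Fl r (b₀ j)) a).transpose *
      (Matrix.of fun a j => c.repr (gradedComap φ Fl r (b₀ j)) a) = 1 := by
    ext i j
    rw [Matrix.mul_apply, Matrix.one_apply, ← hb₀ i j, sumForm_comapForm,
      apply_eq_sum_of_orthonormal hc]
    rfl
  obtain ⟨h1, h2⟩ := coeff_of_tendsto_dilation (deg := fun x : Σ i, κ i => (x.1 : ℕ) + 1) hP
    hlimA hlimW hA₀ hW₀
  rw [hd] at h1
  rw [hd, hd', Fintype.card_fin] at h2
  refine ⟨_, inv_ne_zero (pow_ne_zero 2 hP), h1, ?_⟩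
  have hdet : ((b₀.map sN).toMatrix w).det = b₀.det (sN.symm ∘ w) := by
    rw [← Basis.det_apply, Basis.det_map]
  rw [hWmul, gramDet_mul, hdet, ← hcomp, mul_left_comm, coeff_C_mul]
  rw [show (flagWeight (fun i => (Fl i).comap φ) r)
    = ∑ i : Fin r, ((i : ℕ) + 1) * finrank ℝ (GradedPiece (fun i => (Fl i).comap φ) i) from rfl,
    show flagWeight Fl r = ∑ i : Fin r, ((i : ℕ) + 1) * finrank ℝ (GradedPiece Fl i) from rfl, h2]

end PointwiseFormula

/-! ### The graded inner product and the Popp form at a point -/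

section Pointwise

open Polynomial

variable {n : ℕ} {M : Type*} [TopologicalSpace M] [T2Space M]
  [ChartedSpace (EuclideanSpace ℝ (Fin n)) M]
  [IsManifold (𝓡 n) ∞ M]
  {F : Type*} [NormedAddCommGroup F] [NormedSpace ℝ F] [FiniteDimensional ℝ F]
  {U : M → Type*} [TopologicalSpace (Bundle.TotalSpace F U)]
  [∀ x, TopologicalSpace (U x)] [∀ x, AddCommGroup (U x)] [∀ x, Module ℝ (U x)]
  [∀ x, IsTopologicalAddGroup (U x)] [∀ x, ContinuousConstSMul ℝ (U x)]
  [FiberBundle F U] [VectorBundle ℝ F U] [ContMDiffVectorBundle ∞ F U (𝓡 n)]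

theorem finrank_tangentSpace {k : ℕ} {N : Type*} [TopologicalSpace N]
    [ChartedSpace (EuclideanSpace ℝ (Fin k)) N] (p : N) :
    finrank ℝ (TangentSpace (𝓡 k) p) = k :=
  finrank_euclideanSpace_fin (𝕜 := ℝ) (n := k)

theorem finiteDimensional_tangentSpace {k : ℕ} {N : Type*} [TopologicalSpace N]
    [ChartedSpace (EuclideanSpace ℝ (Fin k)) N] (p : N) :
    FiniteDimensional ℝ (TangentSpace (𝓡 k) p) :=
  inferInstanceAs (FiniteDimensional ℝ (EuclideanSpace ℝ (Fin k)))

theorem finiteDimensional_fiber {M : Type*} [TopologicalSpace M]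
    (F : Type*) [NormedAddCommGroup F] [NormedSpace ℝ F] [FiniteDimensional ℝ F]
    {U : M → Type*} [TopologicalSpace (Bundle.TotalSpace F U)]
    [∀ x, TopologicalSpace (U x)] [∀ x, AddCommGroup (U x)] [∀ x, Module ℝ (U x)]
    [FiberBundle F U] [VectorBundle ℝ F U] (x : M) : FiniteDimensional ℝ (U x) :=
  ((trivializationAt F U x).continuousLinearEquivAt ℝ x
    (FiberBundle.mem_baseSet_trivializationAt F U x)).toLinearEquiv.symm.finiteDimensional

/-- The scalar product of the fibre of `U`. -/
abbrev SubRiemannianStructure.fiberInner (S : SubRiemannianStructure n M F U) (x : M) :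
    U x →ₗ[ℝ] U x →ₗ[ℝ] ℝ :=
  ContinuousLinearMap.toLinearMap₁₂ (S.metric.inner x)

theorem SubRiemannianStructure.isScalarProduct_fiberInner (S : SubRiemannianStructure n M F U)
    (x : M) : IsScalarProduct (S.fiberInner x) where
  symm v w := S.metric.symm x v w
  pos v hv := S.metric.pos x v hv

/-- The polarization in the definition of the graded inner product is realized by bilinear forms,
together with the minimal-norm lifts adjoint to the bracket maps. -/
theorem SubRiemannianStructure.exists_gradedInner (S : SubRiemannianStructure n M F U) (x : M) :
    ∃ C : ∀ i : Fin (S.step x),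
        GradedPiece (S.flagAt x) i →ₗ[ℝ] GradedPiece (S.flagAt x) i →ₗ[ℝ] ℝ,
      (∀ i, IsScalarProduct (C i)) ∧ (∀ u v, S.gradedInner x u v = sumForm C u v) ∧
      ∃ σ : ∀ i : Fin (S.step x), GradedPiece (S.flagAt x) i →ₗ[ℝ]
          (⨂[ℝ] _ : Fin ((i : ℕ) + 1), U x),
        (∀ (i : Fin (S.step x)) w, S.bracketMap x i (σ i w) = w) ∧
        ∀ (i : Fin (S.step x)) w t, tensorInner (S.fiberInner x) _ (σ i w) t = C i w (S.bracketMap x i t) := by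
  have : FiniteDimensional ℝ (U x) := finiteDimensional_fiber F x
  have hfin : ∀ i : ℕ, FiniteDimensional ℝ (⨂[ℝ] _ : Fin i, U x) := fun i =>
    (Basis.piTensorProduct fun _ : Fin i => finBasis ℝ (U x)).finiteDimensional_of_finite
  choose C hC hCi σ hσ hadj using fun i : Fin (S.step x) =>
    exists_inducedInner (isScalarProduct_tensorInner (S.isScalarProduct_fiberInner x)
      ((i : ℕ) + 1)) (S.bracketMap_surjective x i)
  refine ⟨C, hC, fun u v => ?_, σ, hσ, hadj⟩
  rw [sumForm_apply]
  exact Finset.sum_congr rfl fun i _ => hCi i _ _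

/-- The scalar products of the tensor products of the sections `V_j`. -/
def tensorGram (S : SubRiemannianStructure n M F U) {m : ℕ}
    (V : Fin m → ContMDiffSection (𝓡 n) F ∞ U) (r : ℕ) (x : M) :
    Matrix (Σ i : Fin r, Fin ((i : ℕ) + 1) → Fin m) (Σ i : Fin r, Fin ((i : ℕ) + 1) → Fin m) ℝ :=
  Matrix.of fun I J => if h : I.1 = J.1 then
    ∏ l, S.metric.inner x (V (I.2 l) x) (V (J.2 (Fin.cast (by rw [h]) l)) x) else 0

theorem tensorGram_eq (S : SubRiemannianStructure n M F U) {m : ℕ}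
    (V : Fin m → ContMDiffSection (𝓡 n) F ∞ U) (r : ℕ) {x : M} {b : Basis (Fin m) ℝ (U x)}
    (hb : ∀ j, b j = V j x) :
    tensorGram S V r x = gramMatrix
      (sumForm fun i : Fin r => tensorInner (S.fiberInner x) ((i : ℕ) + 1))
      (Pi.basis fun i : Fin r => Basis.piTensorProduct fun _ : Fin ((i : ℕ) + 1) => b) := by
  ext ⟨i, I⟩ ⟨j, J⟩
  rw [gramMatrix, Matrix.of_apply, Pi.basis_apply, Pi.basis_apply, sumForm_single, tensorGram,
    Matrix.of_apply]
  by_cases h : i = j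
  · subst h
    simp only [dif_pos, Pi.single_eq_same, Basis.piTensorProduct_apply, tensorInner_tprod, hb]
    rfl
  · rw [dif_neg h, Pi.single_eq_of_ne h, map_zero]

variable {k : ℕ} {N : Type*} [TopologicalSpace N] [ChartedSpace (EuclideanSpace ℝ (Fin k)) N]
  {S : SubRiemannianStructure n M F U} {ι : N → M}

theorem finrank_restrictedGraded (hN : IsEquisingular (k := k) S ι) (p : N) :
    finrank ℝ (restrictedGraded (k := k) S ι p) = k := by
  obtain ⟨s, -⟩ := exists_splitting (hN.isFullFlag p)
  rw [s.finrank_eq, finrank_tangentSpace]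

theorem exists_isOrthonormalBasis (hN : IsEquisingular (k := k) S ι) (p : N) :
    ∃ b, IsOrthonormalBasis (k := k) S ι p b := by
  obtain ⟨C, hC, hCi, -⟩ := S.exists_gradedInner (ι p)
  have := finiteDimensional_tangentSpace (k := k) p
  obtain ⟨b, -, -, hb, -⟩ := exists_homogeneous_orthonormal_basis
    (isScalarProduct_comapForm (φ := tangentIncl ι p) hC) (finrank_restrictedGraded hN p)
  refine ⟨b, fun i j => ?_⟩
  rw [restrictedInner, hCi]
  exact (sumForm_comapForm _ C _ _).symm.trans (hb i j)

theorem isVolumeElement_iff {p : N} {b : Basis (Fin k) ℝ (restrictedGraded (k := k) S ι p)}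
    (hb : IsOrthonormalBasis S ι p b) (w : restrictedGraded (k := k) S ι p [⋀^Fin k]→ₗ[ℝ] ℝ) :
    IsVolumeElement S ι p w ↔ w = b.det ∨ w = -b.det := by
  refine ⟨?_, fun h => ⟨b, hb, h⟩⟩
  rintro ⟨b', hb', h⟩
  obtain ⟨C, hC, hCi, -⟩ := S.exists_gradedInner (ι p)
  have key : ∀ {b : Basis (Fin k) ℝ (restrictedGraded (k := k) S ι p)},
      IsOrthonormalBasis S ι p b → ∀ i j, sumForm (comapForm (tangentIncl ι p) C) (b i) (b j)
        = if i = j then 1 else 0 := fun hb i j =>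
    (sumForm_comapForm _ C _ _).trans ((hCi _ _).symm.trans (hb i j))
  have h2 : b'.det = b.det ∨ b'.det = -b.det :=
    det_eq_or_eq_neg_of_orthonormal (key hb) (key hb')
  rcases h2 with h1 | h1 <;> rcases h with h | h <;> simp [h, h1]

theorem exists_isVolumeElement (hN : IsEquisingular (k := k) S ι) (p : N) :
    ∃ v, v ≠ 0 ∧ ∀ w, IsVolumeElement (k := k) S ι p w ↔ w = v ∨ w = -v := by
  obtain ⟨b, hb⟩ := exists_isOrthonormalBasis hN p
  exact ⟨b.det, b.det_ne_zero, isVolumeElement_iff hb⟩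

theorem exists_isPositive_volumeElement (hN : IsEquisingular (k := k) S ι)
    (o : PointwiseOrientation k N) (p : N) :
    ∃ v, IsVolumeElement S ι p v ∧ IsPositive (o p) ((thetaN hN p).symm v) := by
  obtain ⟨v, hv, hiff⟩ := exists_isVolumeElement hN p
  have h0 : (thetaN hN p).symm v ≠ 0 := by simpa using hv
  have h0' : (thetaN hN p).symm (-v) ≠ 0 := by simpa using hv
  have := finiteDimensional_tangentSpace (k := k) p
  -- In top degree there are only two rays, so one of `v` and `-v` has the prescribed sign.
  rcases Orientation.eq_or_eq_neg (rayOfNeZero ℝ _ h0) (o p)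
    (by rw [Fintype.card_fin, finrank_tangentSpace]) with h | h
  · exact ⟨v, (hiff v).2 (Or.inl rfl), h0, h⟩
  · refine ⟨-v, (hiff _).2 (Or.inr rfl), h0', ?_⟩
    have h1 : rayOfNeZero ℝ (-(thetaN hN p).symm v) (neg_ne_zero.2 h0) = o p :=
      (neg_rayOfNeZero ℝ _ h0).symm.trans ((congrArg Neg.neg h).trans (neg_neg (o p)))
    rw [← h1]
    congr 1

theorem poppForm_spec (hN : IsEquisingular (k := k) S ι) (o : PointwiseOrientation k N) (p : N) :
    IsVolumeElement S ι p (thetaN hN p (poppForm hN o p)) ∧ IsPositive (o p) (poppForm hN o p) := by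
  have h := exists_isPositive_volumeElement hN o p
  rw [poppForm, dif_pos h, LinearEquiv.apply_symm_apply]
  exact h.choose_spec

/-- The matrix of the iterated brackets of the sections `V_j` at `x`. -/
def bracketMatrix (S : SubRiemannianStructure n M F U) {m : ℕ}
    (V : Fin m → ContMDiffSection (𝓡 n) F ∞ U) (r : ℕ) {x : M}
    (β : Basis (Fin n) ℝ (TangentSpace (𝓡 n) x)) :
    Matrix (Fin n) (Σ i : Fin r, Fin ((i : ℕ) + 1) → Fin m) ℝ :=
  Matrix.of fun a I => β.repr (S.iteratedBracket I.1 (fun l => V (I.2 l)) x) a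

/-- The integer `r` is kept separate from the step at `ι p` so that the index type of the matrices
can be the same at all points of `N`. -/
theorem poppForm_sq (hN : IsEquisingular (k := k) S ι) (o : PointwiseOrientation k N) (p : N)
    (β : Basis (Fin n) ℝ (TangentSpace (𝓡 n) (ι p))) {m : ℕ}
    {V : Fin m → ContMDiffSection (𝓡 n) F ∞ U} {b : Basis (Fin m) ℝ (U (ι p))}
    (hb : ∀ j, b j = V j (ι p)) (w : Fin k → TangentSpace (𝓡 k) p) {r : ℕ}
    (hr : S.step (ι p) = r) :
    ∃ δ ≠ 0, (cometric (fun I : Σ i : Fin r, Fin ((i : ℕ) + 1) → Fin m => (I.1 : ℕ) + 1)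
        (bracketMatrix S V r β) (tensorGram S V r (ι p))⁻¹).det.coeff
        (2 * flagWeight (S.flagAt (ι p)) r) = δ ∧
      (X ^ (2 * flagWeight (restrictedFlag (k := k) S ι p) r) *
        gramDet (fun I : Σ i : Fin r, Fin ((i : ℕ) + 1) → Fin m => (I.1 : ℕ) + 1)
        (bracketMatrix S V r β) (tensorGram S V r (ι p))⁻¹
        (Matrix.of fun a j => β.repr (tangentIncl ι p (w j)) a)).coeff
        (2 * flagWeight (S.flagAt (ι p)) r * k) = poppForm hN o p w ^ 2 * δ ^ k := by
  subst hr
  obtain ⟨C, hC, hCi, σ, hσ, hadj⟩ := S.exists_gradedInner (ι p)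
  have := finiteDimensional_tangentSpace (k := k) p
  have : FiniteDimensional ℝ (TangentSpace (𝓡 n) (ι p)) := finiteDimensional_tangentSpace _
  have : FiniteDimensional ℝ (U (ι p)) := finiteDimensional_fiber F _
  obtain ⟨⟨c, hc, hη⟩, -⟩ := poppForm_spec hN o p
  refine coeff_gramDet_eq (S.isFullFlag_flagAt (ι p)) (hN.isFullFlag p) (finrank_tangentSpace p) hC
    (fun i => isScalarProduct_tensorInner (S.isScalarProduct_fiberInner (ι p)) _) hσ hadj
    (fun i => Basis.piTensorProduct fun _ : Fin ((i : ℕ) + 1) => b)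
    (fun i I => ⟨_, S.iteratedBracket_mem i (fun l => V (I l)) (ι p)⟩) (fun i I => ?_) β rfl
    (by rw [tensorGram_eq S V _ hb]) w rfl (b := c) (fun i j => ?_) hη
  · rw [Basis.piTensorProduct_apply, ← S.isBracketMap_bracketMap]
    simp only [hb]
  · rw [← hCi]
    exact hc i j

end Pointwise

/-! ### Smooth dependence of determinants and coefficients -/

section SmoothMatrices

open Polynomial

variable {Y : Type*} [NormedAddCommGroup Y] [NormedSpace ℝ Y]

/-- The ring of the functions that are smooth at `y`. -/
def smoothAt (y : Y) : Subring (Y → ℝ) where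
  carrier := {f | ContDiffAt ℝ ∞ f y}
  mul_mem' hf hg := show ContDiffAt ℝ ∞ _ y from ContDiffAt.mul hf.out hg.out
  one_mem' := show ContDiffAt ℝ ∞ _ y from contDiffAt_const (c := (1 : ℝ))
  add_mem' hf hg := show ContDiffAt ℝ ∞ _ y from ContDiffAt.add hf.out hg.out
  zero_mem' := show ContDiffAt ℝ ∞ _ y from contDiffAt_const (c := (0 : ℝ))
  neg_mem' hf := show ContDiffAt ℝ ∞ _ y from ContDiffAt.neg hf.out

/-- Evaluation at `y` of the functions that are smooth at `y₀`. -/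
def smoothAtEval (y₀ y : Y) : smoothAt y₀ →+* ℝ :=
  (Pi.evalRingHom (fun _ => ℝ) y).comp (smoothAt y₀).subtype

theorem contDiffAt_smoothAtEval {y₀ : Y} (f : smoothAt y₀) :
    ContDiffAt ℝ ∞ (fun y => smoothAtEval y₀ y f) y₀ := f.2

/-- A matrix depending smoothly on `y` is one matrix over the ring of functions smooth at `y₀`.
Every polynomial construction commutes with evaluation at `y`, which is a ring homomorphism, so its
result is smooth. -/
theorem exists_map_smoothAtEval {μ ν : Type*} {y₀ : Y} {A : Y → Matrix μ ν ℝ}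
    (hA : ∀ a I, ContDiffAt ℝ ∞ (fun y => A y a I) y₀) :
    ∃ A' : Matrix μ ν (smoothAt y₀), ∀ y, A y = A'.map (smoothAtEval y₀ y) :=
  ⟨Matrix.of fun a I => ⟨fun y => A y a I, hA a I⟩, fun _ => rfl⟩

variable {μ κ ν : Type*} [Fintype μ] [DecidableEq μ] [Fintype κ] [DecidableEq κ] [Fintype ν]
  [DecidableEq ν] {y₀ : Y}

theorem contDiffAt_matrix_det {A : Y → Matrix μ μ ℝ}
    (hA : ∀ a I, ContDiffAt ℝ ∞ (fun y => A y a I) y₀) :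
    ContDiffAt ℝ ∞ (fun y => (A y).det) y₀ := by
  obtain ⟨A', hA'⟩ := exists_map_smoothAtEval hA
  refine (contDiffAt_smoothAtEval A'.det).congr_of_eventuallyEq (Eventually.of_forall fun y => ?_)
  simp only [hA', RingHom.map_det, RingHom.mapMatrix_apply]

theorem contDiffAt_matrix_inv {A : Y → Matrix μ μ ℝ}
    (hA : ∀ a I, ContDiffAt ℝ ∞ (fun y => A y a I) y₀) (h0 : (A y₀).det ≠ 0) (a I : μ) :
    ContDiffAt ℝ ∞ (fun y => (A y)⁻¹ a I) y₀ := by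
  have h1 : ContDiffAt ℝ ∞ (fun y => (A y).adjugate a I) y₀ := by
    obtain ⟨A', hA'⟩ := exists_map_smoothAtEval hA
    refine (contDiffAt_smoothAtEval (A'.adjugate a I)).congr_of_eventuallyEq
      (Eventually.of_forall fun y => ?_)
    simp only [hA', ← RingHom.mapMatrix_apply, ← RingHom.map_adjugate]
    rfl
  refine (((contDiffAt_matrix_det hA).inv h0).mul h1).congr_of_eventuallyEq
    (Eventually.of_forall fun y => ?_)
  simp only [Matrix.inv_def, Ring.inverse_eq_inv', Matrix.smul_apply, smul_eq_mul, Pi.inv_apply]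

theorem contDiffAt_coeff_cometric_det (deg : κ → ℕ) {A : Y → Matrix μ κ ℝ} {Γ : Y → Matrix κ κ ℝ}
    (hA : ∀ a I, ContDiffAt ℝ ∞ (fun y => A y a I) y₀)
    (hΓ : ∀ I J, ContDiffAt ℝ ∞ (fun y => Γ y I J) y₀) (m : ℕ) :
    ContDiffAt ℝ ∞ (fun y => (cometric deg (A y) (Γ y)).det.coeff m) y₀ := by
  obtain ⟨A', hA'⟩ := exists_map_smoothAtEval hA
  obtain ⟨Γ', hΓ'⟩ := exists_map_smoothAtEval hΓ
  refine (contDiffAt_smoothAtEval ((cometric deg A' Γ').det.coeff m)).congr_of_eventuallyEq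
    (Eventually.of_forall fun y => ?_)
  simp only [hA', hΓ', cometric_det_map, coeff_map]

theorem contDiffAt_coeff_gramDet (deg : κ → ℕ) {A : Y → Matrix μ κ ℝ} {Γ : Y → Matrix κ κ ℝ}
    {W : Y → Matrix μ ν ℝ} (hA : ∀ a I, ContDiffAt ℝ ∞ (fun y => A y a I) y₀)
    (hΓ : ∀ I J, ContDiffAt ℝ ∞ (fun y => Γ y I J) y₀)
    (hW : ∀ a j, ContDiffAt ℝ ∞ (fun y => W y a j) y₀) (l m : ℕ) :
    ContDiffAt ℝ ∞ (fun y => (X ^ l * gramDet deg (A y) (Γ y) (W y)).coeff m) y₀ := by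
  obtain ⟨A', hA'⟩ := exists_map_smoothAtEval hA
  obtain ⟨Γ', hΓ'⟩ := exists_map_smoothAtEval hΓ
  obtain ⟨W', hW'⟩ := exists_map_smoothAtEval hW
  refine (contDiffAt_smoothAtEval
    ((X ^ l * gramDet deg A' Γ' W').coeff m)).congr_of_eventuallyEq
    (Eventually.of_forall fun y => ?_)
  simp only [hA', hΓ', hW', gramDet_map, ← coeff_map, Polynomial.map_mul, Polynomial.map_pow,
    Polynomial.map_X]

end SmoothMatrices

/-! ### Coefficients of forms in charts and the choice of sign -/

section Charts

variable {k : ℕ} {N : Type*} [TopologicalSpace N] [ChartedSpace (EuclideanSpace ℝ (Fin k)) N]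
  [IsManifold (𝓡 k) ∞ N]

theorem mdifferentiable_of_mem_maximalAtlas
    {e : OpenPartialHomeomorph N (EuclideanSpace ℝ (Fin k))}
    (he : e ∈ IsManifold.maximalAtlas (𝓡 k) ∞ N) : e.MDifferentiable (𝓡 k) (𝓡 k) :=
  ⟨(contMDiffOn_of_mem_maximalAtlas he).mdifferentiableOn (by simp),
    (contMDiffOn_symm_of_mem_maximalAtlas he).mdifferentiableOn (by simp)⟩

/-- The coordinate vectors of a chart. -/
def coordVector (e : OpenPartialHomeomorph N (EuclideanSpace ℝ (Fin k)))
    (y : EuclideanSpace ℝ (Fin k)) (j : Fin k) : TangentSpace (𝓡 k) (e.symm y) :=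
  mfderiv (𝓡 k) (𝓡 k) e.symm y (EuclideanSpace.single j (1 : ℝ))

theorem formCoeff_eq (α : TopForm k N) (e : OpenPartialHomeomorph N (EuclideanSpace ℝ (Fin k)))
    (y : EuclideanSpace ℝ (Fin k)) : formCoeff α e y = α (e.symm y) (coordVector e y) := rfl

theorem exists_basis_coordVector {e : OpenPartialHomeomorph N (EuclideanSpace ℝ (Fin k))}
    (he : e ∈ IsManifold.maximalAtlas (𝓡 k) ∞ N) {y : EuclideanSpace ℝ (Fin k)}
    (hy : y ∈ e.target) :
    ∃ b : Basis (Fin k) ℝ (TangentSpace (𝓡 k) (e.symm y)), ∀ j, b j = coordVector e y j := by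
  let L : EuclideanSpace ℝ (Fin k) ≃ₗ[ℝ] TangentSpace (𝓡 k) (e.symm y) :=
    LinearEquiv.ofBijective (mfderiv (𝓡 k) (𝓡 k) e.symm y).toLinearMap
      ((mdifferentiable_of_mem_maximalAtlas he).symm.mfderiv_bijective hy)
  refine ⟨(EuclideanSpace.basisFun (Fin k) ℝ).toBasis.map L, fun j => ?_⟩
  rw [Basis.map_apply, OrthonormalBasis.coe_toBasis, EuclideanSpace.basisFun_apply]
  rfl

/-- A nonzero form of top degree has nonzero coefficients. -/
theorem formCoeff_ne_zero {α : TopForm k N} {e : OpenPartialHomeomorph N (EuclideanSpace ℝ (Fin k))}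
    (he : e ∈ IsManifold.maximalAtlas (𝓡 k) ∞ N) {y : EuclideanSpace ℝ (Fin k)}
    (hy : y ∈ e.target) (hα : α (e.symm y) ≠ 0) : formCoeff α e y ≠ 0 := by
  obtain ⟨b, hb⟩ := exists_basis_coordVector he hy
  intro h
  apply hα
  rw [AlternatingMap.eq_smul_basis_det b (α (e.symm y)), (funext hb : ⇑b = _), ← formCoeff_eq, h,
    zero_smul]

theorem contDiffAt_alternatingMap {Y : Type*} [NormedAddCommGroup Y] [NormedSpace ℝ Y]
    (c : EuclideanSpace ℝ (Fin k) [⋀^Fin k]→ₗ[ℝ] ℝ) {v : Y → Fin k → EuclideanSpace ℝ (Fin k)}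
    {y₀ : Y} (hv : ∀ j, ContDiffAt ℝ ∞ (fun y => v y j) y₀) :
    ContDiffAt ℝ ∞ (fun y => c (v y)) y₀ := by
  let b := (EuclideanSpace.basisFun (Fin k) ℝ).toBasis
  have h : ∀ y, c (v y) = c b * (b.toMatrix (v y)).det := fun y => by
    conv_lhs => rw [c.eq_smul_basis_det b]
    rw [AlternatingMap.smul_apply, smul_eq_mul, Basis.det_apply]
  simp only [h]
  refine contDiffAt_const.mul (contDiffAt_matrix_det fun a j => ?_)
  exact (EuclideanSpace.proj (𝕜 := ℝ) a).contDiff.contDiffAt.comp y₀ (hv j)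

/-- A positively oriented form is smooth as soon as the squares of its coefficients are. -/
theorem contDiffAt_formCoeff_of_sq {o : PointwiseOrientation k N} (ho : IsOrientation o)
    {α : TopForm k N} (hα : ∀ p, IsPositive (o p) (α p))
    {e : OpenPartialHomeomorph N (EuclideanSpace ℝ (Fin k))}
    (he : e ∈ IsManifold.maximalAtlas (𝓡 k) ∞ N) {y₀ : EuclideanSpace ℝ (Fin k)}
    (hy₀ : y₀ ∈ e.target) (h : ContDiffAt ℝ ∞ (fun y => formCoeff α e y ^ 2) y₀) :
    ContDiffAt ℝ ∞ (formCoeff α e) y₀ := by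
  obtain ⟨c, hc⟩ := ho (e.symm y₀)
  set e' := chartAt (EuclideanSpace ℝ (Fin k)) (e.symm y₀) with he'
  have hmem' : e' ∈ IsManifold.maximalAtlas (𝓡 k) ∞ N := IsManifold.chart_mem_maximalAtlas _
  have hcont : Tendsto e.symm (𝓝 y₀) (𝓝 (e.symm y₀)) := e.continuousAt_symm hy₀
  have hsrc : ∀ᶠ y in 𝓝 y₀, e.symm y ∈ e'.source :=
    hcont (e'.open_source.mem_nhds (mem_chart_source _ _))
  -- The coefficient in the chart `e` of the reference form that represents the orientation near the
  -- point: smooth, nonvanishing nearby and of the same sign as the coefficient of `α`.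
  set C : EuclideanSpace ℝ (Fin k) → ℝ := fun y =>
    c fun j => fderiv ℝ (e' ∘ e.symm) y (EuclideanSpace.single j (1 : ℝ)) with hC
  have hsm : ContDiffAt ℝ ∞ (e' ∘ e.symm) y₀ := contMDiffAt_iff_contDiffAt.1
    (((contMDiffOn_of_mem_maximalAtlas hmem').contMDiffAt
      (e'.open_source.mem_nhds hsrc.self_of_nhds)).comp y₀
      ((contMDiffOn_symm_of_mem_maximalAtlas he).contMDiffAt (e.open_target.mem_nhds hy₀)))
  have hCs : ContDiffAt ℝ ∞ C y₀ := contDiffAt_alternatingMap c fun j =>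
    (hsm.fderiv_right (m := ∞) (by simp)).clm_apply contDiffAt_const
  have key : ∀ᶠ y in 𝓝 y₀, C y ≠ 0 ∧ formCoeff α e y = √(formCoeff α e y ^ 2 / C y ^ 2) * C y := by
    filter_upwards [hsrc, e.open_target.mem_nhds hy₀, hcont.eventually hc] with y hy hyt hpos
    obtain ⟨hη, hη'⟩ := hpos
    obtain ⟨hα0, hα'⟩ := hα (e.symm y)
    set η := c.compLinearMap (mfderiv (𝓡 k) (𝓡 k) e' (e.symm y)).toLinearMap with hηdef
    have hCη : C y = η (coordVector e y) := by
      change c _ = c _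
      congr 1
      ext1 j
      rw [← mfderiv_eq_fderiv, mfderiv_comp y
        ((mdifferentiable_of_mem_maximalAtlas hmem').mdifferentiableAt hy)
        ((mdifferentiable_of_mem_maximalAtlas he).mdifferentiableAt_symm hyt)]
      rfl
    have hC0 : C y ≠ 0 := by
      intro h0
      obtain ⟨b, hb⟩ := exists_basis_coordVector he hyt
      apply hη
      rw [AlternatingMap.eq_smul_basis_det b η, (funext hb : ⇑b = _), ← hCη, h0, zero_smul]
    have hray := (ray_eq_iff hα0 hη).1 (hα'.trans hη'.symm)
    -- Both forms lie in the ray `o`, so their coefficients have a positive ratio, which is the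
    -- square root of its own square.
    obtain ⟨r, s, hr, hs, hrs⟩ := hray.exists_pos hα0 hη
    have h1 : r * formCoeff α e y = s * C y := by
      have := congrArg (fun ζ => ζ (coordVector e y)) hrs
      rw [hCη]
      exact this
    have h2 : formCoeff α e y = (s / r) * C y := by
      field_simp
      linarith
    refine ⟨hC0, ?_⟩
    have h3 : formCoeff α e y ^ 2 / C y ^ 2 = (s / r) ^ 2 := by
      rw [h2]
      field_simp
    rw [h3, Real.sqrt_sq (by positivity), h2]
  have h0 := key.self_of_nhds.1
  refine ContDiffAt.congr_of_eventuallyEq ?_ (key.mono fun y hy => hy.2)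
  refine ((h.div (hCs.pow 2) (pow_ne_zero 2 h0)).sqrt ?_).mul hCs
  -- The radicand is nonzero at `y₀`, where the square root is therefore smooth.
  exact div_ne_zero (pow_ne_zero 2 (formCoeff_ne_zero he hy₀ (hα _).1)) (pow_ne_zero 2 h0)

end Charts

/-! ### Smoothness of the Popp form -/

section PoppForm

variable {n : ℕ} {M : Type*} [TopologicalSpace M] [T2Space M]
  [ChartedSpace (EuclideanSpace ℝ (Fin n)) M]
  [IsManifold (𝓡 n) ∞ M]
  {F : Type*} [NormedAddCommGroup F] [NormedSpace ℝ F] [FiniteDimensional ℝ F]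
  {U : M → Type*} [TopologicalSpace (Bundle.TotalSpace F U)]
  [∀ x, TopologicalSpace (U x)] [∀ x, AddCommGroup (U x)] [∀ x, Module ℝ (U x)]
  [∀ x, IsTopologicalAddGroup (U x)] [∀ x, ContinuousConstSMul ℝ (U x)]
  [FiberBundle F U] [VectorBundle ℝ F U] [ContMDiffVectorBundle ∞ F U (𝓡 n)]
  {k : ℕ} {N : Type*} [TopologicalSpace N] [ChartedSpace (EuclideanSpace ℝ (Fin k)) N]
  {S : SubRiemannianStructure n M F U} {ι : N → M}

theorem flagWeight_congr {E E' : Type*} [AddCommGroup E] [Module ℝ E] [FiniteDimensional ℝ E]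
    [AddCommGroup E'] [Module ℝ E'] [FiniteDimensional ℝ E'] {Fl : ℕ → Submodule ℝ E}
    {Fl' : ℕ → Submodule ℝ E'} (h : Monotone Fl) (h' : Monotone Fl')
    (heq : ∀ i, finrank ℝ (Fl i) = finrank ℝ (Fl' i)) (r : ℕ) :
    flagWeight Fl r = flagWeight Fl' r := by
  refine Finset.sum_congr rfl fun i _ => ?_
  rw [finrank_gradedPiece h, finrank_gradedPiece h', heq, heq]

theorem IsEquisingular.step_eq (hN : IsEquisingular (k := k) S ι) (p q : N) :
    S.step (ι p) = S.step (ι q) := by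
  classical
  have key : ∀ p i, S.flagAt (ι p) i = ⊤ ↔ finrank ℝ (S.flagAt (ι p) i) = n := fun p i => by
    have : FiniteDimensional ℝ (TangentSpace (𝓡 n) (ι p)) := finiteDimensional_tangentSpace _
    refine ⟨fun h => ?_, fun h => Submodule.eq_top_of_finrank_eq ?_⟩
    · rw [h, finrank_top, finrank_tangentSpace]
    · rw [h, finrank_tangentSpace]
  refine Nat.find_congr' fun {i} => ?_
  rw [key, key, hN.finrank_flag i p q]

theorem IsEquisingular.flagWeight_eq (hN : IsEquisingular (k := k) S ι) (p q : N) (r : ℕ) :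
    flagWeight (S.flagAt (ι p)) r = flagWeight (S.flagAt (ι q)) r := by
  have : ∀ x : M, FiniteDimensional ℝ (TangentSpace (𝓡 n) x) := finiteDimensional_tangentSpace
  exact flagWeight_congr (S.flagAt_mono _) (S.flagAt_mono _) (fun i => hN.finrank_flag i p q) r

theorem IsEquisingular.flagWeight_restrictedFlag_eq (hN : IsEquisingular (k := k) S ι) (p q : N)
    (r : ℕ) : flagWeight (restrictedFlag (k := k) S ι p) r =
      flagWeight (restrictedFlag (k := k) S ι q) r := by
  have : ∀ x : N, FiniteDimensional ℝ (TangentSpace (𝓡 k) x) := finiteDimensional_tangentSpace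
  exact flagWeight_congr (hN.isFullFlag _).mono (hN.isFullFlag _).mono
    (fun i => hN.finrank_restrictedFlag i p q) r

/-- The coordinate basis of the tangent space at `x` in the preferred chart at `x₀`. -/
theorem exists_tangentBasis (x₀ : M) {x : M}
    (hx : x ∈ (trivializationAt (EuclideanSpace ℝ (Fin n)) (TangentSpace (𝓡 n)) x₀).baseSet) :
    ∃ β : Basis (Fin n) ℝ (TangentSpace (𝓡 n) x), ∀ v a, β.repr v a =
      (trivializationAt (EuclideanSpace ℝ (Fin n)) (TangentSpace (𝓡 n)) x₀
        (⟨x, v⟩ : TangentBundle (𝓡 n) M)).2 a := by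
  set t := trivializationAt (EuclideanSpace ℝ (Fin n)) (TangentSpace (𝓡 n)) x₀
  refine ⟨(EuclideanSpace.basisFun (Fin n) ℝ).toBasis.map
    (t.continuousLinearEquivAt ℝ x hx).symm.toLinearEquiv, fun v a => ?_⟩
  rw [Basis.map_repr]
  rfl

variable {Y : Type*} [NormedAddCommGroup Y] [NormedSpace ℝ Y] {y₀ : Y}

theorem contDiffAt_tangent_coordinate {g : Y → TangentBundle (𝓡 n) M}
    (hg : ContMDiffAt 𝓘(ℝ, Y) (𝓡 n).tangent ∞ g y₀) (a : Fin n) :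
    ContDiffAt ℝ ∞ (fun y => (trivializationAt (EuclideanSpace ℝ (Fin n)) (TangentSpace (𝓡 n))
      (g y₀).1 (g y)).2 a) y₀ := by
  have h := contMDiffAt_iff_contDiffAt.1 (Bundle.contMDiffAt_totalSpace.1 hg).2
  exact (EuclideanSpace.proj (𝕜 := ℝ) a).contDiff.contDiffAt.comp y₀ h

theorem contDiffAt_tensorGram (S : SubRiemannianStructure n M F U) {m : ℕ}
    (V : Fin m → ContMDiffSection (𝓡 n) F ∞ U) (r : ℕ) {g : Y → M}
    (hg : ContMDiffAt 𝓘(ℝ, Y) (𝓡 n) ∞ g y₀) (I J) :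
    ContDiffAt ℝ ∞ (fun y => tensorGram S V r (g y) I J) y₀ := by
  have h1 : ∀ i j, ContDiffAt ℝ ∞ (fun y => S.metric.inner (g y) (V i (g y)) (V j (g y))) y₀ := by
    intro i j
    have h2 : ContMDiffAt 𝓘(ℝ, Y) ((𝓡 n).prod 𝓘(ℝ)) ∞
        (fun y => Bundle.TotalSpace.mk' ℝ (E := Bundle.Trivial M ℝ) (g y)
          (S.metric.inner (g y) (V i (g y)) (V j (g y)))) y₀ := by
      apply ContMDiffAt.clm_bundle_apply₂ (F₁ := F) (F₂ := F)
      · exact S.metric.contMDiff.contMDiffAt.comp y₀ hg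
      · exact (V i).contMDiff.contMDiffAt.comp y₀ hg
      · exact (V j).contMDiff.contMDiffAt.comp y₀ hg
    exact contMDiffAt_iff_contDiffAt.1 (Bundle.contMDiffAt_totalSpace.1 h2).2
  simp only [tensorGram, Matrix.of_apply]
  by_cases h : I.1 = J.1
  · simp only [dif_pos h]
    exact contDiffAt_prod fun l _ => h1 _ _
  · simp only [dif_neg h]
    exact contDiffAt_const

theorem tensorGram_det_ne_zero (S : SubRiemannianStructure n M F U) {m : ℕ}
    (V : Fin m → ContMDiffSection (𝓡 n) F ∞ U) (r : ℕ) {x : M} {b : Basis (Fin m) ℝ (U x)}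
    (hb : ∀ j, b j = V j x) : (tensorGram S V r x).det ≠ 0 := by
  have : FiniteDimensional ℝ (U x) := finiteDimensional_fiber F x
  rw [tensorGram_eq S V r hb]
  exact gramMatrix_det_ne_zero (isScalarProduct_sumForm fun i =>
    isScalarProduct_tensorInner (S.isScalarProduct_fiberInner x) _) _

variable [IsManifold (𝓡 k) ∞ N]

/-- By the chain rule the vector is the differential of `ι ∘ e.symm` on a constant vector, hence a
tangent map composed with a constant section. -/
theorem contDiffAt_tangentIncl_coordVector (hι : ContMDiff (𝓡 k) (𝓡 n) ∞ ι)
    {e : OpenPartialHomeomorph N (EuclideanSpace ℝ (Fin k))}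
    (he : e ∈ IsManifold.maximalAtlas (𝓡 k) ∞ N) {y₀ : EuclideanSpace ℝ (Fin k)}
    (hy₀ : y₀ ∈ e.target) (j : Fin k) :
    ContMDiffAt (𝓡 k) (𝓡 n).tangent ∞ (fun y =>
      (⟨ι (e.symm y), tangentIncl ι (e.symm y) (coordVector e y j)⟩ : TangentBundle (𝓡 n) M))
      y₀ := by
  have hg : ContMDiffOn (𝓡 k) (𝓡 n) ∞ (ι ∘ e.symm) e.target :=
    hι.comp_contMDiffOn (contMDiffOn_symm_of_mem_maximalAtlas he)
  have hu : UniqueMDiffOn (𝓡 k) e.target := e.open_target.uniqueMDiffOn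
  have h1 := hg.contMDiffOn_tangentMapWithin (m := ∞) (by simp) hu
  have h2 : ContMDiff (𝓡 k) (𝓡 k).tangent ∞ (fun y => (⟨y, EuclideanSpace.single j (1 : ℝ)⟩ :
      TangentBundle (𝓡 k) (EuclideanSpace ℝ (Fin k)))) := fun y =>
    contMDiffAt_vectorSpace_iff_contDiffAt.2 contDiffAt_const
  have h3 := (h1.comp h2.contMDiffOn (s := e.target) fun y hy => hy).contMDiffAt
    (e.open_target.mem_nhds hy₀)
  refine h3.congr_of_eventuallyEq ?_
  filter_upwards [e.open_target.mem_nhds hy₀] with y hy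
  have hs := (mdifferentiable_of_mem_maximalAtlas he).mdifferentiableAt_symm hy
  have hd : mfderivWithin (𝓡 k) (𝓡 n) (ι ∘ e.symm) e.target y =
      (mfderiv (𝓡 k) (𝓡 n) ι (e.symm y)).comp (mfderiv (𝓡 k) (𝓡 k) e.symm y) := by
    rw [mfderivWithin_of_isOpen e.open_target hy]
    exact mfderiv_comp y ((hι _).mdifferentiableAt (by simp)) hs
  change _ = (⟨ι (e.symm y), mfderivWithin (𝓡 k) (𝓡 n) (ι ∘ e.symm) e.target y
    (EuclideanSpace.single j (1 : ℝ))⟩ : TangentBundle (𝓡 n) M)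
  rw [hd]
  rfl

/-- In a frame of `U` and a trivialization of the tangent bundle of `M`, the pointwise formula
writes the square as one coefficient over a power of another, with the same exponents at all nearby
points. -/
theorem contDiffAt_formCoeff_poppForm_sq (hN : IsEquisingular (k := k) S ι)
    (o : PointwiseOrientation k N) {e : OpenPartialHomeomorph N (EuclideanSpace ℝ (Fin k))}
    (he : e ∈ IsManifold.maximalAtlas (𝓡 k) ∞ N) {y₀ : EuclideanSpace ℝ (Fin k)}
    (hy₀ : y₀ ∈ e.target) :
    ContDiffAt ℝ ∞ (fun y => formCoeff (poppForm hN o) e y ^ 2) y₀ := by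
  set g : EuclideanSpace ℝ (Fin k) → M := ι ∘ e.symm with hgdef
  set t := trivializationAt (EuclideanSpace ℝ (Fin n)) (TangentSpace (𝓡 n)) (g y₀) with ht
  have hg : ContMDiffAt (𝓡 k) (𝓡 n) ∞ g y₀ := hN.smooth.contMDiffAt.comp y₀
    ((contMDiffOn_symm_of_mem_maximalAtlas he).contMDiffAt (e.open_target.mem_nhds hy₀))
  obtain ⟨V, hV, -⟩ := exists_frame (n := n) (F := F) (U := U) (g y₀)
  -- Frozen at `y₀`, as are the weights below: by equisingularity they do not change along `N`.
  set r := S.step (ι (e.symm y₀)) with hr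
  let deg : (Σ i : Fin r, Fin ((i : ℕ) + 1) → Fin (finrank ℝ F)) → ℕ := fun I => (I.1 : ℕ) + 1
  let A : EuclideanSpace ℝ (Fin k) →
      Matrix (Fin n) (Σ i : Fin r, Fin ((i : ℕ) + 1) → Fin (finrank ℝ F)) ℝ := fun y =>
    Matrix.of fun a I => (t (⟨g y, S.iteratedBracket I.1 (fun l => V (I.2 l)) (g y)⟩ :
      TangentBundle (𝓡 n) M)).2 a
  let W : EuclideanSpace ℝ (Fin k) → Matrix (Fin n) (Fin k) ℝ := fun y =>
    Matrix.of fun a j => (t (⟨g y, tangentIncl ι (e.symm y) (coordVector e y j)⟩ :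
      TangentBundle (𝓡 n) M)).2 a
  let Γ := fun y => (tensorGram S V r (g y))⁻¹
  have hA : ∀ a I, ContDiffAt ℝ ∞ (fun y => A y a I) y₀ := fun a I =>
    contDiffAt_tangent_coordinate ((derivedFlag_smooth S.distribution_smooth _ _
      (S.iteratedBracket_mem_derivedFlag I.1 fun l => V (I.2 l))).contMDiffAt.comp y₀ hg) a
  have hW : ∀ a j, ContDiffAt ℝ ∞ (fun y => W y a j) y₀ := fun a j =>
    contDiffAt_tangent_coordinate (contDiffAt_tangentIncl_coordVector hN.smooth he hy₀ j) a
  have hΓ : ∀ I J, ContDiffAt ℝ ∞ (fun y => Γ y I J) y₀ := fun I J => by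
    obtain ⟨b, hb⟩ := hV.self_of_nhds
    exact contDiffAt_matrix_inv (fun I J => contDiffAt_tensorGram S V r hg I J)
      (tensorGram_det_ne_zero S V r hb) I J
  have hnum := contDiffAt_coeff_gramDet deg hA hΓ hW
    (2 * flagWeight (restrictedFlag (k := k) S ι (e.symm y₀)) r)
    (2 * flagWeight (S.flagAt (ι (e.symm y₀))) r * k)
  have hden := contDiffAt_coeff_cometric_det deg hA hΓ
    (2 * flagWeight (S.flagAt (ι (e.symm y₀))) r)
  have hbase : ∀ᶠ y in 𝓝 y₀, g y ∈ t.baseSet := hg.continuousAt.eventually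
    (t.open_baseSet.mem_nhds (FiberBundle.mem_baseSet_trivializationAt _ _ _))
  have key : ∀ᶠ y in 𝓝 y₀, (cometric deg (A y) (Γ y)).det.coeff
        (2 * flagWeight (S.flagAt (ι (e.symm y₀))) r) ≠ 0 ∧
      (Polynomial.X ^ (2 * flagWeight (restrictedFlag (k := k) S ι (e.symm y₀)) r) *
        gramDet deg (A y) (Γ y) (W y)).coeff (2 * flagWeight (S.flagAt (ι (e.symm y₀))) r * k) =
        formCoeff (poppForm hN o) e y ^ 2 * (cometric deg (A y) (Γ y)).det.coeff
        (2 * flagWeight (S.flagAt (ι (e.symm y₀))) r) ^ k := by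
    filter_upwards [hbase, hg.continuousAt.eventually hV] with y hy hb
    obtain ⟨b, hb⟩ := hb
    obtain ⟨β, hβ⟩ := exists_tangentBasis (g y₀) hy
    obtain ⟨δ, hδ, h1, h2⟩ := poppForm_sq hN o (e.symm y) β hb (coordVector e y)
      (hN.step_eq (e.symm y) (e.symm y₀))
    have hAy : bracketMatrix S V r β = A y := Matrix.ext fun a I => hβ _ a
    have hWy : (Matrix.of fun a j => β.repr (tangentIncl ι (e.symm y) (coordVector e y j)) a) =
      W y := Matrix.ext fun a j => hβ _ a
    rw [hAy, hN.flagWeight_eq (e.symm y) (e.symm y₀)] at h1 h2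
    rw [hWy, hN.flagWeight_restrictedFlag_eq (e.symm y) (e.symm y₀)] at h2
    have h1' : (cometric deg (A y) (Γ y)).det.coeff
        (2 * flagWeight (S.flagAt (ι (e.symm y₀))) r) = δ := h1
    rw [h1']
    exact ⟨hδ, h2⟩
  refine (hnum.div (hden.pow k) (pow_ne_zero k key.self_of_nhds.1)).congr_of_eventuallyEq ?_
  filter_upwards [key] with y hy
  rw [Pi.div_apply, hy.2, mul_div_cancel_right₀ _ (pow_ne_zero k hy.1)]

theorem isVolumeForm_poppForm (hN : IsEquisingular (k := k) S ι) {o : PointwiseOrientation k N}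
    (ho : IsOrientation o) : IsVolumeForm o (poppForm hN o) where
  smooth _ he _ hy := (contDiffAt_formCoeff_of_sq ho (fun p => (poppForm_spec hN o p).2) he hy
    (contDiffAt_formCoeff_poppForm_sq hN o he hy)).contDiffWithinAt
  positive p := (poppForm_spec hN o p).2

end PoppForm

/-! ### The measure of a form of top degree -/

section FormMeasure

variable {k : ℕ} {N : Type*} [TopologicalSpace N] [ChartedSpace (EuclideanSpace ℝ (Fin k)) N]
  [IsManifold (𝓡 k) ∞ N]

theorem differentiableAt_coordChange {e e' : OpenPartialHomeomorph N (EuclideanSpace ℝ (Fin k))}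
    (he : e ∈ IsManifold.maximalAtlas (𝓡 k) ∞ N) (he' : e' ∈ IsManifold.maximalAtlas (𝓡 k) ∞ N)
    {y : EuclideanSpace ℝ (Fin k)} (hy : y ∈ e.target) (hy' : e.symm y ∈ e'.source) :
    DifferentiableAt ℝ (e' ∘ e.symm) y :=
  mdifferentiableAt_iff_differentiableAt.1
    (((mdifferentiable_of_mem_maximalAtlas he').mdifferentiableAt hy').comp y
      ((mdifferentiable_of_mem_maximalAtlas he).mdifferentiableAt_symm hy))

/-- Change of variables for the coefficients of a form of top degree. -/
theorem formCoeff_coordChange (α : TopForm k N)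
    {e e' : OpenPartialHomeomorph N (EuclideanSpace ℝ (Fin k))}
    (he : e ∈ IsManifold.maximalAtlas (𝓡 k) ∞ N) (he' : e' ∈ IsManifold.maximalAtlas (𝓡 k) ∞ N)
    {y : EuclideanSpace ℝ (Fin k)} (hy : y ∈ e.target) (hy' : e.symm y ∈ e'.source) :
    formCoeff α e y =
      (fderiv ℝ (e' ∘ e.symm) y).det * formCoeff α e' ((e' ∘ e.symm) y) := by
  have hs := (mdifferentiable_of_mem_maximalAtlas he).mdifferentiableAt_symm hy
  set q := e.symm y with hq
  have hqe : e'.symm (e' q) = q := e'.left_inv hy'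
  have hs' := (mdifferentiable_of_mem_maximalAtlas he').mdifferentiableAt_symm
    (e'.map_source hy')
  set τ := e' ∘ e.symm with hτ
  have hτd := differentiableAt_coordChange he he' hy hy'
  let b := (EuclideanSpace.basisFun (Fin k) ℝ).toBasis
  have hb : ∀ j, b j = EuclideanSpace.single j (1 : ℝ) := fun j => by simp [b]
  -- Near `y` the map `e'.symm ∘ τ` coincides with `e.symm`.
  have hcomp : mfderiv (𝓡 k) (𝓡 k) (e'.symm ∘ τ) y = mfderiv (𝓡 k) (𝓡 k) e.symm y := by
    refine Filter.EventuallyEq.mfderiv_eq ?_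
    filter_upwards [(e.continuousAt_symm hy).eventually (e'.open_source.mem_nhds hy')] with z hz
    exact e'.left_inv hz
  let B : EuclideanSpace ℝ (Fin k) [⋀^Fin k]→ₗ[ℝ] ℝ :=
    (show EuclideanSpace ℝ (Fin k) [⋀^Fin k]→ₗ[ℝ] ℝ from
      AlternatingMap.compLinearMap (α (e'.symm (τ y)))
        (mfderiv (𝓡 k) (𝓡 k) e'.symm (τ y)).toLinearMap)
  have h1 : formCoeff α e' (τ y) = B b := by
    change B _ = B _
    congr 1
    ext1 j
    exact (hb j).symm
  have h2 : formCoeff α e y = B (fderiv ℝ τ y ∘ b) := by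
    -- The points `e'.symm (τ y)` and `e.symm y` are equal only propositionally. Reading all tangent
    -- spaces as the model space allows rewriting the base point.
    let α' : N → EuclideanSpace ℝ (Fin k) [⋀^Fin k]→ₗ[ℝ] ℝ := α
    have h3 : formCoeff α e y = α' (e'.symm (τ y))
        fun j => mfderiv (𝓡 k) (𝓡 k) e.symm y (EuclideanSpace.single j (1 : ℝ)) :=
      congrArg (fun z => α' z fun j =>
        mfderiv (𝓡 k) (𝓡 k) e.symm y (EuclideanSpace.single j (1 : ℝ))) hqe.symm
    rw [h3]
    change α' (e'.symm (τ y)) _ = α' (e'.symm (τ y)) _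
    congr 1
    ext1 j
    have h4 : mfderiv (𝓡 k) (𝓡 k) (e'.symm ∘ τ) y =
        (mfderiv (𝓡 k) (𝓡 k) e'.symm (τ y)).comp (mfderiv (𝓡 k) (𝓡 k) τ y) :=
      mfderiv_comp y hs' hτd.mdifferentiableAt
    rw [mfderiv_eq_fderiv] at h4
    have h5 := congrArg (fun L : EuclideanSpace ℝ (Fin k) →L[ℝ] EuclideanSpace ℝ (Fin k) => L (b j))
      (hcomp.symm.trans h4)
    rw [hb] at h5
    refine Eq.trans h5 ?_
    change _ = mfderiv (𝓡 k) (𝓡 k) e'.symm (τ y) (fderiv ℝ τ y (b j))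
    rw [hb]
    rfl
  rw [h1, h2, ← ContinuousLinearMap.coe_coe, B.eq_smul_basis_det b, AlternatingMap.smul_apply,
    AlternatingMap.smul_apply, Basis.det_comp, Basis.det_self]
  simp only [smul_eq_mul]
  rw [ContinuousLinearMap.det]
  ring

variable [MeasurableSpace N] [BorelSpace N]

/-- The measure of density `|α(∂_1, …, ∂_k)|` in the chart `e`. -/
abbrev chartMeasure (α : TopForm k N) (e : OpenPartialHomeomorph N (EuclideanSpace ℝ (Fin k))) :
    Measure N :=
  ((volume.restrict e.target).withDensity fun y => ENNReal.ofReal |formCoeff α e y|).map e.symm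

theorem chartMeasure_apply (α : TopForm k N)
    (e : OpenPartialHomeomorph N (EuclideanSpace ℝ (Fin k))) {A : Set N} (hA : MeasurableSet A) :
    chartMeasure α e A = ∫⁻ y in e '' (A ∩ e.source), ENNReal.ofReal |formCoeff α e y| := by
  -- The inverse chart is continuous only on its target, so it is measurable only almost everywhere
  -- for the restricted measure.
  have h1 : AEMeasurable e.symm (volume.restrict e.target) :=
    e.continuousOn_symm.aemeasurable e.open_target.measurableSet
  rw [chartMeasure, Measure.map_apply_of_aemeasurable
    (h1.mono_ac (withDensity_absolutelyContinuous _ _)) hA, withDensity_apply',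
    Measure.restrict_restrict' e.open_target.measurableSet]
  congr 2
  rw [inter_comm, inter_comm A, e.image_source_inter_eq']

theorem measurableSet_image_chart (e : OpenPartialHomeomorph N (EuclideanSpace ℝ (Fin k)))
    {A : Set N} (hA : MeasurableSet A) (hAe : A ⊆ e.source) : MeasurableSet (e '' A) := by
  rw [← inter_eq_self_of_subset_right hAe, e.image_source_inter_eq']
  rw [← Subtype.image_preimage_coe]
  refine (e.open_target.measurableSet.subtype_image ?_)
  exact e.continuousOn_symm.domRestrict.measurable hA

/-- The Jacobian from the change of variables is the factor by which the coefficients of the form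
transform. -/
theorem chartMeasure_eq (α : TopForm k N)
    {e e' : OpenPartialHomeomorph N (EuclideanSpace ℝ (Fin k))}
    (he : e ∈ IsManifold.maximalAtlas (𝓡 k) ∞ N) (he' : e' ∈ IsManifold.maximalAtlas (𝓡 k) ∞ N)
    {A : Set N} (hA : MeasurableSet A) (hAe : A ⊆ e.source) (hAe' : A ⊆ e'.source) :
    chartMeasure α e' A = chartMeasure α e A := by
  rw [chartMeasure_apply α e hA, chartMeasure_apply α e' hA, inter_eq_self_of_subset_left hAe,
    inter_eq_self_of_subset_left hAe']
  have himg : e' '' A = (e' ∘ e.symm) '' (e '' A) := by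
    rw [image_comp, show e.symm '' (e '' A) = A from e.symm_image_image_of_subset_source hAe]
  have hmem : ∀ y ∈ e '' A, y ∈ e.target ∧ e.symm y ∈ e'.source := by
    rintro _ ⟨p, hp, rfl⟩
    rw [e.left_inv (hAe hp)]
    exact ⟨e.map_source (hAe hp), hAe' hp⟩
  rw [himg, lintegral_image_eq_lintegral_abs_det_fderiv_mul volume
    (measurableSet_image_chart e hA hAe)
    (f' := fun y => fderiv ℝ (e' ∘ e.symm) y) (fun y hy =>
      (differentiableAt_coordChange he he' (hmem y hy).1
        (hmem y hy).2).hasFDerivAt.hasFDerivWithinAt)]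
  · refine setLIntegral_congr_fun (measurableSet_image_chart e hA hAe) fun y hy => ?_
    rw [formCoeff_coordChange α he he' (hmem y hy).1 (hmem y hy).2, abs_mul,
      ENNReal.ofReal_mul (abs_nonneg _)]
  · intro y hy z hz h
    exact e.symm.injOn (hmem y hy).1 (hmem z hz).1 (e'.injOn (hmem y hy).2 (hmem z hz).2 h)

theorem isFormMeasure_formMeasure (α : TopForm k N) : IsFormMeasure α (formMeasure α) := by
  intro e he A hAe hA
  have h1 : chartMeasure α e A = ∫⁻ y in e '' A, ENNReal.ofReal |formCoeff α e y| := by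
    rw [chartMeasure_apply α e hA, inter_eq_self_of_subset_left hAe]
  rw [← h1]
  refine le_antisymm ?_ ?_
  -- Every chart measure agrees with that of `e` on the overlap and is trivially bounded by the
  -- infinite measure `⊤` off the domain of `e`. The bound passes to the supremum, and its second
  -- term vanishes on subsets of that domain.
  · have h2 : formMeasure α ≤ chartMeasure α e + (⊤ : Measure N).restrict e.sourceᶜ := by
      refine iSup₂_le fun e' he' => Measure.le_iff.2 fun B hB => ?_
      change chartMeasure α e' B ≤ _
      rw [← measure_inter_add_sdiff B e.open_source.measurableSet]
      refine add_le_add ?_ ?_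
      · have h3 : chartMeasure α e' (B ∩ e.source) =
            chartMeasure α e' (B ∩ e.source ∩ e'.source) := by
          rw [chartMeasure_apply α e' (hB.inter e.open_source.measurableSet),
            chartMeasure_apply α e' ((hB.inter e.open_source.measurableSet).inter
              e'.open_source.measurableSet), inter_assoc _ e'.source, inter_self]
        rw [h3, chartMeasure_eq α he he' ((hB.inter e.open_source.measurableSet).inter
              e'.open_source.measurableSet) (inter_subset_left.trans inter_subset_right)
              inter_subset_right]
        exact measure_mono (inter_subset_left.trans inter_subset_left)
      · have h5 : (⊤ : Measure N).restrict e.sourceᶜ B = (⊤ : Measure N) (B \ e.source) :=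
          Measure.restrict_apply hB
        refine le_of_le_of_eq ?_ h5.symm
        exact (le_top : chartMeasure α e' ≤ ⊤) _
    refine (h2 A).trans_eq ?_
    rw [Measure.add_apply, Measure.restrict_apply hA, ← Set.sdiff_eq, sdiff_eq_empty.2 hAe]
    simp
  · exact (le_iSup₂ (f := fun e (_ : e ∈ IsManifold.maximalAtlas (𝓡 k) ∞ N) =>
      chartMeasure α e) e he) A

end FormMeasure

end SubRiem

end

theorem mainTheorem11
    {n k : ℕ}
    {M : Type*} [TopologicalSpace M] [T2Space M] [SecondCountableTopology M]
    [ChartedSpace (EuclideanSpace ℝ (Fin n)) M] [IsManifold (𝓡 n) ∞ M]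
    {F : Type*} [NormedAddCommGroup F] [NormedSpace ℝ F] [FiniteDimensional ℝ F]
    {U : M → Type*} [TopologicalSpace (Bundle.TotalSpace F U)]
    [∀ x, TopologicalSpace (U x)] [∀ x, AddCommGroup (U x)] [∀ x, Module ℝ (U x)]
    [∀ x, IsTopologicalAddGroup (U x)] [∀ x, ContinuousConstSMul ℝ (U x)]
    [FiberBundle F U] [VectorBundle ℝ F U] [ContMDiffVectorBundle ∞ F U (𝓡 n)]
    (S : SubRiem.SubRiemannianStructure n M F U)
    {N : Type*} [TopologicalSpace N] [T2Space N] [SecondCountableTopology N]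
    [ChartedSpace (EuclideanSpace ℝ (Fin k)) N] [IsManifold (𝓡 k) ∞ N]
    [MeasurableSpace N] [BorelSpace N]
    (ι : N → M) (hN : SubRiem.IsEquisingular (k := k) S ι)
    (o : SubRiem.PointwiseOrientation k N) (ho : SubRiem.IsOrientation o) :
    -- the bracket maps are well defined and surjective
    (∀ (p : N) (i : ℕ), (∃! L, S.IsBracketMap (ι p) i L) ∧
      Function.Surjective (S.bracketMap (ι p) i)) ∧
    -- the volume element of the graded space is well defined up to a sign
    (∀ p : N, ∃ v, ∀ w, SubRiem.IsVolumeElement (k := k) S ι p w ↔ w = v ∨ w = -v) ∧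
    -- its image under the inverse of the canonical isomorphism is, up to sign, a volume form
    (∀ p : N, SubRiem.IsVolumeElement (k := k) S ι p
      (SubRiem.thetaN hN p (SubRiem.poppForm hN o p))) ∧
    SubRiem.IsVolumeForm o (SubRiem.poppForm hN o) ∧
    SubRiem.IsFormMeasure (SubRiem.poppForm hN o) (SubRiem.poppMeasure hN o) ∧
    -- the Popp measure of the submanifold is a smooth volume
    SubRiem.IsSmoothVolume o (SubRiem.poppMeasure hN o) := by
  refine ⟨fun p i => ⟨S.existsUnique_isBracketMap _ _, S.bracketMap_surjective _ _⟩, fun p => ?_,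
    fun p => (SubRiem.poppForm_spec hN o p).1, SubRiem.isVolumeForm_poppForm hN ho,
    SubRiem.isFormMeasure_formMeasure _,
    SubRiem.poppForm hN o, SubRiem.isVolumeForm_poppForm hN ho,
    SubRiem.isFormMeasure_formMeasure _⟩
  obtain ⟨v, -, hv⟩ := SubRiem.exists_isVolumeElement hN p
  exact ⟨v, hv⟩
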